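/- **Setting.** Let $M=G/K$ be a compact simply connected symmetric space: $G$ is a compact connected Lie group acting smoothly and transitively on the manifold $M$, $K$ is the stabilizer of a point $o\in M$, $\sigma\neq\mathrm{id}$ is an involutive automorphism of $G$ with $\mathrm{Fix}(\sigma)_0\subseteq K\subseteq\mathrm{Fix}(\sigma)$, and $M$ carries a $G$-invariant Riemannian metric. Let $\mathfrak m\subseteq\mathfrak g$ be the $(-1)$-eigenspace of $\mathrm D\sigma_e$, let $\mathrm{Exp}(X)=\exp(X).o$ for $X\in\mathfrak m$, let $\mathfrak a\subseteq\mathfrak m$ be a maximal abelian subalgebra, and suppose that the rank $\dim\mathfrak a$ of $M$ is at least $2$. Let $\mathfrak h\supseteq\mathfrak a$ be a Cartan subalgebra of $\mathfrak g_{\mathbb C}$. A root of $\mathfrak g_{\mathbb C}$ is an element $0\ne\alpha\in\mathfrak h^*$ for which there is $0\ne X\in\mathfrak g_{\mathbb C}$ with $[H,X]=\pi i\,\alpha(H)X$ for all $H\in\mathfrak h$; a singular plane is a set $\{H\in\mathfrak a\mid\alpha(H)=n\}$ with $n\in\mathbb Z$ and $\alpha$ a root with $\alpha|_{\mathfrak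 a}\neq0$. **Loop space and intersection multiplicity.** $\Omega_oM$ is the space of absolutely continuous loops $\gamma:[0,1]\to M$ at $o$ of finite energy $E(\gamma)=\frac12\int_0^1|\dot\gamma|^2\,dt$, with the $H^1$-topology. Let $R$ be a commutative ring with unit. For $[x]\in H_*(\Omega_oM;R)$ put $$\mathrm{int}([x])=\inf_{A\sim x}\Big(\sup\{\#\gamma^{-1}(\{o\})\mid\gamma\in\mathrm{im}(A),\ E(\gamma)>0\}\Big)-1,$$ where $A$ runs through the singular cycles of $\Omega_oM$ homologous to $x$, $\mathrm{im}(A)$ is the union of the images of the simplices occurring in $A$, and $\inf$ and $\sup$ are taken in the extended real numbers (so $\sup\emptyset=-\infty$). **The classes $P_*$.** Let $P=(p_1,\dots,p_m)$, $m\ge0$, be an ordered family of singular planes. Let $K_0$ and $K_{p_i}$ be the subgroups of $K$ which fix $\mathrm{Exp}(\mathfrak a)$, respectively $\mathrm{Exp}(p_i)$, pointwise. Let $\Gamma_P=(K_{p_1}\times\dots\times K_{p_m})/K_0^m$ for the right action $$(k_1,\dots,k_m)\cdot(h_1,\dots,h_m)=(k_1h_1,\,h_1^{-1}k_2h_2,\,\dots,\,h_{m-1}^{-1}k_mh_m).$$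 Let $c_0,\dots,c_m$ be polygons in $\mathfrak a$, $c_i$ parametrized on $[\frac i{m+1},\frac{i+1}{m+1}]$, such that $c_0$ starts at $0$, the end of $c_{i-1}$ is the start of $c_i$ and lies on $p_i$ for $1\le i\le m$, and $c_m$ ends at $0$. **Proposition.** Concatenation of the paths $\mathrm{Exp}(c_0),\ k_1\mathrm{Exp}(c_1),\ \dots,\ k_1\cdots k_m\mathrm{Exp}(c_m)$ defines a continuous map $f_P:\Gamma_P\to\Omega_oM$. With $P_*=(f_P)_*[\Gamma_P]$ the following hold. 1. For $\mathbb Z_2$-coefficients and the $\mathbb Z_2$-fundamental class $[\Gamma_P]$, the class $P_*\in H_*(\Omega_oM;\mathbb Z_2)$ satisfies $\mathrm{int}(P_*)\le1$, and $\mathrm{int}(P_*)=1$ if the image of $P_*$ in $H_*(\Omega_oM,o;\mathbb Z_2)$ is non-zero. 2. The same holds for $P_*\in H_*(\Omega_oM;R)$ for every commutative ring $R$ with unit for which $\Gamma_P$ is $R$-orientable and every $R$-fundamental class $[\Gamma_P]\in H_*(\Gamma_P;R)$. In particular, if $\Gamma_P$ is orientable, then it holds with arbitrary coefficients. -/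

import Mathlib

open scoped Manifold ContDiff TensorProduct

universe u

noncomputable section

/-! ## Singular homology of pairs, with explicit chains -/

section SingularHomology

/-- Singular `n`-simplices of `X`. -/
abbrev SingularSimplex (X : Type*) [TopologicalSpace X] (n : ℕ) : Type _ :=
  C(stdSimplex ℝ (Fin (n + 1)), X)

/-- Singular `n`-chains of `X` with coefficients in `R`. -/
abbrev SingularChain (R : Type*) [CommRing R] (X : Type*) [TopologicalSpace X] (n : ℕ) : Type _ :=
  SingularSimplex X n →₀ R

/-- The inclusion of the `i`-th face of the standard simplex. -/
def simplexFace {n : ℕ} (i : Fin (n + 2)) :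
    C(stdSimplex ℝ (Fin (n + 1)), stdSimplex ℝ (Fin (n + 2))) :=
  ⟨stdSimplex.map i.succAbove, stdSimplex.continuous_map _⟩

variable (R : Type*) [CommRing R] {X Y : Type*} [TopologicalSpace X] [TopologicalSpace Y]

/-- The singular boundary operator `∂ s = ∑ i, (-1) ^ i • (s ∘ face i)`. -/
def singularBoundary (X : Type*) [TopologicalSpace X] (n : ℕ) :
    SingularChain R X (n + 1) →ₗ[R] SingularChain R X n :=
  ∑ i : Fin (n + 2), ((-1 : R) ^ (i : ℕ)) •
    Finsupp.lmapDomain R R (fun s : SingularSimplex X (n + 1) => s.comp (simplexFace i))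

/-- The chain map induced by a continuous map. -/
def singularChainMap (f : C(X, Y)) (n : ℕ) : SingularChain R X n →ₗ[R] SingularChain R Y n :=
  Finsupp.lmapDomain R R (fun s : SingularSimplex X n => f.comp s)

/-- The singular chains of `X` which lie in the subspace `A`. -/
def chainsIn (A : Set X) (n : ℕ) : Submodule R (SingularChain R X n) :=
  Finsupp.supported R R {s : SingularSimplex X n | Set.range s ⊆ A}

/-- The relative cycles of `(X, A)`: the chains whose boundary lies in `A`. -/
def relCycles (A : Set X) : (n : ℕ) → Submodule R (SingularChain R X n)
  | 0 => ⊤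
  | n + 1 => (chainsIn R A n).comap (singularBoundary R X n)

/-- The relative boundaries of `(X, A)`: the boundaries modulo the chains in `A`. -/
def relBoundaries (A : Set X) (n : ℕ) : Submodule R (SingularChain R X n) :=
  LinearMap.range (singularBoundary R X n) ⊔ chainsIn R A n

/-- Singular homology `H_n(X, A; R)` of a pair: the classes of the relative cycles in the quotient of
the chains by the relative boundaries. As no simplex is empty, `A = ∅` gives the absolute homology
`H_n(X; R)`. -/
abbrev RelHomology (X : Type*) [TopologicalSpace X] (A : Set X) (n : ℕ) : Type _ :=
  ↥((relCycles R A n).map (relBoundaries R A n).mkQ)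

/-- Singular homology `H_n(X; R)`. -/
abbrev SingHomology (X : Type*) [TopologicalSpace X] (n : ℕ) : Type _ :=
  RelHomology R X ∅ n

/-- The homology class of a (relative) cycle. -/
def homologyClass (A : Set X) (n : ℕ) (c : relCycles R A n) : RelHomology R X A n :=
  ⟨(relBoundaries R A n).mkQ c, Submodule.mem_map_of_mem c.2⟩

theorem singularBoundary_chainMap (f : C(X, Y)) (n : ℕ) (c : SingularChain R X (n + 1)) :
    singularBoundary R Y n (singularChainMap R f (n + 1) c) =
      singularChainMap R f n (singularBoundary R X n c) := by
  simp only [singularBoundary, singularChainMap, LinearMap.sum_apply, LinearMap.smul_apply,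
    map_sum, map_smul, Finsupp.lmapDomain_apply, ← Finsupp.mapDomain_comp]
  rfl

theorem singularChainMap_mem_chainsIn {f : C(X, Y)} {A : Set X} {B : Set Y}
    (h : Set.MapsTo f A B) {n : ℕ} {c : SingularChain R X n} (hc : c ∈ chainsIn R A n) :
    singularChainMap R f n c ∈ chainsIn R B n := by
  have h2 : singularChainMap R f n c ∈ (chainsIn R A n).map (singularChainMap R f n) :=
    Submodule.mem_map_of_mem hc
  unfold chainsIn singularChainMap at h2
  rw [Finsupp.lmapDomain_supported] at h2
  refine Finsupp.supported_mono ?_ h2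
  rintro _ ⟨s, hs, rfl⟩ _ ⟨x, rfl⟩
  exact h (hs ⟨x, rfl⟩)

theorem singularChainMap_mem_relCycles {f : C(X, Y)} {A : Set X} {B : Set Y}
    (h : Set.MapsTo f A B) {n : ℕ} {c : SingularChain R X n} (hc : c ∈ relCycles R A n) :
    singularChainMap R f n c ∈ relCycles R B n := by
  cases n with
  | zero => trivial
  | succ n =>
    change singularBoundary R Y n _ ∈ chainsIn R B n
    rw [singularBoundary_chainMap]
    exact singularChainMap_mem_chainsIn R h hc

theorem singularChainMap_mem_relBoundaries {f : C(X, Y)} {A : Set X} {B : Set Y}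
    (h : Set.MapsTo f A B) {n : ℕ} {c : SingularChain R X n} (hc : c ∈ relBoundaries R A n) :
    singularChainMap R f n c ∈ relBoundaries R B n := by
  obtain ⟨_, ⟨b, rfl⟩, a, ha, rfl⟩ := Submodule.mem_sup.1 hc
  rw [map_add, ← singularBoundary_chainMap]
  exact Submodule.add_mem_sup ⟨_, rfl⟩ (singularChainMap_mem_chainsIn R h ha)

/-- The map `H_n(X, A; R) → H_n(Y, B; R)` induced by a continuous map of pairs. -/
def homologyMap (f : C(X, Y)) (A : Set X) (B : Set Y) (h : Set.MapsTo f A B) (n : ℕ) :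
    RelHomology R X A n →ₗ[R] RelHomology R Y B n :=
  ((relBoundaries R A n).mapQ (relBoundaries R B n) (singularChainMap R f n)
    fun _ hc => singularChainMap_mem_relBoundaries R h hc).restrict (by
      rintro _ ⟨c, hc, rfl⟩
      exact ⟨_, singularChainMap_mem_relCycles R h hc, rfl⟩)

/-- The map `f_* : H_n(X; R) → H_n(Y; R)`. -/
def pushforward (f : C(X, Y)) (n : ℕ) : SingHomology R X n →ₗ[R] SingHomology R Y n :=
  homologyMap R f ∅ ∅ (Set.mapsTo_empty _ _) n

/-- The map `H_n(X; R) → H_n(X, A; R)`. -/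
def toRelative (A : Set X) (n : ℕ) : SingHomology R X n →ₗ[R] RelHomology R X A n :=
  homologyMap R (ContinuousMap.id X) ∅ A (Set.mapsTo_empty _ _) n

/-- `μ ∈ H_n(X; R)` is an `R`-fundamental class of the closed manifold `X`: for each point `x` its
image in `H_n(X, X ∖ {x}; R)` is a generator of a free `R`-module of rank one. (A closed manifold
has such a class iff it is `R`-orientable, and if `R ≠ 0`, then `n` is necessarily its
dimension.) -/
def IsFundamentalClass {n : ℕ} (μ : SingHomology R X n) : Prop :=
  ∀ x : X, Function.Bijective fun r : R => r • toRelative R ({x}ᶜ : Set X) n μ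

/-- The image `im(A)` of a chain: the union of the images of the simplices which occur in it. -/
def chainImage {n : ℕ} (A : SingularChain R X n) : Set X :=
  ⋃ s ∈ A.support, Set.range s

end SingularHomology

/-! ## The based loop space of a Riemannian manifold -/

section LoopSpace

variable {d : ℕ} {M : Type*} [TopologicalSpace M] [ChartedSpace (EuclideanSpace ℝ (Fin d)) M]
  [IsManifold (𝓡 d) ∞ M]

/-- Smooth Riemannian metrics on `M`. -/
abbrev SmoothMetric (d : ℕ) (M : Type*) [TopologicalSpace M]
    [ChartedSpace (EuclideanSpace ℝ (Fin d)) M] [IsManifold (𝓡 d) ∞ M] : Type _ :=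
  Bundle.ContMDiffRiemannianMetric (𝓡 d) ∞ (EuclideanSpace ℝ (Fin d))
    (fun x : M => TangentSpace (𝓡 d) x)

/-- A path, as a function on `ℝ` which is constant outside of `[0, 1]`. -/
def pathExtend {M : Type*} [TopologicalSpace M] (γ : C(unitInterval, M)) (t : ℝ) : M :=
  γ (Set.projIcc 0 1 zero_le_one t)

/-- The velocity of a path (used at almost every time only). -/
def velocity (d : ℕ) {M : Type*} [TopologicalSpace M] [ChartedSpace (EuclideanSpace ℝ (Fin d)) M]
    (γ : C(unitInterval, M)) (t : ℝ) : TangentSpace (𝓡 d) (pathExtend γ t) :=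
  mfderiv 𝓘(ℝ, ℝ) (𝓡 d) (pathExtend γ) t (1 : ℝ)

/-- Absolute continuity of a path in `M`: it is absolutely continuous in all smooth charts. -/
def IsAbsContPath (d : ℕ) {M : Type*} [TopologicalSpace M]
    [ChartedSpace (EuclideanSpace ℝ (Fin d)) M] (γ : C(unitInterval, M)) : Prop :=
  ∀ e ∈ IsManifold.maximalAtlas (𝓡 d) ∞ M, ∀ a b : ℝ, 0 ≤ a → a ≤ b → b ≤ 1 →
    (∀ t ∈ Set.Icc a b, pathExtend γ t ∈ e.source) →
      AbsolutelyContinuousOnInterval (fun t => e (pathExtend γ t)) a b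

/-- The energy `E(γ) = 1/2 ∫₀¹ g(γ', γ') dt`, with values in `[0, ∞]`. -/
def energy (g : SmoothMetric d M) (γ : C(unitInterval, M)) : ENNReal :=
  2⁻¹ * ∫⁻ t in Set.Icc (0 : ℝ) 1,
    ENNReal.ofReal (g.inner (pathExtend γ t) (velocity d γ t) (velocity d γ t))

/-- The based loop space `Ω_o M` of absolutely continuous loops of finite energy. -/
def BasedLoopSpace (g : SmoothMetric d M) (o : M) : Type _ :=
  {γ : C(unitInterval, M) // IsAbsContPath d γ ∧ energy g γ < ⊤ ∧ γ 0 = o ∧ γ 1 = o}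

/-- The `H¹`-distance of `f ∘ γ` and `f ∘ η`, for a smooth function `f : M → ℝ`. -/
def loopDist {g : SmoothMetric d M} {o : M} (f : M → ℝ) (γ η : BasedLoopSpace g o) : ENNReal :=
  (⨆ t : unitInterval, ENNReal.ofReal |f (γ.1 t) - f (η.1 t)|) +
    MeasureTheory.eLpNorm
      (fun t : ℝ => deriv (fun s => f (pathExtend γ.1 s)) t -
        deriv (fun s => f (pathExtend η.1 s)) t)
      2 (MeasureTheory.volume.restrict (Set.Icc 0 1))

/-- The `H¹`-topology, which underlies the Hilbert manifold structure of the loop space: the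
coarsest topology for which `γ ↦ f ∘ γ ∈ H¹([0, 1], ℝ)` is continuous for all smooth
`f : M → ℝ`. (For an embedding of `M` in a Euclidean space `ℝ^N` it is the subspace topology
of `H¹([0, 1], ℝ^N)`.) -/
instance (g : SmoothMetric d M) (o : M) : TopologicalSpace (BasedLoopSpace g o) :=
  TopologicalSpace.generateFrom
    {U | ∃ f : M → ℝ, ContMDiff (𝓡 d) 𝓘(ℝ, ℝ) ∞ f ∧
      ∃ (γ : BasedLoopSpace g o) (ε : ENNReal), 0 < ε ∧ U = {η | loopDist f γ η < ε}}

/-- The set of the constant loops at `o`, which has at most one element. -/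
def constantLoop (g : SmoothMetric d M) (o : M) : Set (BasedLoopSpace g o) :=
  {γ | ∀ t, γ.1 t = o}

/-- The intersection multiplicity
`int(a) = inf_{A ∼ x} (sup {#(γ⁻¹{o}) | γ ∈ im(A), E(γ) > 0}) - 1`, where `A` runs through the
cycles which represent the class `a = [x]`. Infimum and supremum are those of the extended
real numbers; in particular `sup ∅ = -∞`. -/
def intersectionMultiplicity (R : Type*) [CommRing R] {g : SmoothMetric d M} {o : M} {n : ℕ}
    (a : SingHomology R (BasedLoopSpace g o) n) : EReal :=
  (⨅ (A : relCycles R (∅ : Set (BasedLoopSpace g o)) n) (_ : homologyClass R ∅ n A = a),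
    ⨆ (γ : BasedLoopSpace g o) (_ : γ ∈ chainImage R A.1) (_ : 0 < energy g γ.1),
      (((γ.1 ⁻¹' {o}).encard : ENNReal) : EReal)) - 1

end LoopSpace

/-! ## Symmetric spaces -/

section SymmetricSpaces

variable {n d : ℕ} {G M : Type*}
  [TopologicalSpace G] [ChartedSpace (EuclideanSpace ℝ (Fin n)) G] [Group G]
  [LieGroup (𝓡 n) ∞ G]
  [TopologicalSpace M] [ChartedSpace (EuclideanSpace ℝ (Fin d)) M] [IsManifold (𝓡 d) ∞ M]
  [MulAction G M]

/-- Smooth Lie groups have the regularity needed for Mathlib's Lie algebra of a Lie group. -/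
instance lieGroup_minSmoothness {n : ℕ} {G : Type*} [TopologicalSpace G]
    [ChartedSpace (EuclideanSpace ℝ (Fin n)) G] [Group G] [LieGroup (𝓡 n) ∞ G] :
    LieGroup (𝓡 n) (minSmoothness ℝ 3) G :=
  LieGroup.of_le (n := ∞) (by
    rw [minSmoothness_of_isRCLikeNormedField]
    exact ENat.LEInfty.out)

/-- A presentation `M = G/K` of `M` as a Riemannian symmetric space, with `K` the stabilizer of the
basepoint `o`: an involution `σ ≠ id` of the Lie group `G` with `Fix(σ)₀ ⊆ K ⊆ Fix(σ)` and a
`G`-invariant Riemannian metric on `M`. (`G` is assumed to act smoothly and transitively.) -/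
structure SymmetricSpace (n d : ℕ) (G M : Type*)
    [TopologicalSpace G] [ChartedSpace (EuclideanSpace ℝ (Fin n)) G] [Group G]
    [LieGroup (𝓡 n) ∞ G]
    [TopologicalSpace M] [ChartedSpace (EuclideanSpace ℝ (Fin d)) M] [IsManifold (𝓡 d) ∞ M]
    [MulAction G M] where
  /-- the basepoint -/
  o : M
  /-- the involution of `G` -/
  σ : G →* G
  contMDiff_σ : ContMDiff (𝓡 n) (𝓡 n) ∞ σ
  σ_σ : ∀ x, σ (σ x) = x
  σ_ne_id : σ ≠ MonoidHom.id G
  stabilizer_subset : (MulAction.stabilizer G o : Set G) ⊆ {x | σ x = x}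
  subset_stabilizer : connectedComponentIn {x | σ x = x} 1 ⊆ (MulAction.stabilizer G o : Set G)
  /-- the Riemannian metric of `M` -/
  g : SmoothMetric d M
  g_invariant : ∀ (a : G) (x : M) (v w : TangentSpace (𝓡 d) x),
    g.inner (a • x) (mfderiv (𝓡 d) (𝓡 d) (fun y : M => a • y) x v)
      (mfderiv (𝓡 d) (𝓡 d) (fun y : M => a • y) x w) = g.inner x v w

/-- The Lie group exponential `exp X = φ(1)`, where `φ` is the integral curve through `1` of the
left invariant vector field defined by `X`. (There always is exactly one such curve.) -/
def lieExp (n : ℕ) {G : Type*} [TopologicalSpace G] [ChartedSpace (EuclideanSpace ℝ (Fin n)) G]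
    [Group G] (X : GroupLieAlgebra (𝓡 n) G) : G :=
  open Classical in
  if h : ∃ φ : ℝ → G, φ 0 = 1 ∧
      IsMIntegralCurve (I := 𝓡 n) φ (mulInvariantVectorField (I := 𝓡 n) X)
  then h.choose 1 else 1

/-- The map `Exp : 𝔤 → M`, `Exp X = exp X • o`. -/
def SymmetricSpace.Exp (S : SymmetricSpace n d G M) (X : GroupLieAlgebra (𝓡 n) G) : M :=
  lieExp n X • S.o

/-- The isotropy group `K`. -/
abbrev SymmetricSpace.K (S : SymmetricSpace n d G M) : Subgroup G := MulAction.stabilizer G S.o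

/-- `X ∈ 𝔪`, i.e. `X` lies in the `(-1)`-eigenspace of the differential of `σ` at `1`. -/
def SymmetricSpace.MemM (S : SymmetricSpace n d G M) (X : GroupLieAlgebra (𝓡 n) G) : Prop :=
  (mfderiv (𝓡 n) (𝓡 n) S.σ 1 X : EuclideanSpace ℝ (Fin n)) = (-X : EuclideanSpace ℝ (Fin n))

/-- `𝔟` is an abelian subalgebra of `𝔤` which is contained in `𝔪`. -/
def SymmetricSpace.IsAbelianIn (S : SymmetricSpace n d G M)
    (𝔟 : Submodule ℝ (GroupLieAlgebra (𝓡 n) G)) : Prop :=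
  (∀ X ∈ 𝔟, S.MemM X) ∧ ∀ X ∈ 𝔟, ∀ Y ∈ 𝔟, ⁅X, Y⁆ = 0

/-- `𝔞` is a maximal abelian subalgebra of `𝔪`; its dimension is the rank of `M`. -/
def SymmetricSpace.IsMaximalAbelian (S : SymmetricSpace n d G M)
    (𝔞 : Submodule ℝ (GroupLieAlgebra (𝓡 n) G)) : Prop :=
  S.IsAbelianIn 𝔞 ∧ ∀ 𝔟, S.IsAbelianIn 𝔟 → 𝔞 ≤ 𝔟 → 𝔟 = 𝔞

/-- `β` is a root of `𝔤_ℂ` with respect to the Cartan subalgebra `𝔥`, in the normalization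
`[H, X] = π i β(H) X`. -/
def IsComplexRoot (𝔥 : LieSubalgebra ℂ (ℂ ⊗[ℝ] GroupLieAlgebra (𝓡 n) G))
    (β : Module.Dual ℂ 𝔥) : Prop :=
  β ≠ 0 ∧ ∃ X : ℂ ⊗[ℝ] GroupLieAlgebra (𝓡 n) G, X ≠ 0 ∧
    ∀ H : 𝔥, ⁅(H : ℂ ⊗[ℝ] GroupLieAlgebra (𝓡 n) G), X⁆ = (Real.pi * Complex.I * β H) • X

/-- `α` is a root of the symmetric space: the non-zero restriction to `𝔞` of a root of `𝔤_ℂ`. (Such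
a restriction is real valued.) -/
def IsRoot (𝔞 : Submodule ℝ (GroupLieAlgebra (𝓡 n) G))
    (𝔥 : LieSubalgebra ℂ (ℂ ⊗[ℝ] GroupLieAlgebra (𝓡 n) G)) (α : Module.Dual ℝ 𝔞) : Prop :=
  α ≠ 0 ∧ ∃ β : Module.Dual ℂ 𝔥, IsComplexRoot 𝔥 β ∧
    ∀ (H : 𝔞) (Z : 𝔥), (Z : ℂ ⊗[ℝ] GroupLieAlgebra (𝓡 n) G) =
      (1 : ℂ) ⊗ₜ[ℝ] (H : GroupLieAlgebra (𝓡 n) G) → β Z = (α H : ℂ)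

/-- The singular planes `(α, k) = {H ∈ 𝔞 | α(H) = k}` for roots `α` and integers `k`. -/
def IsSingularPlane (𝔞 : Submodule ℝ (GroupLieAlgebra (𝓡 n) G))
    (𝔥 : LieSubalgebra ℂ (ℂ ⊗[ℝ] GroupLieAlgebra (𝓡 n) G)) (p : Set 𝔞) : Prop :=
  ∃ (α : Module.Dual ℝ 𝔞) (k : ℤ), IsRoot 𝔞 𝔥 α ∧ p = {H | α H = k}

/-- The subgroup of those elements of `K` which fix `Exp(p)` pointwise. For a singular plane `p`
this is `K_p`, and for `p = 𝔞` it is the pointwise stabilizer `K_0` of the maximal torus. -/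
def SymmetricSpace.fixing (S : SymmetricSpace n d G M)
    (𝔞 : Submodule ℝ (GroupLieAlgebra (𝓡 n) G)) (p : Set 𝔞) : Subgroup G :=
  S.K ⊓ fixingSubgroup G ((fun H : 𝔞 => S.Exp H) '' p)

/-- The pointwise stabilizer `K_0` in `K` of the maximal torus `T = Exp(𝔞)`. -/
abbrev SymmetricSpace.K₀ (S : SymmetricSpace n d G M)
    (𝔞 : Submodule ℝ (GroupLieAlgebra (𝓡 n) G)) : Subgroup G :=
  S.fixing 𝔞 Set.univ

/-- `W(P) = K_{p_1} × ⋯ × K_{p_m}`. -/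
abbrev SymmetricSpace.W (S : SymmetricSpace n d G M)
    (𝔞 : Submodule ℝ (GroupLieAlgebra (𝓡 n) G)) {m : ℕ} (P : Fin m → Set 𝔞) : Type _ :=
  ∀ i : Fin m, S.fixing 𝔞 (P i)

/-- `k'` arises from `k` by the right action of some `h ∈ K_0^m`, i.e.
`k' = (k_1 h_1, h_1⁻¹ k_2 h_2, …, h_{m-1}⁻¹ k_m h_m)`. (We put `h_0 = 1`.) -/
def SymmetricSpace.SameOrbit (S : SymmetricSpace n d G M)
    (𝔞 : Submodule ℝ (GroupLieAlgebra (𝓡 n) G)) {m : ℕ} (P : Fin m → Set 𝔞)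
    (k k' : S.W 𝔞 P) : Prop :=
  ∃ h : Fin (m + 1) → S.K₀ 𝔞, h 0 = 1 ∧
    ∀ i : Fin m, (k' i : G) = (h i.castSucc : G)⁻¹ * (k i : G) * (h i.succ : G)

/-- The manifold `Γ_P = W(P) / K_0^m`, with the quotient topology. -/
abbrev SymmetricSpace.Γ (S : SymmetricSpace n d G M)
    (𝔞 : Submodule ℝ (GroupLieAlgebra (𝓡 n) G)) {m : ℕ} (P : Fin m → Set 𝔞) : Type _ :=
  Quot (S.SameOrbit 𝔞 P)

/-- `c` restricts to a polygon, i.e. to a continuous piecewise affine curve, on `[a, b]`. -/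
def IsPolygonOn {V : Type*} [AddCommGroup V] [Module ℝ V] (c : ℝ → V) (a b : ℝ) : Prop :=
  ∃ (N : ℕ) (τ : ℕ → ℝ), Monotone τ ∧ τ 0 = a ∧ τ N = b ∧
    ∀ j < N, ∃ u v : V, ∀ t ∈ Set.Icc (τ j) (τ (j + 1)), c t = u + t • v

/-- An ordered family of polygons `c = (c_0, …, c_m)` in `𝔞` for the ordered family of singular
planes `P = (p_1, …, p_m)`: `c_i` is a polygon on `[i/(m+1), (i+1)/(m+1)]`, `c_0` starts at `0`,
the end of `c_{i-1}` is the start of `c_i` and lies on `p_i`, and `c_m` ends at `0`. (The entry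
`p_{i+1}` is `P i`.) -/
structure IsPolygonFamily {V : Type*} [AddCommGroup V] [Module ℝ V] {m : ℕ}
    (P : Fin m → Set V) (c : Fin (m + 1) → ℝ → V) : Prop where
  polygon : ∀ i : Fin (m + 1), IsPolygonOn (c i) (i / (m + 1)) ((i + 1) / (m + 1))
  start : c 0 0 = 0
  finish : c (Fin.last m) 1 = 0
  joint : ∀ i : Fin m,
    c i.castSucc ((i + 1) / (m + 1)) = c i.succ ((i + 1) / (m + 1))
  mem_plane : ∀ i : Fin m, c i.succ ((i + 1) / (m + 1)) ∈ P i

/-- `f` is the map `f_P : Γ_P → Ω_o M` defined by the family of polygons `c`: on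
`[i/(m+1), (i+1)/(m+1)]` the loop `f_P [k_1, …, k_m]` is `k_1 ⋯ k_i Exp(c_i)`. -/
def SymmetricSpace.IsBottSamelsonMap (S : SymmetricSpace n d G M)
    (𝔞 : Submodule ℝ (GroupLieAlgebra (𝓡 n) G)) {m : ℕ} (P : Fin m → Set 𝔞)
    (c : Fin (m + 1) → ℝ → 𝔞) (f : S.Γ 𝔞 P → BasedLoopSpace S.g S.o) : Prop :=
  ∀ (k : S.W 𝔞 P) (i : Fin (m + 1)) (t : unitInterval),
    (t : ℝ) ∈ Set.Icc ((i : ℝ) / (m + 1)) ((i + 1) / (m + 1)) →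
      (f (Quot.mk _ k)).1 t = Fin.partialProd (fun j => (k j : G)) i • S.Exp (c i t)

end SymmetricSpaces

end

open scoped Manifold ContDiff TensorProduct

noncomputable section

/-! ## Homotopy invariance of singular homology -/

section HomotopyInvariance

/-! Upper bound. The class $P_*$ does not depend on the polygons. Two families for the same planes
are joined by linear interpolation in `𝔞`; since each plane is affine, the joints stay on it and are
still fixed by $K_{p_i}$, so the interpolated loops close up and descend to $\Gamma_P$. This is
`SymmetricSpace.exists_homotopy`, to be combined with homotopy invariance of singular homology.

The polygons may therefore be chosen freely. The vectors of `𝔞` which `Exp` sends to `o` form a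
closed subgroup. It contains no line: if $\exp(tX)\in K\subseteq\mathrm{Fix}(\sigma)$ for all $t$,
then $\mathrm D\sigma_e X=X$, whereas $X\in\mathfrak m$ gives $-X$. So the subgroup is countable. As
$\dim\mathfrak a\ge2$, both the joints (on planes of positive dimension) and the segments between
them can be moved off this countable set (`IsPolygonFamily.exists_avoiding`). The elements
$k_1\cdots k_i$ fix `o`, so the new loops meet `o` at the times 0 and 1 only. Since $P_*$ has a
representing cycle inside the image of the new map, the supremum is at most 2 for this cycle.

Lower bound. Every based loop is at `o` at both ends, so a supremum below 2 forces all loops of the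
cycle to have zero energy. An absolutely continuous path of zero energy is constant, hence such a
cycle lies in the constant loop and its relative class vanishes (`one_le_intersectionMultiplicity`).
Both bounds work for every coefficient ring.

The analytic work is the continuity of the families in the $H^1$-topology
(`continuous_of_isBrokenPath`). It relies on the identity $\exp(X+Y)=\exp X\exp Y$ for commuting
$X,Y$ (`modelExp_add`), which turns affine segments in `𝔞` into translated one-parameter subgroups.
Velocities are then values of left invariant fields, and everything is uniform on compact sets. -/

/-- The summation identity behind the prism operator. -/
theorem sum_prism {A : Type*} [AddCommGroup A] {n : ℕ} (a : Fin (n + 2) → Fin (n + 1) → A)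
    (b : Fin (n + 3) → Fin (n + 2) → A)
    (hle : ∀ i j, i ≤ Fin.castSucc j → b i.castSucc j.succ = a i j)
    (hlt : ∀ i j, Fin.castSucc j < i → b i.succ j.castSucc = a i j)
    (heq : ∀ j : Fin (n + 1), b j.castSucc.succ j.succ = b j.castSucc.succ j.castSucc) :
    ∑ i : Fin (n + 3), ∑ j : Fin (n + 2), ((-1 : ℤ) ^ (i + j : ℕ)) • b i j =
      b 0 0 - b (Fin.last _) (Fin.last _) -
        ∑ i : Fin (n + 2), ∑ j : Fin (n + 1), ((-1 : ℤ) ^ (i + j : ℕ)) • a i j := by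
  let α (x : Fin (n + 2) × Fin (n + 1)) := (-1 : ℤ) ^ ((x.1 + x.2 : ℕ)) • a x.1 x.2
  let β (x : Fin (n + 3) × Fin (n + 2)) := (-1 : ℤ) ^ ((x.1 + x.2 : ℕ)) • b x.1 x.2
  rw [← Finset.sum_product .univ .univ α, ← Finset.sum_product .univ .univ β,
    Finset.univ_product_univ, Finset.univ_product_univ]
  -- The index pairs of `b` split into four images and two corners: `γ₁` and `γ₂` give the faces
  -- which are prisms over faces, `γ₃` and `γ₄` index the common faces of neighbouring simplices,
  -- which cancel in pairs, and the corners are the two ends of the prism.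
  let S : Finset (Fin (n + 2) × Fin (n + 1)) := { x | x.2.castSucc < x.1 }
  let γ₁ (x : Fin (n + 2) × Fin (n + 1)) := (x.1.castSucc, x.2.succ)
  let γ₂ (x : Fin (n + 2) × Fin (n + 1)) := (x.1.succ, x.2.castSucc)
  let γ₃ (i : Fin (n + 1)) := (i.castSucc.succ, i.succ)
  let γ₄ (i : Fin (n + 1)) := (i.castSucc.succ, i.castSucc)
  have hγ₁ : Function.Injective γ₁ := fun _ _ ↦ by aesop
  have hγ₂ : Function.Injective γ₂ := fun _ _ ↦ by aesop
  have hγ₃ : Function.Injective γ₃ := fun _ _ ↦ by aesop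
  have hγ₄ : Function.Injective γ₄ := fun _ _ ↦ by aesop
  have eq₁ : b 0 0 = β ⟨0, 0⟩ := by simp [β]
  have eq₂ : b (Fin.last _) (Fin.last _) = - β ⟨Fin.last _, Fin.last _⟩ := by
    have : (-1 : ℤ) ^ (n + 2 + (n + 1)) = -1 := Odd.neg_one_pow ⟨n + 1, by ring⟩
    simp [β, this]
  have eq₃ : ∑ x ∈ Sᶜ, α x = - ∑ y ∈ Finset.image γ₁ Sᶜ, β y := by
    rw [← Finset.sum_neg_distrib, Finset.sum_image hγ₁.injOn]
    refine Finset.sum_congr rfl fun x hx ↦ ?_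
    simp only [α, β, γ₁, hle x.1 x.2 (by simpa [S] using hx), Fin.val_castSucc, Fin.val_succ,
      ← add_assoc, pow_succ, mul_neg, mul_one, neg_smul, neg_neg]
  have eq₄ : ∑ x ∈ S, α x = - ∑ y ∈ Finset.image γ₂ S, β y := by
    rw [← Finset.sum_neg_distrib, Finset.sum_image hγ₂.injOn]
    refine Finset.sum_congr rfl fun x hx ↦ ?_
    simp only [α, β, γ₂, hlt x.1 x.2 (by simpa [S] using hx), Fin.val_castSucc, Fin.val_succ,
      add_right_comm _ 1, pow_succ, mul_neg, mul_one, neg_smul, neg_neg]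
  have eq₅ : ∑ x, β (γ₄ x) = - ∑ x, β (γ₃ x) := by
    rw [← Finset.sum_neg_distrib]
    refine Finset.sum_congr rfl fun x hx ↦ ?_
    simp only [β, γ₃, γ₄, heq, Fin.val_castSucc, Fin.val_succ, ← add_assoc, pow_succ, mul_neg,
      mul_one, neg_smul, neg_neg]
  have h₁ : Disjoint (Finset.image γ₁ Sᶜ) (Finset.image γ₂ S) := by
    rw [Finset.disjoint_iff_ne]
    grind [Finset.mem_compl]
  have h₂ : Disjoint (Finset.image γ₃ .univ) (Finset.image γ₄ .univ) := by
    rw [Finset.disjoint_iff_ne]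
    grind
  have h₃ : Disjoint (Finset.disjUnion _ _ h₂) {(0, 0), (Fin.last _, Fin.last _)} := by
    rw [Finset.disjoint_iff_ne]
    simp only [Finset.mem_insert, forall_eq_or_imp, Prod.forall]
    rintro ⟨a, _⟩ ⟨b, _⟩
    simp
    grind
  have h₄ : Disjoint (Finset.disjUnion _ _ h₁) (Finset.disjUnion _ _ h₃) := by
    rw [Finset.disjoint_iff_ne]
    simp only [Finset.compl_filter, not_lt, Finset.disjUnion_eq_union, Finset.mem_union,
      Finset.mem_image, Finset.mem_filter, Finset.mem_univ, true_and, Prod.exists, ne_eq,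
      Finset.mem_insert, Finset.mem_singleton, Prod.forall, Prod.mk.injEq, not_and,
      S, γ₁, γ₂, γ₃, γ₄]
    rintro ⟨a, _⟩ ⟨b, _⟩ (⟨⟨j, _⟩, ⟨k, _⟩, h₁, h₂, h₃⟩ | ⟨⟨j, _⟩, ⟨k, _⟩, h₁, h₂, h₃⟩) _ _
      ((⟨⟨i, _⟩, h₄, h₅⟩ | ⟨⟨i, _⟩, h₄, h₅⟩) | (⟨rfl, rfl⟩ | ⟨rfl, rfl⟩)) <;>
        simp [Fin.ext_iff] at h₁ h₂ h₃ ⊢ <;> grind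
  -- Given disjointness, a count suffices: $(n+2)(n+1)+2(n+1)+2=(n+3)(n+2)$.
  have H : (Finset.disjUnion _ _ h₁)ᶜ = Finset.disjUnion _ _ h₃ :=
    Finset.compl_eq_of_disjoint_of_card_add_eq h₄ (by
      rw [Finset.card_disjUnion, Finset.card_disjUnion, Finset.card_disjUnion,
        Finset.card_image_of_injective _ hγ₁, Finset.card_image_of_injective _ hγ₂,
        Finset.card_image_of_injective _ hγ₃, Finset.card_image_of_injective _ hγ₄]
      simp
      lia)
  rw [eq₁, eq₂, ← S.sum_add_sum_compl α, eq₃, eq₄,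
    ← (Finset.disjUnion _ _ h₁).sum_add_sum_compl, H,
    Finset.sum_disjUnion, Finset.sum_disjUnion, Finset.sum_disjUnion,
    Finset.sum_image hγ₃.injOn, Finset.sum_image hγ₄.injOn,
    Finset.sum_insert (by simp), Finset.sum_singleton, eq₅]
  abel

variable {X Y : Type*} [TopologicalSpace X] [TopologicalSpace Y]

/-- The singular simplex `t ↦ H (χ_* t, s (φ_* t))` for maps `φ` and `χ` of the vertices, where `H`
is a homotopy and `Δ¹` is identified with the unit interval. -/
def prismSimplex (H : C(unitInterval × X, Y)) {n k : ℕ} (φ : Fin (k + 1) → Fin (n + 1))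
    (χ : Fin (k + 1) → Fin 2) (s : SingularSimplex X n) : SingularSimplex Y k :=
  H.comp (.prodMk ⟨fun t => stdSimplexHomeomorphUnitInterval (stdSimplex.map χ t),
      (Homeomorph.continuous _).comp (stdSimplex.continuous_map _)⟩
    (s.comp ⟨stdSimplex.map φ, stdSimplex.continuous_map _⟩))

/-- Together with `prismSimplex_face`, this reduces identities between faces of the prism to
identities between maps of finite vertex sets, which are decided by arithmetic. -/
theorem prismSimplex_comp_face (H : C(unitInterval × X, Y)) {n k : ℕ}
    (φ : Fin (k + 2) → Fin (n + 1)) (χ : Fin (k + 2) → Fin 2) (s : SingularSimplex X n)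
    (j : Fin (k + 2)) :
    (prismSimplex H φ χ s).comp (simplexFace j) =
      prismSimplex H (φ ∘ j.succAbove) (χ ∘ j.succAbove) s := by
  ext t
  simp [prismSimplex, simplexFace, stdSimplex.map_comp_apply]

theorem prismSimplex_face (H : C(unitInterval × X, Y)) {n k : ℕ}
    (φ : Fin (k + 1) → Fin (n + 1)) (χ : Fin (k + 1) → Fin 2) (s : SingularSimplex X (n + 1))
    (j : Fin (n + 2)) :
    prismSimplex H φ χ (s.comp (simplexFace j)) = prismSimplex H (j.succAbove ∘ φ) χ s := by
  ext t
  simp [prismSimplex, simplexFace, stdSimplex.map_comp_apply]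

theorem stdSimplex_map_const {k l : ℕ} (i : Fin (l + 1)) (t : stdSimplex ℝ (Fin (k + 1))) :
    stdSimplex.map (fun _ => i) t = stdSimplex.vertex i := by
  have h : (fun _ : Fin (k + 1) => i) = (fun _ : Fin 1 => i) ∘ fun _ => 0 := rfl
  rw [h, ← stdSimplex.map_comp_apply,
    Subsingleton.elim (stdSimplex.map (fun _ => (0 : Fin 1)) t) (stdSimplex.vertex 0),
    stdSimplex.map_vertex]

theorem prismSimplex_zero (H : C(unitInterval × X, Y)) {n : ℕ} (s : SingularSimplex X n) :
    prismSimplex H id (fun _ => 0) s = (H.comp (.prodMk (.const X 0) (.id X))).comp s := by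
  ext t
  simp [prismSimplex, stdSimplex_map_const]

theorem prismSimplex_one (H : C(unitInterval × X, Y)) {n : ℕ} (s : SingularSimplex X n) :
    prismSimplex H id (fun _ => 1) s = (H.comp (.prodMk (.const X 1) (.id X))).comp s := by
  ext t
  simp [prismSimplex, stdSimplex_map_const]

/-- The `j`-th simplex of the prism over `s`. -/
def prism (H : C(unitInterval × X, Y)) {n : ℕ} (j : Fin (n + 1)) (s : SingularSimplex X n) :
    SingularSimplex Y (n + 1) :=
  prismSimplex H j.predAbove (fun i => if i ≤ j.castSucc then 0 else 1) s

variable (R : Type*) [CommRing R]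

/-- The prism operator. -/
def prismOperator (H : C(unitInterval × X, Y)) (n : ℕ) :
    SingularChain R X n →ₗ[R] SingularChain R Y (n + 1) :=
  ∑ j : Fin (n + 1), ((-1 : R) ^ (j : ℕ)) • Finsupp.lmapDomain R R (prism H j)

theorem val_predAbove {n : ℕ} (p : Fin n) (i : Fin (n + 1)) :
    (p.predAbove i : ℕ) = if (p : ℕ) < i then (i : ℕ) - 1 else i := by
  simp only [Fin.predAbove, Fin.lt_def, Fin.val_castSucc]
  split_ifs <;> simp

theorem val_succAbove {n : ℕ} (p : Fin (n + 1)) (i : Fin n) :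
    (p.succAbove i : ℕ) = if (i : ℕ) < p then (i : ℕ) else i + 1 := by
  simp only [Fin.succAbove, Fin.lt_def, Fin.val_castSucc]
  split_ifs <;> simp

/-- The `j`-th simplex has the vertices $0,\dots,j$ at level 0 and $j,\dots,n$ at level 1. For `j =
0`, dropping the first vertex leaves the end of the prism at level 1. -/
theorem prism_face_zero (H : C(unitInterval × X, Y)) {n : ℕ} (s : SingularSimplex X n) :
    (prism H 0 s).comp (simplexFace 0) = (H.comp (.prodMk (.const X 1) (.id X))).comp s := by
  rw [prism, prismSimplex_comp_face, ← prismSimplex_one]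
  congr 1

theorem prism_face_last (H : C(unitInterval × X, Y)) {n : ℕ} (s : SingularSimplex X n) :
    (prism H (Fin.last n) s).comp (simplexFace (Fin.last (n + 1))) =
      (H.comp (.prodMk (.const X 0) (.id X))).comp s := by
  rw [prism, prismSimplex_comp_face, ← prismSimplex_zero]
  congr 1 <;> ext i <;> simp [Fin.le_def, Fin.is_le]

theorem prism_face_of_le (H : C(unitInterval × X, Y)) {n : ℕ} (s : SingularSimplex X (n + 1))
    (i : Fin (n + 2)) (j : Fin (n + 1)) (h : i ≤ j.castSucc) :
    (prism H j.succ s).comp (simplexFace i.castSucc) = prism H j (s.comp (simplexFace i)) := by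
  rw [prism, prism, prismSimplex_comp_face, prismSimplex_face]
  rw [Fin.le_def, Fin.val_castSucc] at h
  congr 1 <;> ext k <;> simp only [Function.comp, val_predAbove, val_succAbove, Fin.le_def,
    Fin.val_castSucc, Fin.val_succ] <;> split_ifs <;> first | rfl | omega

theorem prism_face_of_lt (H : C(unitInterval × X, Y)) {n : ℕ} (s : SingularSimplex X (n + 1))
    (i : Fin (n + 2)) (j : Fin (n + 1)) (h : j.castSucc < i) :
    (prism H j.castSucc s).comp (simplexFace i.succ) = prism H j (s.comp (simplexFace i)) := by
  rw [prism, prism, prismSimplex_comp_face, prismSimplex_face]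
  rw [Fin.lt_def, Fin.val_castSucc] at h
  congr 1 <;> ext k <;> simp only [Function.comp, val_predAbove, val_succAbove, Fin.le_def,
    Fin.val_castSucc, Fin.val_succ] <;> split_ifs <;> first | rfl | omega

theorem prism_face_succ (H : C(unitInterval × X, Y)) {n : ℕ} (s : SingularSimplex X (n + 1))
    (j : Fin (n + 1)) :
    (prism H j.succ s).comp (simplexFace j.castSucc.succ) =
      (prism H j.castSucc s).comp (simplexFace j.castSucc.succ) := by
  rw [prism, prism, prismSimplex_comp_face, prismSimplex_comp_face]
  congr 1 <;> ext k <;> simp only [Function.comp, val_predAbove, val_succAbove, Fin.le_def,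
    Fin.val_castSucc, Fin.val_succ] <;> split_ifs <;> first | rfl | omega

/-- Integer signs make `sum_prism`, an identity in abelian groups, applicable to chains over any
ring. -/
theorem neg_one_pow_smul_eq {A : Type*} [AddCommGroup A] [Module R A] (k : ℕ) (a : A) :
    ((-1 : R) ^ k) • a = ((-1 : ℤ) ^ k) • a := by
  rcases neg_one_pow_eq_or ℤ k with h | h <;>
    rcases Nat.even_or_odd k with hk | hk <;> simp_all

theorem singularBoundary_single (n : ℕ) (s : SingularSimplex X (n + 1)) (r : R) :
    singularBoundary R X n (Finsupp.single s r) =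
      ∑ i : Fin (n + 2), ((-1 : ℤ) ^ (i : ℕ)) • Finsupp.single (s.comp (simplexFace i)) r := by
  simp only [singularBoundary, LinearMap.sum_apply, LinearMap.smul_apply,
    Finsupp.lmapDomain_apply, Finsupp.mapDomain_single, neg_one_pow_smul_eq]

theorem prismOperator_single (H : C(unitInterval × X, Y)) (n : ℕ) (s : SingularSimplex X n)
    (r : R) : prismOperator R H n (Finsupp.single s r) =
      ∑ j : Fin (n + 1), ((-1 : ℤ) ^ (j : ℕ)) • Finsupp.single (prism H j s) r := by
  simp only [prismOperator, LinearMap.sum_apply, LinearMap.smul_apply,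
    Finsupp.lmapDomain_apply, Finsupp.mapDomain_single, neg_one_pow_smul_eq]

/-- The prism operator is a chain homotopy (in positive degrees). -/
theorem singularBoundary_prismOperator_succ (H : C(unitInterval × X, Y)) (n : ℕ)
    (c : SingularChain R X (n + 1)) :
    singularBoundary R Y (n + 1) (prismOperator R H (n + 1) c) =
      singularChainMap R (H.comp (.prodMk (.const X 1) (.id X))) (n + 1) c -
      singularChainMap R (H.comp (.prodMk (.const X 0) (.id X))) (n + 1) c -
      prismOperator R H n (singularBoundary R X n c) := by
  induction c using Finsupp.induction_linear with
  | zero => simp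
  | add c d hc hd => simp only [map_add, hc, hd]; abel
  | single s r =>
    have h := sum_prism (fun i j => Finsupp.single (prism H j (s.comp (simplexFace i))) r)
      (fun i j => Finsupp.single ((prism H j s).comp (simplexFace i)) r)
      (fun i j h => by rw [prism_face_of_le H s i j h])
      (fun i j h => by rw [prism_face_of_lt H s i j h])
      (fun j => by rw [prism_face_succ H s j])
    simp only [prism_face_zero, prism_face_last] at h
    simp only [prismOperator_single, singularBoundary_single, map_sum, map_zsmul, Finset.smul_sum,
      smul_smul, ← pow_add, singularChainMap, Finsupp.lmapDomain_apply, Finsupp.mapDomain_single]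
    rw [Finset.sum_comm, ← h]
    simp only [add_comm]

theorem singularBoundary_prismOperator_zero (H : C(unitInterval × X, Y))
    (c : SingularChain R X 0) :
    singularBoundary R Y 0 (prismOperator R H 0 c) =
      singularChainMap R (H.comp (.prodMk (.const X 1) (.id X))) 0 c -
      singularChainMap R (H.comp (.prodMk (.const X 0) (.id X))) 0 c := by
  induction c using Finsupp.induction_linear with
  | zero => simp
  | add c d hc hd => simp only [map_add, hc, hd]; abel
  | single s r =>
    have h₀ := prism_face_zero H s
    have h₁ := prism_face_last H s
    simp only [prismOperator_single, Fin.sum_univ_succ, Fin.sum_univ_zero, singularChainMap,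
      Finsupp.lmapDomain_apply, Finsupp.mapDomain_single]
    rw [← h₀, ← h₁, sub_eq_add_neg, Fin.val_zero, pow_zero, one_smul, add_zero,
      singularBoundary_single]
    simp only [Fin.sum_univ_succ, Fin.sum_univ_zero, Fin.val_zero, Fin.val_succ, pow_zero, one_smul,
      zero_add, pow_one, neg_smul, add_zero]
    rfl

theorem chainsIn_empty (n : ℕ) : chainsIn R (∅ : Set X) n = ⊥ := by
  have : {s : SingularSimplex X n | Set.range s ⊆ ∅} = ∅ := by
    ext s
    simp
  rw [chainsIn, this, Finsupp.supported_empty]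

/-- Homotopic maps send a cycle to homologous cycles. -/
theorem singularChainMap_sub_mem_relBoundaries (H : C(unitInterval × X, Y)) {n : ℕ}
    {c : SingularChain R X n} (hc : c ∈ relCycles R (∅ : Set X) n) :
    singularChainMap R (H.comp (.prodMk (.const X 1) (.id X))) n c -
      singularChainMap R (H.comp (.prodMk (.const X 0) (.id X))) n c ∈
        relBoundaries R (∅ : Set Y) n := by
  refine Submodule.mem_sup_left ⟨prismOperator R H n c, ?_⟩
  cases n with
  | zero => exact singularBoundary_prismOperator_zero R H c
  | succ n =>
    have h : singularBoundary R X n c ∈ chainsIn R ∅ n := hc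
    rw [chainsIn_empty, Submodule.mem_bot] at h
    rw [singularBoundary_prismOperator_succ, h, map_zero, sub_zero]

/-- Homotopy invariance of singular homology. -/
theorem pushforward_eq_of_homotopic {f₀ f₁ : C(X, Y)} (h : f₀.Homotopic f₁) (n : ℕ) :
    pushforward R f₀ n = pushforward R f₁ n := by
  obtain ⟨H⟩ := h
  ext ⟨_, c, hc, rfl⟩
  have h := singularChainMap_sub_mem_relBoundaries R H.toContinuousMap hc
  have h₀ : H.toContinuousMap.comp (.prodMk (.const X 0) (.id X)) = f₀ := by ext; simp
  have h₁ : H.toContinuousMap.comp (.prodMk (.const X 1) (.id X)) = f₁ := by ext; simp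
  rw [h₀, h₁] at h
  exact ((Submodule.Quotient.eq _).2 h).symm

/-- The class `f_* a` is represented by a cycle whose image is contained in the range of `f`. -/
theorem exists_cycle_pushforward (f : C(X, Y)) {n : ℕ} (a : SingHomology R X n) :
    ∃ A : relCycles R (∅ : Set Y) n,
      homologyClass R ∅ n A = pushforward R f n a ∧ chainImage R A.1 ⊆ Set.range f := by
  classical
  obtain ⟨_, c, hc, rfl⟩ := a
  refine ⟨⟨singularChainMap R f n c,
    singularChainMap_mem_relCycles R (Set.mapsTo_empty _ _) hc⟩, rfl, ?_⟩
  refine Set.iUnion₂_subset fun s hs => ?_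
  obtain ⟨s', -, rfl⟩ := Finset.mem_image.1 (Finsupp.mapDomain_support hs)
  rintro _ ⟨x, rfl⟩
  exact ⟨s' x, rfl⟩

/-- The image of the class of a cycle vanishes in the homology relative to a subspace which contains
the image of the cycle. -/
theorem toRelative_homologyClass_eq_zero {A : Set X} {n : ℕ} (c : relCycles R (∅ : Set X) n)
    (h : chainImage R c.1 ⊆ A) : toRelative R A n (homologyClass R ∅ n c) = 0 := by
  have hc : c.1 ∈ chainsIn R A n := by
    refine (Finsupp.mem_supported R c.1).2 fun s hs => ?_
    exact fun x hx => h (Set.mem_iUnion₂.2 ⟨s, hs, hx⟩)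
  have hid : singularChainMap R (ContinuousMap.id X) n c.1 = c.1 := Finsupp.mapDomain_id
  refine Subtype.ext ((Submodule.Quotient.mk_eq_zero _).2 ?_)
  rw [hid]
  exact Submodule.mem_sup_right hc

end HomotopyInvariance

/-! ## Velocities of curves -/

section Curves

variable {E H M E' H' M' : Type*} [NormedAddCommGroup E] [NormedSpace ℝ E] [TopologicalSpace H]
  (I : ModelWithCorners ℝ E H) [TopologicalSpace M] [ChartedSpace H M]
  [NormedAddCommGroup E'] [NormedSpace ℝ E'] [TopologicalSpace H']
  (I' : ModelWithCorners ℝ E' H') [TopologicalSpace M'] [ChartedSpace H' M']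

/-- The manifold derivative, as a map between the model spaces. -/
def modelDeriv (f : M → M') (x : M) : E →L[ℝ] E' := mfderiv I I' f x

/-- The curve `γ` has the velocity `v` at `t` within `s`. Here `v` is considered as an element of the
model space, to avoid types which depend on `γ t`. -/
def HasVelocityWithinAt (γ : ℝ → M) (v : E) (s : Set ℝ) (t : ℝ) : Prop :=
  HasMFDerivWithinAt 𝓘(ℝ, ℝ) I γ s t ((1 : ℝ →L[ℝ] ℝ).smulRight v : ℝ →L[ℝ] E)

variable {I I'}

theorem hasMFDerivAt_iff_hasVelocityWithinAt {γ : ℝ → M} {v : E} {t : ℝ} :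
    HasMFDerivAt 𝓘(ℝ, ℝ) I γ t ((1 : ℝ →L[ℝ] ℝ).smulRight v : ℝ →L[ℝ] E) ↔
      HasVelocityWithinAt I γ v Set.univ t :=
  hasMFDerivWithinAt_univ.symm

theorem isMIntegralCurve_iff_hasVelocityWithinAt {γ : ℝ → M} {V : ∀ x : M, TangentSpace I x} :
    IsMIntegralCurve (I := I) γ V ↔ ∀ t, HasVelocityWithinAt I γ (V (γ t)) Set.univ t :=
  forall_congr' fun _ => hasMFDerivAt_iff_hasVelocityWithinAt

theorem HasVelocityWithinAt.comp_curve {γ : ℝ → M} {s : Set ℝ} {t : ℝ} {v : E} {f : M → M'}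
    (hf : MDifferentiableAt I I' f (γ t)) (hγ : HasVelocityWithinAt I γ v s t) :
    HasVelocityWithinAt I' (fun t => f (γ t)) (modelDeriv I I' f (γ t) v) s t := by
  have h := hf.hasMFDerivAt.comp_hasMFDerivWithinAt t hγ
  have h2 : (modelDeriv I I' f (γ t)).comp ((1 : ℝ →L[ℝ] ℝ).smulRight v : ℝ →L[ℝ] E) =
      (1 : ℝ →L[ℝ] ℝ).smulRight (modelDeriv I I' f (γ t) v) := by ext; simp
  rw [HasVelocityWithinAt, ← h2]
  exact h

theorem HasVelocityWithinAt.mono {γ : ℝ → M} {v : E} {s s' : Set ℝ} {t : ℝ}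
    (h : HasVelocityWithinAt I γ v s t) (hs : s' ⊆ s) : HasVelocityWithinAt I γ v s' t :=
  HasMFDerivWithinAt.mono h hs

theorem HasVelocityWithinAt.congr {γ γ' : ℝ → M} {v : E} {s : Set ℝ} {t : ℝ}
    (h : HasVelocityWithinAt I γ v s t) (hs : γ' =ᶠ[nhdsWithin t s] γ) (ht : γ' t = γ t) :
    HasVelocityWithinAt I γ' v s t := by
  rw [HasVelocityWithinAt] at h ⊢
  exact h.congr_of_eventuallyEq hs ht

theorem HasVelocityWithinAt.hasDerivWithinAt {γ : ℝ → E} {v : E} {s : Set ℝ} {t : ℝ}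
    (h : HasVelocityWithinAt 𝓘(ℝ, E) γ v s t) : HasDerivWithinAt γ v s t := 
  HasMFDerivWithinAt.hasFDerivWithinAt h

theorem HasVelocityWithinAt.comp_sub {γ : ℝ → M} {v : E} {t : ℝ}
    (h : HasVelocityWithinAt I γ v Set.univ t) (s : ℝ) :
    HasVelocityWithinAt I (fun r => γ (r - s)) v Set.univ (t + s) := by
  rw [← hasMFDerivAt_iff_hasVelocityWithinAt] at h ⊢
  have hs : HasMFDerivAt 𝓘(ℝ, ℝ) 𝓘(ℝ, ℝ) (fun r : ℝ => r - s) (t + s) (ContinuousLinearMap.id ℝ ℝ) :=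
    ((hasFDerivAt_id (𝕜 := ℝ) (t + s)).sub_const s).hasMFDerivAt
  have ht : t = (t + s) - s := by ring
  rw [ht] at h
  exact h.comp (t + s) hs

theorem modelDeriv_comp {E'' H'' M'' : Type*} [NormedAddCommGroup E''] [NormedSpace ℝ E'']
    [TopologicalSpace H''] {I'' : ModelWithCorners ℝ E'' H''} [TopologicalSpace M'']
    [ChartedSpace H'' M''] {f : M → M'} {g : M' → M''} {x : M}
    (hg : MDifferentiableAt I' I'' g (f x)) (hf : MDifferentiableAt I I' f x) (v : E) :
    modelDeriv I I'' (fun y => g (f y)) x v =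
      modelDeriv I' I'' g (f x) (modelDeriv I I' f x v) :=
  congrArg (fun L : E →L[ℝ] E'' => L v) (mfderiv_comp x hg hf)

end Curves

/-! ### One-parameter subgroups and the exponential map of a Lie group. -/

section OneParameterSubgroups

variable {n : ℕ} {G : Type*} [TopologicalSpace G] [ChartedSpace (EuclideanSpace ℝ (Fin n)) G]
  [Group G]

/-- The value at `g` of the left invariant vector field defined by `X`. -/
def leftField (X : EuclideanSpace ℝ (Fin n)) (g : G) : EuclideanSpace ℝ (Fin n) :=
  modelDeriv (𝓡 n) (𝓡 n) (fun b : G => g * b) 1 X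

/-- The exponential map, as a map on the model space. -/
def modelExp (G : Type*) [TopologicalSpace G] [ChartedSpace (EuclideanSpace ℝ (Fin n)) G] [Group G]
    (X : EuclideanSpace ℝ (Fin n)) : G :=
  lieExp n (X : GroupLieAlgebra (𝓡 n) G)

theorem leftField_one (X : EuclideanSpace ℝ (Fin n)) : leftField X (1 : G) = X := by
  have h : (fun b : G => 1 * b) = id := by ext b; simp
  rw [leftField, h, modelDeriv, mfderiv_id]
  rfl

variable [LieGroup (𝓡 n) ∞ G]

theorem contMDiff_one_mulInvariantVectorField (X : GroupLieAlgebra (𝓡 n) G) :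
    ContMDiff (𝓡 n) (𝓡 n).tangent 1
      (fun g : G => (mulInvariantVectorField X g : TangentBundle (𝓡 n) G)) := by
  refine (contMDiff_mulInvariantVectorField X).of_le ?_
  rw [minSmoothness_of_isRCLikeNormedField]
  norm_num

theorem LieGroup.mdifferentiableAt_mul_left (g h : G) :
    MDifferentiableAt (𝓡 n) (𝓡 n) (fun b : G => g * b) h :=
  (contMDiff_mul_left (I := 𝓡 n) (n := ∞)).mdifferentiableAt (by simp)

theorem LieGroup.mdifferentiableAt_mul_right (g h : G) :
    MDifferentiableAt (𝓡 n) (𝓡 n) (fun b : G => b * g) h :=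
  (contMDiff_mul_right (I := 𝓡 n) (n := ∞)).mdifferentiableAt (by simp)

/-- Left invariance is the chain rule for $L_{gh}=L_g\circ L_h$ at the identity. -/
theorem modelDeriv_mul_left_leftField (g h : G) (X : EuclideanSpace ℝ (Fin n)) :
    modelDeriv (𝓡 n) (𝓡 n) (fun b : G => g * b) h (leftField X h) = leftField X (g * h) := by
  have h1 : (fun b : G => g * h * b) = fun b => g * (h * b) := by
    ext b; simp [mul_assoc]
  rw [leftField, leftField, h1, modelDeriv_comp (I' := 𝓡 n)
    (LieGroup.mdifferentiableAt_mul_left g _) (LieGroup.mdifferentiableAt_mul_left h _), mul_one]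

theorem HasVelocityWithinAt.mul_left {φ : ℝ → G} {X : EuclideanSpace ℝ (Fin n)} {s : Set ℝ}
    {t : ℝ} (h : HasVelocityWithinAt (𝓡 n) φ (leftField X (φ t)) s t) (g : G) :
    HasVelocityWithinAt (𝓡 n) (fun t => g * φ t) (leftField X (g * φ t)) s t := by
  rw [← modelDeriv_mul_left_leftField]
  exact h.comp_curve (LieGroup.mdifferentiableAt_mul_left g (φ t))

/-- Left translates of one local integral curve through 1 give integral curves through all points
with the same lifetime `ε`, and a uniform lifetime implies completeness. -/
theorem exists_isMIntegralCurve_mulInvariantVectorField [T2Space G]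
    (X : GroupLieAlgebra (𝓡 n) G) :
    ∃ φ : ℝ → G, φ 0 = 1 ∧ IsMIntegralCurve (I := 𝓡 n) φ (mulInvariantVectorField X) := by
  obtain ⟨φ, h0, hφ⟩ := exists_isMIntegralCurveAt_of_contMDiffAt_boundaryless (I := 𝓡 n) 0
    (contMDiff_one_mulInvariantVectorField X).contMDiffAt (x₀ := (1 : G))
  obtain ⟨ε, hε, h⟩ := isMIntegralCurveAt_iff'.1 hφ
  refine exists_isMIntegralCurve_of_isMIntegralCurveOn
    (contMDiff_one_mulInvariantVectorField X) hε (fun g => ⟨fun t => g * φ t, by simp [h0], ?_⟩) 1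
  rw [Real.ball_eq_Ioo, zero_sub, zero_add] at h
  exact fun t ht => HasVelocityWithinAt.mul_left (h t ht) g

variable [T2Space G]

/-- Integral curves are unique, so the choice in the definition of `lieExp` does not matter. -/
theorem lieExp_eq {φ : ℝ → G} {X : GroupLieAlgebra (𝓡 n) G} (h0 : φ 0 = 1)
    (h : IsMIntegralCurve (I := 𝓡 n) φ (mulInvariantVectorField X)) : lieExp n X = φ 1 := by
  have hex : ∃ φ : ℝ → G, φ 0 = 1 ∧
      IsMIntegralCurve (I := 𝓡 n) φ (mulInvariantVectorField (I := 𝓡 n) X) := ⟨φ, h0, h⟩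
  rw [lieExp, dif_pos hex]
  have := isMIntegralCurve_Ioo_eq_of_contMDiff_boundaryless (t₀ := 0)
    (contMDiff_one_mulInvariantVectorField X) hex.choose_spec.2 h (hex.choose_spec.1.trans h0.symm)
  exact congrFun this 1

theorem lieExp_smul_eq {φ : ℝ → G} {X : GroupLieAlgebra (𝓡 n) G} (h0 : φ 0 = 1)
    (h : IsMIntegralCurve (I := 𝓡 n) φ (mulInvariantVectorField X)) (t : ℝ) :
    lieExp n (t • X) = φ t := by
  have h2 := h.comp_mul t
  rw [← mulInvariantVectorField_smul] at h2
  simpa using lieExp_eq (by simp [h0]) h2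

theorem modelExp_smul_eq {φ : ℝ → G} {X : EuclideanSpace ℝ (Fin n)} (h0 : φ 0 = 1)
    (h : IsMIntegralCurve (I := 𝓡 n) φ (mulInvariantVectorField (G := G) X)) (t : ℝ) :
    modelExp G (t • X) = φ t :=
  lieExp_smul_eq h0 h t

theorem isMIntegralCurve_modelExp (X : EuclideanSpace ℝ (Fin n)) :
    IsMIntegralCurve (I := 𝓡 n) (fun t : ℝ => (modelExp G (t • X) : G))
      (mulInvariantVectorField (G := G) X) := by
  obtain ⟨φ, h0, h⟩ := exists_isMIntegralCurve_mulInvariantVectorField (G := G) X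
  have : (fun t : ℝ => modelExp G (t • X)) = φ := funext fun t => modelExp_smul_eq h0 h t
  rwa [this]

theorem hasVelocityWithinAt_modelExp (X : EuclideanSpace ℝ (Fin n)) (s : Set ℝ) (t : ℝ) :
    HasVelocityWithinAt (𝓡 n) (fun t : ℝ => (modelExp G (t • X) : G))
      (leftField X (modelExp G (t • X))) s t :=
  (isMIntegralCurve_iff_hasVelocityWithinAt.1 (isMIntegralCurve_modelExp X) t).mono s.subset_univ

theorem continuous_modelExp_smul (X : EuclideanSpace ℝ (Fin n)) :
    Continuous (fun t : ℝ => (modelExp G (t • X) : G)) :=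
  (isMIntegralCurve_modelExp X).continuous

theorem modelExp_zero : modelExp G (0 : EuclideanSpace ℝ (Fin n)) = 1 := by
  obtain ⟨φ, h0, h⟩ :=
    exists_isMIntegralCurve_mulInvariantVectorField (0 : GroupLieAlgebra (𝓡 n) G)
  exact (congrArg (modelExp G) (zero_smul ℝ _).symm).trans ((modelExp_smul_eq h0 h 0).trans h0)

/-- A one-parameter subgroup is determined by its velocity at `0`. -/
theorem modelExp_smul_eq_of_hom {p : ℝ → G} (hp : ∀ s t, p (s + t) = p s * p t)
    {X : EuclideanSpace ℝ (Fin n)} (h : HasVelocityWithinAt (𝓡 n) p X Set.univ 0) (t : ℝ) :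
    modelExp G (t • X) = p t := by
  have h0 : p 0 = 1 := by simpa using hp 0 0
  refine modelExp_smul_eq h0 (isMIntegralCurve_iff_hasVelocityWithinAt.2 fun s => ?_) t
  -- The velocity at `s` is thus the left translate by `p s` of the velocity at 0.
  have h1 : p = fun t => p s * p (t - s) := by ext t; rw [← hp]; simp
  have h2 := h.comp_sub s
  rw [zero_add] at h2
  have h3 := h2.comp_curve (γ := fun r => p (r - s))
    (LieGroup.mdifferentiableAt_mul_left (n := n) (p s) (p (s - s)))
  simp only [sub_self, h0, ← h1] at h3
  exact h3

/-- As functions of `t`, both sides are integral curves of the same field and they agree at `t = 0`.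
-/
theorem modelExp_add_smul (X : EuclideanSpace ℝ (Fin n)) (s t : ℝ) :
    modelExp G ((s + t) • X) = modelExp G (s • X) * modelExp G (t • X) := by
  have h1 := (isMIntegralCurve_modelExp (G := G) X).comp_add s
  have h2 : IsMIntegralCurve (I := 𝓡 n) (fun t : ℝ => modelExp G (s • X) * modelExp G (t • X) : ℝ → G)
      (mulInvariantVectorField (G := G) X) := isMIntegralCurve_iff_hasVelocityWithinAt.2
    fun t => (hasVelocityWithinAt_modelExp X Set.univ t).mul_left _
  have := isMIntegralCurve_Ioo_eq_of_contMDiff_boundaryless (t₀ := 0)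
    (contMDiff_one_mulInvariantVectorField (G := G) X) h1 h2 (by simp [modelExp_zero])
  simpa [add_comm] using congrFun this t

end OneParameterSubgroups

/-! ## Commuting one-parameter subgroups -/

section Commuting

open Filter Topology

variable {n : ℕ} {G : Type*} [TopologicalSpace G] [ChartedSpace (EuclideanSpace ℝ (Fin n)) G]
  [Group G]

/-- The adjoint representation. -/
def adjointMap (n : ℕ) {G : Type*} [TopologicalSpace G] [ChartedSpace (EuclideanSpace ℝ (Fin n)) G]
    [Group G] (g : G) : EuclideanSpace ℝ (Fin n) →L[ℝ] EuclideanSpace ℝ (Fin n) :=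
  modelDeriv (𝓡 n) (𝓡 n) (fun b : G => g * b * g⁻¹) 1

/-- The value at `g` of the right invariant vector field defined by `X`. -/
def rightField (X : EuclideanSpace ℝ (Fin n)) (g : G) : EuclideanSpace ℝ (Fin n) :=
  modelDeriv (𝓡 n) (𝓡 n) (fun b : G => b * g) 1 X

/-- The group multiplication in the chart at `1`. -/
def chartMul (n : ℕ) (G : Type*) [TopologicalSpace G] [ChartedSpace (EuclideanSpace ℝ (Fin n)) G]
    [Group G] (p : EuclideanSpace ℝ (Fin n) × EuclideanSpace ℝ (Fin n)) :
    EuclideanSpace ℝ (Fin n) :=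
  extChartAt (𝓡 n) (1 : G)
    ((extChartAt (𝓡 n) (1 : G)).symm p.1 * (extChartAt (𝓡 n) (1 : G)).symm p.2)

/-- The left invariant vector field defined by `X` in the chart at `1`. -/
def chartField (G : Type*) [TopologicalSpace G] [ChartedSpace (EuclideanSpace ℝ (Fin n)) G]
    [Group G] (X : EuclideanSpace ℝ (Fin n)) (x : EuclideanSpace ℝ (Fin n)) :
    EuclideanSpace ℝ (Fin n) :=
  modelDeriv (𝓡 n) 𝓘(ℝ, EuclideanSpace ℝ (Fin n)) (extChartAt (𝓡 n) (1 : G))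
    ((extChartAt (𝓡 n) (1 : G)).symm x) (leftField X ((extChartAt (𝓡 n) (1 : G)).symm x))


theorem adjointMap_one (X : EuclideanSpace ℝ (Fin n)) : adjointMap n (1 : G) X = X := by
  have h : (fun b : G => 1 * b * 1⁻¹) = id := by ext b; simp
  rw [adjointMap, h, modelDeriv, mfderiv_id]
  rfl

/-- The Lie bracket of `X` and `Y` vanishes. -/
def LieCommute (G : Type*) [TopologicalSpace G] [ChartedSpace (EuclideanSpace ℝ (Fin n)) G]
    [Group G] (X Y : EuclideanSpace ℝ (Fin n)) : Prop :=
  @Bracket.bracket (GroupLieAlgebra (𝓡 n) G) (GroupLieAlgebra (𝓡 n) G) _ X Y = 0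

variable [LieGroup (𝓡 n) ∞ G]

theorem LieGroup.mdifferentiableAt_conj (g h : G) :
    MDifferentiableAt (𝓡 n) (𝓡 n) (fun b : G => g * b * g⁻¹) h :=
  (LieGroup.mdifferentiableAt_mul_right g⁻¹ (g * h)).comp h
    (LieGroup.mdifferentiableAt_mul_left g h)

theorem adjointMap_mul (g h : G) (X : EuclideanSpace ℝ (Fin n)) :
    adjointMap n (g * h) X = adjointMap n g (adjointMap n h X) := by
  have h1 : (fun b : G => g * h * b * (g * h)⁻¹) = fun b => g * (h * b * h⁻¹) * g⁻¹ := by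
    ext b; group
  have h2 : h * 1 * h⁻¹ = 1 := by group
  rw [adjointMap, h1, modelDeriv_comp (LieGroup.mdifferentiableAt_conj g _)
    (LieGroup.mdifferentiableAt_conj h _), h2]
  rfl

/-- From $gb=(gbg^{-1})g$. In a chart, this relation determines the adjoint representation through
the two partial derivatives of the multiplication. -/
theorem rightField_adjointMap (g : G) (X : EuclideanSpace ℝ (Fin n)) :
    rightField (adjointMap n g X) g = leftField X g := by
  have h1 : (fun b : G => g * b) = fun b => (g * b * g⁻¹) * g := by ext b; group
  have h2 : g * 1 * g⁻¹ = 1 := by group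
  rw [leftField, h1, modelDeriv_comp (LieGroup.mdifferentiableAt_mul_right g _)
    (LieGroup.mdifferentiableAt_conj g _), h2]
  rfl

theorem isManifold_one_lieGroup : IsManifold (𝓡 n) 1 G := inferInstance

theorem modelDeriv_extChartAt_one (v : EuclideanSpace ℝ (Fin n)) :
    modelDeriv (𝓡 n) 𝓘(ℝ, EuclideanSpace ℝ (Fin n)) (extChartAt (𝓡 n) (1 : G)) 1 v = v := by
  rw [modelDeriv, mfderiv_extChartAt_self]
  rfl

theorem modelDeriv_extChartAt_one_symm (v : EuclideanSpace ℝ (Fin n)) :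
    modelDeriv 𝓘(ℝ, EuclideanSpace ℝ (Fin n)) (𝓡 n) (extChartAt (𝓡 n) (1 : G)).symm
      (extChartAt (𝓡 n) (1 : G) 1) v = v := by
  have h := mfderivWithin_range_extChartAt_symm (I := 𝓡 n) (x := (1 : G))
  rw [ModelWithCorners.range_eq_univ, mfderivWithin_univ] at h
  rw [modelDeriv, h]
  rfl

theorem contMDiffAt_extChartAt_one_symm :
    ContMDiffAt 𝓘(ℝ, EuclideanSpace ℝ (Fin n)) (𝓡 n) ∞ (extChartAt (𝓡 n) (1 : G)).symm
      (extChartAt (𝓡 n) (1 : G) 1) :=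
  (contMDiffOn_extChartAt_symm (1 : G)).contMDiffAt (extChartAt_target_mem_nhds 1)

theorem contDiffAt_chartMul :
    ContDiffAt ℝ ∞ (chartMul n G) (extChartAt (𝓡 n) (1 : G) 1, extChartAt (𝓡 n) (1 : G) 1) := by
  rw [← contMDiffAt_iff_contDiffAt]
  have h1 : ContMDiffAt 𝓘(ℝ, EuclideanSpace ℝ (Fin n) × EuclideanSpace ℝ (Fin n)) (𝓡 n) ∞
      (fun p : EuclideanSpace ℝ (Fin n) × EuclideanSpace ℝ (Fin n) =>
        (extChartAt (𝓡 n) (1 : G)).symm p.1)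
      (extChartAt (𝓡 n) (1 : G) 1, extChartAt (𝓡 n) (1 : G) 1) :=
    ContMDiffAt.comp _ contMDiffAt_extChartAt_one_symm contDiffAt_fst.contMDiffAt
  have h2 : ContMDiffAt 𝓘(ℝ, EuclideanSpace ℝ (Fin n) × EuclideanSpace ℝ (Fin n)) (𝓡 n) ∞
      (fun p : EuclideanSpace ℝ (Fin n) × EuclideanSpace ℝ (Fin n) =>
        (extChartAt (𝓡 n) (1 : G)).symm p.2)
      (extChartAt (𝓡 n) (1 : G) 1, extChartAt (𝓡 n) (1 : G) 1) :=
    ContMDiffAt.comp _ contMDiffAt_extChartAt_one_symm contDiffAt_snd.contMDiffAt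
  have h3 : ContMDiffAt (𝓡 n) 𝓘(ℝ, EuclideanSpace ℝ (Fin n)) ∞ (extChartAt (𝓡 n) (1 : G))
      ((extChartAt (𝓡 n) (1 : G)).symm (extChartAt (𝓡 n) (1 : G) 1) *
        (extChartAt (𝓡 n) (1 : G)).symm (extChartAt (𝓡 n) (1 : G) 1)) := by
    rw [extChartAt_to_inv, mul_one]
    exact contMDiffAt_extChartAt
  exact ContMDiffAt.comp
    (extChartAt (𝓡 n) (1 : G) 1, extChartAt (𝓡 n) (1 : G) 1) h3 (h1.mul h2)

theorem eventually_differentiableAt_chartMul :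
    ∀ᶠ p in 𝓝 (extChartAt (𝓡 n) (1 : G) 1, extChartAt (𝓡 n) (1 : G) 1),
      DifferentiableAt ℝ (chartMul n G) p := by
  have h := (contDiffAt_chartMul (n := n) (G := G)).of_le (m := 1) (by simp)
  filter_upwards [h.eventually (by simp)] with p hp
  exact hp.differentiableAt (by simp)

theorem modelDeriv_eq_fderiv {E F : Type*} [NormedAddCommGroup E] [NormedSpace ℝ E]
    [NormedAddCommGroup F] [NormedSpace ℝ F] (f : E → F) (x : E) :
    modelDeriv 𝓘(ℝ, E) 𝓘(ℝ, F) f x = fderiv ℝ f x := mfderiv_eq_fderiv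

theorem mdifferentiableAt_extChartAt_one {g : G} (hg : g ∈ (extChartAt (𝓡 n) (1 : G)).source) :
    MDifferentiableAt (𝓡 n) 𝓘(ℝ, EuclideanSpace ℝ (Fin n)) (extChartAt (𝓡 n) (1 : G)) g :=
  mdifferentiableAt_extChartAt (by rwa [extChartAt_source] at hg)

/-- A left invariant field differentiates the product in its second factor at 1; its chart
expression is therefore a partial derivative of `chartMul`. The right invariant fields give the
other partial derivative. -/
theorem modelDeriv_chart_left (X : EuclideanSpace ℝ (Fin n)) {g : G}
    (hg : g ∈ (extChartAt (𝓡 n) (1 : G)).source)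
    (hd : DifferentiableAt ℝ (chartMul n G)
      (extChartAt (𝓡 n) (1 : G) g, extChartAt (𝓡 n) (1 : G) 1)) :
    modelDeriv (𝓡 n) 𝓘(ℝ, EuclideanSpace ℝ (Fin n)) (extChartAt (𝓡 n) (1 : G)) g
      (leftField X g) =
      fderiv ℝ (chartMul n G) (extChartAt (𝓡 n) (1 : G) g, extChartAt (𝓡 n) (1 : G) 1) (0, X) := by
  set e := extChartAt (𝓡 n) (1 : G) with he
  have hs : MDifferentiableAt 𝓘(ℝ, EuclideanSpace ℝ (Fin n)) (𝓡 n) e.symm (e 1) :=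
    contMDiffAt_extChartAt_one_symm.mdifferentiableAt (by simp)
  have h1 : e.symm (e 1) = 1 := extChartAt_to_inv (1 : G)
  have hm : MDifferentiableAt 𝓘(ℝ, EuclideanSpace ℝ (Fin n)) (𝓡 n) (fun y => g * e.symm y) (e 1) :=
    (LieGroup.mdifferentiableAt_mul_left g _).comp _ hs
  have hc : MDifferentiableAt (𝓡 n) 𝓘(ℝ, EuclideanSpace ℝ (Fin n)) e (g * e.symm (e 1)) := by
    rw [h1, mul_one]
    exact mdifferentiableAt_extChartAt_one hg
  have h2 : modelDeriv 𝓘(ℝ, EuclideanSpace ℝ (Fin n)) 𝓘(ℝ, EuclideanSpace ℝ (Fin n))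
      (fun y => chartMul n G (e g, y)) (e 1) X =
      modelDeriv (𝓡 n) 𝓘(ℝ, EuclideanSpace ℝ (Fin n)) e g (leftField X g) := by
    have : (fun y => chartMul n G (e g, y)) = fun y => e (g * e.symm y) := by
      ext1 y
      rw [chartMul, ← he, e.left_inv hg]
    rw [this, modelDeriv_comp (f := fun y => g * e.symm y) hc hm,
      modelDeriv_comp (LieGroup.mdifferentiableAt_mul_left g _) hs, modelDeriv_extChartAt_one_symm,
      h1, mul_one, leftField]
  rw [← h2, modelDeriv_eq_fderiv]
  have h3 := hd.hasFDerivAt.comp (e 1) (hasFDerivAt_prodMk_right (e g) (e 1))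
  have h4 := h3.fderiv
  rw [Function.comp_def] at h4
  rw [h4]
  rfl

theorem modelDeriv_chart_right (X : EuclideanSpace ℝ (Fin n)) {g : G}
    (hg : g ∈ (extChartAt (𝓡 n) (1 : G)).source)
    (hd : DifferentiableAt ℝ (chartMul n G)
      (extChartAt (𝓡 n) (1 : G) 1, extChartAt (𝓡 n) (1 : G) g)) :
    modelDeriv (𝓡 n) 𝓘(ℝ, EuclideanSpace ℝ (Fin n)) (extChartAt (𝓡 n) (1 : G)) g
      (rightField X g) =
      fderiv ℝ (chartMul n G) (extChartAt (𝓡 n) (1 : G) 1, extChartAt (𝓡 n) (1 : G) g) (X, 0) := by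
  set e := extChartAt (𝓡 n) (1 : G) with he
  have hs : MDifferentiableAt 𝓘(ℝ, EuclideanSpace ℝ (Fin n)) (𝓡 n) e.symm (e 1) :=
    contMDiffAt_extChartAt_one_symm.mdifferentiableAt (by simp)
  have h1 : e.symm (e 1) = 1 := extChartAt_to_inv (1 : G)
  have hm : MDifferentiableAt 𝓘(ℝ, EuclideanSpace ℝ (Fin n)) (𝓡 n) (fun y => e.symm y * g) (e 1) :=
    (LieGroup.mdifferentiableAt_mul_right g _).comp _ hs
  have hc : MDifferentiableAt (𝓡 n) 𝓘(ℝ, EuclideanSpace ℝ (Fin n)) e (e.symm (e 1) * g) := by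
    rw [h1, one_mul]
    exact mdifferentiableAt_extChartAt_one hg
  have h2 : modelDeriv 𝓘(ℝ, EuclideanSpace ℝ (Fin n)) 𝓘(ℝ, EuclideanSpace ℝ (Fin n))
      (fun y => chartMul n G (y, e g)) (e 1) X =
      modelDeriv (𝓡 n) 𝓘(ℝ, EuclideanSpace ℝ (Fin n)) e g (rightField X g) := by
    have : (fun y => chartMul n G (y, e g)) = fun y => e (e.symm y * g) := by
      ext1 y
      rw [chartMul, ← he, e.left_inv hg]
    rw [this, modelDeriv_comp (f := fun y => e.symm y * g) hc hm,
      modelDeriv_comp (LieGroup.mdifferentiableAt_mul_right g _) hs, modelDeriv_extChartAt_one_symm,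
      h1, one_mul, rightField]
  rw [← h2, modelDeriv_eq_fderiv]
  have h3 := HasFDerivAt.comp (f := fun y => (y, e g)) (e 1) hd.hasFDerivAt
    (hasFDerivAt_prodMk_left (𝕜 := ℝ) (e 1) (e g))
  have h4 := h3.fderiv
  rw [Function.comp_def] at h4
  rw [h4]
  rfl

theorem chartField_one (X : EuclideanSpace ℝ (Fin n)) :
    chartField G X (extChartAt (𝓡 n) (1 : G) 1) = X := by
  rw [chartField, extChartAt_to_inv, leftField_one, modelDeriv_extChartAt_one]

/-- The Lie bracket is defined by pulling fields back along the inverse chart. On the chart target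
the derivative of the chart inverts that of the inverse chart, so the pullback is the pushforward
`chartField`. -/
theorem mpullbackWithin_eventuallyEq_chartField (X : GroupLieAlgebra (𝓡 n) G) :
    (VectorField.mpullbackWithin 𝓘(ℝ, EuclideanSpace ℝ (Fin n)) (𝓡 n)
      (extChartAt (𝓡 n) (1 : G)).symm (mulInvariantVectorField X) (Set.range (𝓡 n)) :
        EuclideanSpace ℝ (Fin n) → EuclideanSpace ℝ (Fin n))
      =ᶠ[𝓝 (extChartAt (𝓡 n) (1 : G) 1)] chartField G X := by
  filter_upwards [extChartAt_target_mem_nhds (I := 𝓡 n) (1 : G)] with x hx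
  have h := ContinuousLinearMap.inverse_eq
    (mfderivWithin_extChartAt_symm_comp_mfderiv_extChartAt (I := 𝓡 n) hx)
    (mfderiv_extChartAt_comp_mfderivWithin_extChartAt_symm (I := 𝓡 n) hx)
  rw [VectorField.mpullbackWithin_apply, h]
  rfl

theorem bracket_eq_fderiv_chartField (X Y : GroupLieAlgebra (𝓡 n) G) :
    ⁅X, Y⁆ =
      (fderiv ℝ (chartField G Y) (extChartAt (𝓡 n) (1 : G) 1) X -
      fderiv ℝ (chartField G X) (extChartAt (𝓡 n) (1 : G) 1) Y : EuclideanSpace ℝ (Fin n)) := by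
  rw [GroupLieAlgebra.bracket_def, ← VectorField.mlieBracketWithin_univ,
    VectorField.mlieBracketWithin_apply, mfderiv_extChartAt_self, Set.preimage_univ,
    Set.univ_inter]
  have h := (Filter.EventuallyEq.lieBracket_vectorField (𝕜 := ℝ)
    (mpullbackWithin_eventuallyEq_chartField X)
    (mpullbackWithin_eventuallyEq_chartField Y)).self_of_nhds
  have hid (v : EuclideanSpace ℝ (Fin n)) :
      (ContinuousLinearMap.id ℝ (EuclideanSpace ℝ (Fin n))).inverse v = v := by
    rw [ContinuousLinearMap.inverse_id]; rfl
  have hw (V W : EuclideanSpace ℝ (Fin n) → EuclideanSpace ℝ (Fin n)) (x) :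
      VectorField.lieBracketWithin ℝ V W (Set.range (𝓡 n)) x = VectorField.lieBracket ℝ V W x := by
    rw [ModelWithCorners.range_eq_univ, VectorField.lieBracketWithin_univ]
  have key (X Y : EuclideanSpace ℝ (Fin n)) :
      VectorField.lieBracket ℝ (chartField G X) (chartField G Y) (extChartAt (𝓡 n) (1 : G) 1) =
      fderiv ℝ (chartField G Y) (extChartAt (𝓡 n) (1 : G) 1) X -
      fderiv ℝ (chartField G X) (extChartAt (𝓡 n) (1 : G) 1) Y := by
    rw [VectorField.lieBracket, chartField_one, chartField_one]
  exact (hid _).trans ((hw _ _ _).trans (h.trans (key X Y)))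

theorem chartField_eventuallyEq (X : EuclideanSpace ℝ (Fin n)) :
    chartField G X =ᶠ[𝓝 (extChartAt (𝓡 n) (1 : G) 1)]
      fun x => fderiv ℝ (chartMul n G) (x, extChartAt (𝓡 n) (1 : G) 1) (0, X) := by
  have h1 : Tendsto (fun x => (x, extChartAt (𝓡 n) (1 : G) 1)) (𝓝 (extChartAt (𝓡 n) (1 : G) 1))
      (𝓝 (extChartAt (𝓡 n) (1 : G) 1, extChartAt (𝓡 n) (1 : G) 1)) :=
    (Continuous.prodMk_left _).tendsto _
  filter_upwards [extChartAt_target_mem_nhds (I := 𝓡 n) (1 : G),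
    h1.eventually eventually_differentiableAt_chartMul] with x hx hd
  have h := modelDeriv_chart_left (n := n) X ((extChartAt (𝓡 n) (1 : G)).map_target hx)
    (by rwa [(extChartAt (𝓡 n) (1 : G)).right_inv hx])
  rw [(extChartAt (𝓡 n) (1 : G)).right_inv hx] at h
  exact h

theorem hasFDerivAt_fderiv_chartMul :
    HasFDerivAt (fderiv ℝ (chartMul n G))
      (fderiv ℝ (fderiv ℝ (chartMul n G))
        (extChartAt (𝓡 n) (1 : G) 1, extChartAt (𝓡 n) (1 : G) 1))
      (extChartAt (𝓡 n) (1 : G) 1, extChartAt (𝓡 n) (1 : G) 1) :=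
  (((contDiffAt_chartMul (n := n) (G := G)).fderiv_right (m := 1) (by norm_cast)).differentiableAt
    (by simp)).hasFDerivAt

/-- Near the identity `chartField` is a first partial derivative of `chartMul`, so its derivative is
a mixed second derivative and the bracket is the antisymmetrization of the latter. -/
theorem bracket_eq_second_derivative (X Y : GroupLieAlgebra (𝓡 n) G) :
    ⁅X, Y⁆ =
      (fderiv ℝ (fderiv ℝ (chartMul n G))
        (extChartAt (𝓡 n) (1 : G) 1, extChartAt (𝓡 n) (1 : G) 1) (X, 0) (0, Y) -
      fderiv ℝ (fderiv ℝ (chartMul n G))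
        (extChartAt (𝓡 n) (1 : G) 1, extChartAt (𝓡 n) (1 : G) 1) (Y, 0) (0, X) :
          EuclideanSpace ℝ (Fin n)) := by
  have h (X Y : EuclideanSpace ℝ (Fin n)) :
      fderiv ℝ (chartField G Y) (extChartAt (𝓡 n) (1 : G) 1) X =
      fderiv ℝ (fderiv ℝ (chartMul n G))
        (extChartAt (𝓡 n) (1 : G) 1, extChartAt (𝓡 n) (1 : G) 1) (X, 0) (0, Y) := by
    rw [(chartField_eventuallyEq Y).fderiv_eq]
    have h1 := HasFDerivAt.comp (f := fun y => (y, extChartAt (𝓡 n) (1 : G) 1))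
      (extChartAt (𝓡 n) (1 : G) 1) (hasFDerivAt_fderiv_chartMul (n := n) (G := G))
      (hasFDerivAt_prodMk_left (𝕜 := ℝ) _ _)
    have h2 := h1.clm_apply (hasFDerivAt_const (0, Y) (extChartAt (𝓡 n) (1 : G) 1))
    have h3 := h2.fderiv
    simp only [Function.comp_def] at h3
    rw [h3]
    simp
  exact (bracket_eq_fderiv_chartField X Y).trans
    (congrArg₂ (fun a b : EuclideanSpace ℝ (Fin n) => a - b) (h X Y) (h Y X))

theorem fderiv_chartMul_one (X Y : EuclideanSpace ℝ (Fin n)) :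
    fderiv ℝ (chartMul n G) (extChartAt (𝓡 n) (1 : G) 1, extChartAt (𝓡 n) (1 : G) 1) (X, Y) =
      X + Y := by
  have hX := modelDeriv_chart_right (n := n) (g := (1 : G)) X (mem_extChartAt_source 1)
    (eventually_differentiableAt_chartMul.self_of_nhds)
  have hY := modelDeriv_chart_left (n := n) (g := (1 : G)) Y (mem_extChartAt_source 1)
    (eventually_differentiableAt_chartMul.self_of_nhds)
  have hid : (fun b : G => b * 1) = id := by ext; simp
  rw [modelDeriv_extChartAt_one, rightField, hid, modelDeriv, mfderiv_id] at hX
  rw [modelDeriv_extChartAt_one, leftField_one] at hY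
  have h : (X, Y) = (X, 0) + (0, Y) := by simp
  rw [h, map_add, ← hX, ← hY]
  rfl

/-- The velocity at `1` of a product of curves. -/
theorem HasVelocityWithinAt.mul_one {φ ψ : ℝ → G} {X Y : EuclideanSpace ℝ (Fin n)}
    (hφ : HasVelocityWithinAt (𝓡 n) φ X Set.univ 0) (hψ : HasVelocityWithinAt (𝓡 n) ψ Y Set.univ 0)
    (hφ0 : φ 0 = 1) (hψ0 : ψ 0 = 1) :
    HasVelocityWithinAt (𝓡 n) (fun t => φ t * ψ t) (X + Y) Set.univ 0 := by
  set e := extChartAt (𝓡 n) (1 : G) with he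
  have hcurve {φ : ℝ → G} {X : EuclideanSpace ℝ (Fin n)}
      (h : HasVelocityWithinAt (𝓡 n) φ X Set.univ 0) (h0 : φ 0 = 1) :
      HasDerivAt (fun t => e (φ t)) X 0 ∧ ∀ᶠ t in 𝓝 0, φ t ∈ e.source := by
    constructor
    · have h1 := h.comp_curve (f := e) (I' := 𝓘(ℝ, EuclideanSpace ℝ (Fin n)))
        (mdifferentiableAt_extChartAt_one (by rw [h0]; exact mem_extChartAt_source 1))
      rw [h0, modelDeriv_extChartAt_one] at h1
      simpa using h1.hasDerivWithinAt
    · refine (h.1.continuousAt univ_mem).eventually_mem ?_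
      rw [h0]
      exact extChartAt_source_mem_nhds 1
  obtain ⟨h1, h1'⟩ := hcurve hφ hφ0
  obtain ⟨h2, h2'⟩ := hcurve hψ hψ0
  -- In the chart, the derivative of the multiplication at the identity is addition.
  have h3 : HasDerivAt (fun t => chartMul n G (e (φ t), e (ψ t))) (X + Y) 0 := by
    have hd : HasFDerivAt (chartMul n G) (fderiv ℝ (chartMul n G) (e 1, e 1))
      (e (φ 0), e (ψ 0)) := by
      rw [hφ0, hψ0]
      exact (eventually_differentiableAt_chartMul.self_of_nhds).hasFDerivAt
    have := hd.comp_hasDerivAt 0 (h1.prodMk h2)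
    rwa [fderiv_chartMul_one] at this
  have h4 : HasVelocityWithinAt 𝓘(ℝ, EuclideanSpace ℝ (Fin n))
      (fun t => chartMul n G (e (φ t), e (ψ t))) (X + Y) Set.univ 0 :=
    hasMFDerivAt_iff_hasVelocityWithinAt.1 h3.hasFDerivAt.hasMFDerivAt
  have hv0 : chartMul n G (e (φ 0), e (ψ 0)) = e 1 := by
    rw [chartMul, hφ0, hψ0, ← he, extChartAt_to_inv, _root_.mul_one]
  have h5 := h4.comp_curve (f := e.symm) (I' := 𝓡 n) (by
    rw [hv0]
    exact contMDiffAt_extChartAt_one_symm.mdifferentiableAt (by simp))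
  rw [hv0, modelDeriv_extChartAt_one_symm] at h5
  have : ContinuousMul G := continuousMul_of_contMDiffMul (𝓡 n) ∞
  have hp : ∀ᶠ t in 𝓝 0, φ t * ψ t ∈ e.source := by
    refine ((hφ.1.continuousAt univ_mem).mul (hψ.1.continuousAt univ_mem)).eventually_mem ?_
    rw [Pi.mul_apply, hφ0, hψ0, _root_.mul_one]
    exact extChartAt_source_mem_nhds 1
  have h6 : (fun t => φ t * ψ t) =ᶠ[𝓝 0] fun t => e.symm (chartMul n G (e (φ t), e (ψ t))) := by
    filter_upwards [h1', h2', hp] with t ht1 ht2 ht3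
    rw [chartMul, ← he, e.left_inv ht1, e.left_inv ht2, e.left_inv ht3]
  exact h5.congr (by rwa [nhdsWithin_univ]) h6.self_of_nhds

variable [T2Space G]

/-- A form of $\frac{d}{dt}\mathrm{Ad}(\exp tX)Y=[X,Y]$ at $t=0$, for vanishing bracket. With
$g=\exp tX$ and `F'` the derivative of the chart multiplication, the relation of left and right
fields reads $F'(e1,eg)(\mathrm{Ad}(g)Y,0)=F'(eg,e1)(0,Y)$. Subtracting $F'(e1,eg)(Y,0)$ gives a
right side with derivative $[X,Y]=0$ at 0, by symmetry of the second derivative. On the left,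
$F'(e1,eg)(\cdot,0)$ is close to the identity, so $\mathrm{Ad}(g)Y-Y$ is $o(t)$ too. -/
theorem hasDerivAt_adjointMap_modelExp_zero {X Y : EuclideanSpace ℝ (Fin n)}
    (h : LieCommute G X Y) :
    HasDerivAt (fun t : ℝ => adjointMap n (modelExp G (t • X)) Y) 0 0 := by
  set e := extChartAt (𝓡 n) (1 : G) with he
  set F' := fderiv ℝ (chartMul n G) with hF'
  set F'' := fderiv ℝ F' (e 1, e 1) with hF''
  set g : ℝ → G := fun t => modelExp G (t • X) with hg
  have hg0 : g 0 = 1 := by simp [hg, modelExp_zero]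
  have hgc : Continuous g := continuous_modelExp_smul X
  have hx : HasDerivAt (fun t => e (g t)) X 0 := by
    have h1 := (hasVelocityWithinAt_modelExp (G := G) X Set.univ 0).comp_curve (f := e)
      (I' := 𝓘(ℝ, EuclideanSpace ℝ (Fin n)))
      (mdifferentiableAt_extChartAt_one (by simp [modelExp_zero]))
    have h2 := h1.hasDerivWithinAt
    rw [zero_smul, modelExp_zero, leftField_one, modelDeriv_extChartAt_one,
      hasDerivWithinAt_univ] at h2
    exact h2
  have hx0 : e (g 0) = e 1 := by rw [hg0]
  have hF : HasFDerivAt F' F'' (e 1, e 1) := hasFDerivAt_fderiv_chartMul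
  have hl : HasDerivAt (fun t => F' (e (g t), e 1)) (F'' (X, 0)) 0 := by
    rw [← hx0] at hF ⊢
    exact HasFDerivAt.comp_hasDerivAt (f := fun t => (e (g t), e (g 0))) 0 hF
      (hx.prodMk (hasDerivAt_const 0 (e (g 0))))
  have hr : HasDerivAt (fun t => F' (e 1, e (g t))) (F'' (0, X)) 0 := by
    rw [← hx0] at hF ⊢
    exact HasFDerivAt.comp_hasDerivAt (f := fun t => (e (g 0), e (g t))) 0 hF
      ((hasDerivAt_const 0 (e (g 0))).prodMk hx)
  have hsymm : F'' (0, X) (Y, 0) = F'' (Y, 0) (0, X) :=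
    ((contDiffAt_chartMul (n := n) (G := G)).isSymmSndFDerivAt
      (by rw [minSmoothness_of_isRCLikeNormedField]; norm_cast)).eq _ _
  have hb : F'' (X, 0) (0, Y) - F'' (Y, 0) (0, X) = 0 :=
    (bracket_eq_second_derivative (G := G) X Y).symm.trans h
  have hrem : HasDerivAt (fun t => F' (e (g t), e 1) (0, Y) - F' (e 1, e (g t)) (Y, 0)) 0 0 := by
    have h1 := (hl.clm_apply (hasDerivAt_const 0 ((0 : EuclideanSpace ℝ (Fin n)), Y))).sub
      (hr.clm_apply (hasDerivAt_const 0 (Y, (0 : EuclideanSpace ℝ (Fin n)))))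
    exact h1.congr_deriv (by simp [hsymm, hb])
  have hd1 : Tendsto (fun t => (e (g t), e 1)) (𝓝 0) (𝓝 (e 1, e 1)) := by
    have := (hx.continuousAt.prodMk (continuousAt_const (y := e 1))).tendsto
    rwa [hx0] at this
  have hd2 : Tendsto (fun t => (e 1, e (g t))) (𝓝 0) (𝓝 (e 1, e 1)) := by
    have := ((continuousAt_const (y := e 1)).prodMk hx.continuousAt).tendsto
    rwa [hx0] at this
  have hsrc : ∀ᶠ t in 𝓝 (0 : ℝ), g t ∈ e.source := by
    refine hgc.continuousAt.eventually_mem ?_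
    rw [hg0]
    exact extChartAt_source_mem_nhds 1
  have hone (Z) : F' (e 1, e 1) (Z, 0) = Z := by
    rw [hF', fderiv_chartMul_one, add_zero]
  -- An operator at distance less than 1/2 from the identity shrinks norms by at most a factor 2.
  have hinv : ∀ᶠ t in 𝓝 (0 : ℝ), ∀ Z, ‖Z‖ ≤ 2 * ‖F' (e 1, e (g t)) (Z, 0)‖ := by
    have h1 := hr.continuousAt.eventually (Metric.ball_mem_nhds _ (by norm_num : (0 : ℝ) < 1 / 2))
    filter_upwards [h1] with t ht Z
    rw [dist_eq_norm, hx0] at ht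
    have h2 := (F' (e 1, e (g t)) - F' (e 1, e 1)).le_opNorm (Z, 0)
    rw [sub_apply, hone] at h2
    have h3 : ‖((Z, 0) : EuclideanSpace ℝ (Fin n) × EuclideanSpace ℝ (Fin n))‖ = ‖Z‖ := by
      simp [Prod.norm_def]
    rw [h3] at h2
    have h4 := norm_sub_norm_le Z (F' (e 1, e (g t)) (Z, 0))
    rw [norm_sub_rev] at h4
    nlinarith [norm_nonneg Z]
  have hrel : ∀ᶠ t in 𝓝 (0 : ℝ), F' (e 1, e (g t)) (adjointMap n (g t) Y - Y, 0) =
      F' (e (g t), e 1) (0, Y) - F' (e 1, e (g t)) (Y, 0) := by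
    filter_upwards [hsrc, hd1.eventually eventually_differentiableAt_chartMul,
      hd2.eventually eventually_differentiableAt_chartMul] with t ht h1 h2
    rw [← modelDeriv_chart_left Y ht h1, ← rightField_adjointMap, modelDeriv_chart_right _ ht h2,
      ← map_sub, Prod.mk_sub_mk, sub_zero]
  change HasDerivAt (fun t => adjointMap n (g t) Y) 0 0
  rw [hasDerivAt_iff_isLittleO] at hrem ⊢
  simp only [sub_zero, smul_zero, hg0, adjointMap_one, hone] at hrem ⊢
  have hz : F' (e 1, e 1) (0, Y) = Y := by
    rw [hF', fderiv_chartMul_one, zero_add]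
  simp only [hz, sub_self, sub_zero] at hrem
  refine (Asymptotics.IsBigO.of_bound 2 ?_).trans_isLittleO hrem
  filter_upwards [hinv, hrel] with t h1 h2
  rw [← h2]
  exact h1 _

/-- The curve $\mathrm{Ad}(\exp tX)Y$ has zero derivative at 0, hence at every $s$ by factoring out
$\mathrm{Ad}(\exp sX)$; so it is constant. -/
theorem adjointMap_modelExp {X Y : EuclideanSpace ℝ (Fin n)}
    (h : LieCommute G X Y) :
    adjointMap n (modelExp G X) Y = Y := by
  have h0 := hasDerivAt_adjointMap_modelExp_zero h
  have hs (s : ℝ) : HasDerivAt (fun t : ℝ => adjointMap n (modelExp G (t • X)) Y) 0 s := by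
    have h1 : (fun t : ℝ => adjointMap n (modelExp G (t • X)) Y) =
        fun t => adjointMap n (modelExp G (s • X)) (adjointMap n (modelExp G ((t - s) • X)) Y) := by
      ext1 t
      rw [← adjointMap_mul, ← modelExp_add_smul]
      simp
    rw [h1]
    rw [← sub_self s] at h0
    have h2 := h0.comp_sub_const s s
    exact ((adjointMap n (modelExp G (s • X))).hasFDerivAt.comp_hasDerivAt s h2).congr_deriv
      (map_zero _)
  have h1 := is_const_of_deriv_eq_zero (fun s => (hs s).differentiableAt)
    (fun s => (hs s).deriv) 1 0
  simpa [modelExp_zero, adjointMap_one] using h1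

/-- A conjugate of a one-parameter subgroup is again one, with the initial velocity transformed by
the adjoint map. -/
theorem conj_modelExp (g : G) (Y : EuclideanSpace ℝ (Fin n)) :
    g * modelExp G Y * g⁻¹ = modelExp G (adjointMap n g Y) := by
  have h1 := (hasVelocityWithinAt_modelExp (G := G) Y Set.univ 0).comp_curve
    (LieGroup.mdifferentiableAt_conj (n := n) g _)
  rw [zero_smul, modelExp_zero, leftField_one] at h1
  have h2 := modelExp_smul_eq_of_hom (p := fun t : ℝ => g * modelExp G (t • Y) * g⁻¹)
    (fun s t => by rw [modelExp_add_smul]; group) h1 1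
  rw [one_smul, one_smul] at h2
  exact h2.symm

theorem modelExp_commute {X Y : EuclideanSpace ℝ (Fin n)}
    (h : LieCommute G X Y) :
    (modelExp G X : G) * modelExp G Y = modelExp G Y * modelExp G X := by
  rw [← mul_inv_eq_iff_eq_mul, conj_modelExp, adjointMap_modelExp h]

/-- The exponential map is additive on commuting elements. -/
theorem modelExp_add {X Y : EuclideanSpace ℝ (Fin n)}
    (h : LieCommute G X Y) :
    (modelExp G (X + Y) : G) = modelExp G X * modelExp G Y := by
  have hst (s t : ℝ) : (modelExp G (s • X) : G) * modelExp G (t • Y) =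
      modelExp G (t • Y) * modelExp G (s • X) := by
    refine modelExp_commute ?_
    have h2 (X Y : GroupLieAlgebra (𝓡 n) G) (h : ⁅X, Y⁆ = 0) : ⁅s • X, t • Y⁆ = 0 := by
      rw [smul_lie, lie_smul, h, smul_zero, smul_zero]
    exact h2 X Y h
  -- The product of commuting one-parameter subgroups is a one-parameter subgroup, so its velocity
  -- at 0 identifies it.
  have hv : HasVelocityWithinAt (𝓡 n) (fun t : ℝ => modelExp G (t • X) * modelExp G (t • Y) : ℝ → G)
      (X + Y) Set.univ 0 := by
    have hX := hasVelocityWithinAt_modelExp (G := G) X Set.univ 0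
    have hY := hasVelocityWithinAt_modelExp (G := G) Y Set.univ 0
    rw [zero_smul, modelExp_zero, leftField_one] at hX hY
    exact hX.mul_one hY (by simp [modelExp_zero]) (by simp [modelExp_zero])
  have h2 := modelExp_smul_eq_of_hom
    (p := fun t : ℝ => (modelExp G (t • X) * modelExp G (t • Y) : G))
    (fun s t => by
      rw [modelExp_add_smul, modelExp_add_smul, mul_assoc, mul_assoc,
        ← mul_assoc (modelExp G (t • X)) (modelExp G (s • Y)), hst t s, mul_assoc]) hv 1
  simpa using h2

end Commuting

/-! ## Exponentials of abelian subalgebras -/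

section Flats

open Filter Topology

/-- A closed subgroup of a finite dimensional space which contains no line is countable. -/
theorem AddSubgroup.countable_of_no_line {V : Type*} [NormedAddCommGroup V] [NormedSpace ℝ V]
    [FiniteDimensional ℝ V] (L : AddSubgroup V) (hc : IsClosed (L : Set V))
    (hL : ∀ x : V, (∀ t : ℝ, t • x ∈ L) → x = 0) : (L : Set V).Countable := by
  -- Arbitrarily short non-zero elements would have an accumulating direction `u`; rounding `t /
  -- ‖x‖` to an integer approximates `t • u` by elements of `L`, and closedness puts the whole line
  -- into `L`.
  have hε : ∃ ε > 0, ∀ x ∈ L, ‖x‖ < ε → x = 0 := by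
    by_contra! hcon
    have h1 (j : ℕ) : ∃ x ∈ L, ‖x‖ < 1 / ((j : ℝ) + 1) ∧ x ≠ 0 := by
      obtain ⟨x, h⟩ := hcon (1 / ((j : ℝ) + 1)) (by positivity)
      exact ⟨x, h⟩
    choose x hxL hxn hx0 using h1
    have hpos (j) : 0 < ‖x j‖ := norm_pos_iff.2 (hx0 j)
    have hlim : Tendsto (fun j => ‖x j‖) atTop (𝓝 0) :=
      squeeze_zero (fun _ => norm_nonneg _) (fun j => (hxn j).le)
        tendsto_one_div_add_atTop_nhds_zero_nat
    have hmem (j) : ‖x j‖⁻¹ • x j ∈ Metric.sphere (0 : V) 1 := by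
      rw [mem_sphere_zero_iff_norm, norm_smul, norm_inv, norm_norm, inv_mul_cancel₀ (hpos j).ne']
    obtain ⟨u, hu, φ, hφ, hφu⟩ := (isCompact_sphere (0 : V) 1).tendsto_subseq hmem
    have hline (t : ℝ) : t • u ∈ L := by
      have h2 : Tendsto (fun j => ((⌊t / ‖x (φ j)‖⌋ : ℤ) : ℝ) * ‖x (φ j)‖) atTop (𝓝 t) := by
        have h3 : Tendsto (fun j => ‖x (φ j)‖) atTop (𝓝 0) := hlim.comp hφ.tendsto_atTop
        rw [tendsto_iff_norm_sub_tendsto_zero]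
        refine squeeze_zero (fun _ => norm_nonneg _) (fun j => ?_) h3
        have h4 : t = t / ‖x (φ j)‖ * ‖x (φ j)‖ := by field_simp [(hpos (φ j)).ne']
        have h5 := Int.floor_le (t / ‖x (φ j)‖)
        have h6 := Int.lt_floor_add_one (t / ‖x (φ j)‖)
        rw [Real.norm_eq_abs, abs_le]
        constructor <;> nlinarith [hpos (φ j)]
      have h3 := h2.smul hφu
      refine hc.mem_of_tendsto h3 (Eventually.of_forall fun j => ?_)
      have h4 : (((⌊t / ‖x (φ j)‖⌋ : ℤ) : ℝ) * ‖x (φ j)‖) •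
          ((fun j => ‖x j‖⁻¹ • x j) ∘ φ) j = ⌊t / ‖x (φ j)‖⌋ • x (φ j) := by
        simp only [Function.comp_apply]
        rw [smul_smul, mul_assoc, mul_inv_cancel₀ (hpos (φ j)).ne', mul_one, Int.cast_smul_eq_zsmul]
      rw [h4]
      exact L.zsmul_mem (hxL _) _
    have := hL u hline
    simp [this] at hu
  obtain ⟨ε, hε, h⟩ := hε
  have hd : DiscreteTopology L := by
    rw [discreteTopology_iff_isOpen_singleton_zero]
    have : ({0} : Set L) = {x : L | ‖(x : V)‖ < ε} := by
      ext x
      simp only [Set.mem_singleton_iff, Set.mem_ofPred_eq]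
      exact ⟨fun hx => by simp [hx, hε], fun hx => Subtype.ext (h x x.2 hx)⟩
    rw [this]
    exact isOpen_lt (by fun_prop) continuous_const
  exact Set.countable_coe_iff.1 (TopologicalSpace.separableSpace_iff_countable.1 inferInstance)

variable {n : ℕ} {G : Type*} [TopologicalSpace G] [ChartedSpace (EuclideanSpace ℝ (Fin n)) G]
  [Group G] {V : Type*} [NormedAddCommGroup V] [NormedSpace ℝ V]

/-- The linear map `ι` identifies `V` with an abelian Lie algebra of left invariant fields. -/
def IsFlat (G : Type*) [TopologicalSpace G] [ChartedSpace (EuclideanSpace ℝ (Fin n)) G]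
    [Group G] (ι : V →ₗ[ℝ] EuclideanSpace ℝ (Fin n)) : Prop :=
  ∀ x y, LieCommute G (ι x) (ι y)

variable [LieGroup (𝓡 n) ∞ G] [T2Space G] {ι : V →ₗ[ℝ] EuclideanSpace ℝ (Fin n)}

theorem IsFlat.modelExp_add (h : IsFlat G ι) (x y : V) :
    modelExp G (ι (x + y)) = modelExp G (ι x) * modelExp G (ι y) := by
  rw [map_add, _root_.modelExp_add (h x y)]

/-- In a flat, the exponential of an affine line is a left translate of a one-parameter subgroup. -/
theorem IsFlat.hasVelocityWithinAt (h : IsFlat G ι) (g : G) (y w : V) (t s : ℝ) (A : Set ℝ) :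
    HasVelocityWithinAt (𝓡 n) (fun s : ℝ => g * modelExp G (ι (y + (s - t) • w)))
      (leftField (ι w) (g * modelExp G (ι (y + (s - t) • w)))) A s := by
  have h1 : (fun s : ℝ => g * modelExp G (ι (y + (s - t) • w))) =
      fun s => (g * modelExp G (ι (y + (-t) • w))) * modelExp G (s • ι w) := by
    ext s
    rw [← map_smul, mul_assoc, ← h.modelExp_add]
    congr 3
    module
  have h2 := congrFun h1 s
  rw [show g * modelExp G (ι (y + (s - t) • w)) = _ from h2, h1]
  exact (hasVelocityWithinAt_modelExp (ι w) A s).mul_left _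

/-- Expanding in a basis writes the map as a finite product of one-parameter subgroups of the
coordinates. -/
theorem IsFlat.continuous [FiniteDimensional ℝ V] (h : IsFlat G ι) :
    Continuous fun x => modelExp G (ι x) := by
  have : ContinuousMul G := continuousMul_of_contMDiffMul (𝓡 n) ∞
  let b := Module.finBasis ℝ V
  have h1 (s : Finset (Fin (Module.finrank ℝ V))) :
      Continuous fun x => modelExp G (ι (∑ i ∈ s, b.repr x i • b i)) := by
    classical
    induction s using Finset.induction_on with
    | empty => simpa using continuous_const
    | insert i s hi ih =>
      simp only [Finset.sum_insert hi, h.modelExp_add]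
      refine Continuous.mul ?_ ih
      simp only [map_smul]
      have : Continuous fun x => b.repr x i :=
        (b.coord i).continuous_of_finiteDimensional
      exact (continuous_modelExp_smul (G := G) (ι (b i))).comp this
  simpa [b.sum_repr] using h1 Finset.univ

variable {d : ℕ} {M : Type*} [TopologicalSpace M] [ChartedSpace (EuclideanSpace ℝ (Fin d)) M]
  [IsManifold (𝓡 d) ∞ M] [MulAction G M]

/-- The vectors in a flat which the exponential map sends to the basepoint. -/
def IsFlat.lattice (h : IsFlat G ι) (o : M) : AddSubgroup V where
  carrier := {x | modelExp G (ι x) • o = o}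
  zero_mem' := by simp [modelExp_zero]
  add_mem' {x y} hx hy := by
    rw [Set.mem_ofPred_eq] at *
    rw [h.modelExp_add, mul_smul, hy, hx]
  neg_mem' {x} hx := by
    rw [Set.mem_ofPred_eq] at *
    have h1 : modelExp G (ι (-x)) * modelExp G (ι x) = 1 := by
      rw [← h.modelExp_add]; simp [modelExp_zero]
    rw [eq_inv_of_mul_eq_one_left h1, inv_smul_eq_iff, hx]

theorem IsFlat.mem_lattice (h : IsFlat G ι) {o : M} {x : V} :
    x ∈ h.lattice o ↔ modelExp G (ι x) • o = o := Iff.rfl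

theorem HasVelocityWithinAt.unique {φ : ℝ → G} {X Y : EuclideanSpace ℝ (Fin n)} {t : ℝ}
    (hX : HasVelocityWithinAt (𝓡 n) φ X Set.univ t)
    (hY : HasVelocityWithinAt (𝓡 n) φ Y Set.univ t) : X = Y := by
  have h := hasMFDerivAt_unique (hasMFDerivAt_iff_hasVelocityWithinAt.2 hX)
    (hasMFDerivAt_iff_hasVelocityWithinAt.2 hY)
  have h2 := congrArg (fun L : ℝ →L[ℝ] EuclideanSpace ℝ (Fin n) => L 1) h
  simpa using h2

/-- The one-parameter subgroup lies in the stabilizer, hence is fixed by `σ`. Comparing velocities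
at 0 gives $X=-X$. -/
theorem SymmetricSpace.eq_zero_of_forall_smul_mem (S : SymmetricSpace n d G M)
    {X : EuclideanSpace ℝ (Fin n)} (hX : modelDeriv (𝓡 n) (𝓡 n) S.σ 1 X = -X)
    (h : ∀ t : ℝ, modelExp G (t • X) • S.o = S.o) : X = 0 := by
  have h1 := hasVelocityWithinAt_modelExp (G := G) X Set.univ 0
  have h2 := h1.comp_curve (f := S.σ) (I' := 𝓡 n)
    (S.contMDiff_σ.mdifferentiableAt (by simp))
  have h3 (t : ℝ) : S.σ (modelExp G (t • X)) = modelExp G (t • X) := S.stabilizer_subset (h t)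
  simp only [h3] at h2
  rw [zero_smul, modelExp_zero, leftField_one] at h1 h2
  rw [hX] at h2
  have h4 : (2 : ℝ) • X = 0 := by
    rw [two_smul]
    nth_rewrite 1 [h1.unique h2]
    exact neg_add_cancel X
  exact (smul_eq_zero.1 h4).resolve_left two_ne_zero

theorem IsFlat.countable_lattice [FiniteDimensional ℝ V] (h : IsFlat G ι)
    (S : SymmetricSpace n d G M) [T2Space M] [ContinuousSMul G M]
    (hι : Function.Injective ι) (hm : ∀ x, modelDeriv (𝓡 n) (𝓡 n) S.σ 1 (ι x) = -ι x) :
    (h.lattice S.o : Set V).Countable := by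
  refine AddSubgroup.countable_of_no_line _ ?_ fun x hx => ?_
  · exact isClosed_eq (h.continuous.smul continuous_const) continuous_const
  · refine hι (map_zero ι ▸ S.eq_zero_of_forall_smul_mem (hm x) fun t => ?_)
    have := hx t
    rwa [h.mem_lattice, map_smul] at this

end Flats

/-! ## Polygons -/

section Polygons

open Filter Topology

/-! ### Local affine structure of polygons and of families of polygons. -/

section Affine

variable {V : Type*} [AddCommGroup V] [Module ℝ V]

/-- Near `t` and within `A`, the curve `c` is affine with slope `v`. -/
def IsAffineAt (c : ℝ → V) (v : V) (A : Set ℝ) (t : ℝ) : Prop :=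
  ∀ᶠ s in 𝓝[A] t, c s = c t + (s - t) • v

/-- The local properties of a polygon with slopes in `S` and breakpoints in `B`. -/
structure IsPiecewiseAffineOn (c : ℝ → V) (S : Set V) (B : Set ℝ) (a b : ℝ) : Prop where
  right : ∀ t ∈ Set.Ico a b, ∃ v ∈ S, IsAffineAt c v (Set.Ici t) t
  left : ∀ t ∈ Set.Ioc a b, ∃ v ∈ S, IsAffineAt c v (Set.Iic t) t
  generic : ∀ t ∈ Set.Ioo a b, t ∉ B → ∃ v ∈ S, IsAffineAt c v Set.univ t

theorem isAffineAt_of_eqOn {c : ℝ → V} {u v : V} {a b t : ℝ} {A : Set ℝ}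
    (h : ∀ t ∈ Set.Icc a b, c t = u + t • v) (ht : t ∈ Set.Icc a b)
    (hA : Set.Icc a b ∈ 𝓝[A] t) : IsAffineAt c v A t := by
  filter_upwards [hA] with s hs
  rw [h s hs, h t ht]
  module

theorem IsPolygonOn.isPiecewiseAffineOn {c : ℝ → V} {a b : ℝ} (h : IsPolygonOn c a b) :
    ∃ (S : Set V) (B : Set ℝ), S.Finite ∧ B.Finite ∧ IsPiecewiseAffineOn c S B a b := by
  obtain ⟨N, τ, hτ, rfl, rfl, h⟩ := h
  choose! u v h using h
  refine ⟨v '' Set.Iio N, τ '' Set.Iic N, (Set.finite_Iio N).image _, (Set.finite_Iic N).image _,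
    ?_⟩
  -- The first breakpoint beyond `t` ends a segment of positive length, so repeated breakpoints do
  -- no harm.
  have key1 (t) (ht : t ∈ Set.Ico (τ 0) (τ N)) : ∃ j < N, t ∈ Set.Ico (τ j) (τ (j + 1)) := by
    classical
    have hex : ∃ k, t < τ k := ⟨N, ht.2⟩
    have h0 : Nat.find hex ≠ 0 := fun h0 => (Nat.find_spec hex).not_ge (h0 ▸ ht.1)
    obtain ⟨j, hj⟩ := Nat.exists_eq_succ_of_ne_zero h0
    refine ⟨j, ?_, not_lt.1 (Nat.find_min hex (by omega)), ?_⟩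
    swap
    · have := Nat.find_spec hex
      rwa [hj] at this
    have := Nat.find_min' hex ht.2
    omega
  have key2 (t) (ht : t ∈ Set.Ioc (τ 0) (τ N)) : ∃ j < N, t ∈ Set.Ioc (τ j) (τ (j + 1)) := by
    classical
    have hex : ∃ k, t ≤ τ k := ⟨N, ht.2⟩
    have h0 : Nat.find hex ≠ 0 := fun h0 => (Nat.find_spec hex).not_gt (h0 ▸ ht.1)
    obtain ⟨j, hj⟩ := Nat.exists_eq_succ_of_ne_zero h0
    refine ⟨j, ?_, not_le.1 (Nat.find_min hex (by omega)), ?_⟩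
    swap
    · have := Nat.find_spec hex
      rwa [hj] at this
    have := Nat.find_min' hex ht.2
    omega
  constructor
  · intro t ht
    obtain ⟨j, hj, h1⟩ := key1 t ht
    exact ⟨v j, ⟨j, hj, rfl⟩, isAffineAt_of_eqOn (h j hj) ⟨h1.1, h1.2.le⟩ <|
      mem_of_superset (Icc_mem_nhdsGE h1.2) (Set.Icc_subset_Icc_left h1.1)⟩
  · intro t ht
    obtain ⟨j, hj, h1⟩ := key2 t ht
    exact ⟨v j, ⟨j, hj, rfl⟩, isAffineAt_of_eqOn (h j hj) ⟨h1.1.le, h1.2⟩ <|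
      mem_of_superset (Icc_mem_nhdsLE h1.1) (Set.Icc_subset_Icc_right h1.2)⟩
  · intro t ht hB
    obtain ⟨j, hj, h1⟩ := key1 t ⟨ht.1.le, ht.2⟩
    have h2 : τ j < t := lt_of_le_of_ne h1.1 fun h2 => hB ⟨j, hj.le, h2⟩
    refine ⟨v j, ⟨j, hj, rfl⟩, isAffineAt_of_eqOn (h j hj) ⟨h1.1, h1.2.le⟩ ?_⟩
    rw [nhdsWithin_univ]
    exact Icc_mem_nhds h2 h1.2

theorem IsAffineAt.prodMk {W : Type*} [AddCommGroup W] [Module ℝ W] {c : ℝ → V} {c' : ℝ → W}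
    {v : V} {w : W} {A : Set ℝ} {t : ℝ} (h : IsAffineAt c v A t) (h' : IsAffineAt c' w A t) :
    IsAffineAt (fun s => (c s, c' s)) (v, w) A t := by
  filter_upwards [h, h'] with s h1 h2
  rw [h1, h2]
  rfl

theorem IsPiecewiseAffineOn.prodMk {W : Type*} [AddCommGroup W] [Module ℝ W] {c : ℝ → V}
    {c' : ℝ → W} {S : Set V} {S' : Set W} {B B' : Set ℝ} {a b : ℝ}
    (h : IsPiecewiseAffineOn c S B a b) (h' : IsPiecewiseAffineOn c' S' B' a b) :
    IsPiecewiseAffineOn (fun s => (c s, c' s)) (S ×ˢ S') (B ∪ B') a b := by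
  constructor
  · intro t ht
    obtain ⟨v, hv, h1⟩ := h.right t ht
    obtain ⟨w, hw, h2⟩ := h'.right t ht
    exact ⟨(v, w), ⟨hv, hw⟩, h1.prodMk h2⟩
  · intro t ht
    obtain ⟨v, hv, h1⟩ := h.left t ht
    obtain ⟨w, hw, h2⟩ := h'.left t ht
    exact ⟨(v, w), ⟨hv, hw⟩, h1.prodMk h2⟩
  · intro t ht hB
    rw [Set.mem_union, not_or] at hB
    obtain ⟨v, hv, h1⟩ := h.generic t ht hB.1
    obtain ⟨w, hw, h2⟩ := h'.generic t ht hB.2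
    exact ⟨(v, w), ⟨hv, hw⟩, h1.prodMk h2⟩

/-- The interval on which the polygon number `i` of a family is parametrized. -/
def partInterval {m : ℕ} (i : Fin (m + 1)) : Set ℝ :=
  Set.Icc ((i : ℝ) / (m + 1)) ((i + 1) / (m + 1))

theorem exists_mem_Ico_part (m : ℕ) {t : ℝ} (ht : t ∈ Set.Ico (0 : ℝ) 1) :
    ∃ i : Fin (m + 1), t ∈ Set.Ico ((i : ℝ) / (m + 1)) ((i + 1) / (m + 1)) := by
  have hm : (0 : ℝ) < m + 1 := by positivity
  have h0 : 0 ≤ t * (m + 1) := mul_nonneg ht.1 hm.le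
  have h1 : ⌊t * (m + 1)⌋₊ < m + 1 := by
    rw [Nat.floor_lt h0]
    push_cast
    nlinarith [ht.2]
  refine ⟨⟨_, h1⟩, ?_, ?_⟩
  · rw [div_le_iff₀ hm]
    exact Nat.floor_le h0
  · rw [lt_div_iff₀ hm]
    exact Nat.lt_floor_add_one _

theorem exists_mem_Ioc_part (m : ℕ) {t : ℝ} (ht : t ∈ Set.Ioc (0 : ℝ) 1) :
    ∃ i : Fin (m + 1), t ∈ Set.Ioc ((i : ℝ) / (m + 1)) ((i + 1) / (m + 1)) := by
  have hm : (0 : ℝ) < m + 1 := by positivity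
  have h0 : 0 < t * (m + 1) := mul_pos ht.1 hm
  have h1 : ⌈t * (m + 1)⌉₊ ≤ m + 1 := by
    rw [Nat.ceil_le]
    push_cast
    nlinarith [ht.2]
  obtain ⟨j, hj⟩ := Nat.exists_eq_succ_of_ne_zero (Nat.ceil_pos.2 h0).ne'
  have h2 := Nat.ceil_lt_add_one h0.le
  have h3 := Nat.le_ceil (t * (m + 1))
  rw [hj] at h1 h2 h3
  push_cast at h2 h3
  refine ⟨⟨j, by omega⟩, ?_, ?_⟩
  · rw [div_lt_iff₀ hm]
    dsimp only
    linarith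
  · rw [le_div_iff₀ hm]
    exact h3

theorem exists_mem_partInterval (m : ℕ) {t : ℝ} (ht : t ∈ Set.Icc (0 : ℝ) 1) :
    ∃ i : Fin (m + 1), t ∈ partInterval i := by
  rcases ht.1.eq_or_lt with h | h
  · obtain ⟨i, hi⟩ := exists_mem_Ico_part m (t := t) ⟨ht.1, by rw [← h]; exact zero_lt_one⟩
    exact ⟨i, hi.1, hi.2.le⟩
  · obtain ⟨i, hi⟩ := exists_mem_Ioc_part m (t := t) ⟨h, ht.2⟩
    exact ⟨i, hi.1.le, hi.2⟩

/-- The local properties of a family of polygons. -/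
structure IsPiecewiseAffineFamily {m : ℕ} (c : Fin (m + 1) → ℝ → V) (S : Set V) (B : Set ℝ) :
    Prop where
  right : ∀ t ∈ Set.Ico (0 : ℝ) 1, ∃ i, partInterval i ∈ 𝓝[Set.Ici t] t ∧ ∃ v ∈ S,
    IsAffineAt (c i) v (Set.Ici t) t
  left : ∀ t ∈ Set.Ioc (0 : ℝ) 1, ∃ i, partInterval i ∈ 𝓝[Set.Iic t] t ∧ ∃ v ∈ S,
    IsAffineAt (c i) v (Set.Iic t) t
  generic : ∀ t ∈ Set.Ioo (0 : ℝ) 1, t ∉ B → ∃ i, partInterval i ∈ 𝓝[Set.univ] t ∧ ∃ v ∈ S,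
    IsAffineAt (c i) v Set.univ t

theorem isPiecewiseAffineFamily {m : ℕ} {c : Fin (m + 1) → ℝ → V}
    (h : ∀ i : Fin (m + 1), ∃ (S : Set V) (B : Set ℝ), S.Finite ∧ B.Finite ∧
      IsPiecewiseAffineOn (c i) S B (i / (m + 1)) ((i + 1) / (m + 1))) :
    ∃ (S : Set V) (B : Set ℝ), S.Finite ∧ B.Finite ∧ IsPiecewiseAffineFamily c S B := by
  choose S B hS hB h using h
  -- The joints are counted as breakpoints, so that a generic time is interior to its part.
  refine ⟨⋃ i, S i, (⋃ i, B i) ∪ Set.range fun i : Fin (m + 1) => (i : ℝ) / (m + 1),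
    Set.finite_iUnion hS, (Set.finite_iUnion hB).union (Set.finite_range _), ?_⟩
  constructor
  · intro t ht
    obtain ⟨i, hi⟩ := exists_mem_Ico_part m ht
    obtain ⟨v, hv, h1⟩ := (h i).right t hi
    exact ⟨i, mem_of_superset (Icc_mem_nhdsGE hi.2) (Set.Icc_subset_Icc_left hi.1), v,
      Set.mem_iUnion_of_mem i hv, h1⟩
  · intro t ht
    obtain ⟨i, hi⟩ := exists_mem_Ioc_part m ht
    obtain ⟨v, hv, h1⟩ := (h i).left t hi
    exact ⟨i, mem_of_superset (Icc_mem_nhdsLE hi.1) (Set.Icc_subset_Icc_right hi.2), v,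
      Set.mem_iUnion_of_mem i hv, h1⟩
  · intro t ht htB
    rw [Set.mem_union, not_or] at htB
    obtain ⟨i, hi⟩ := exists_mem_Ico_part m ⟨ht.1.le, ht.2⟩
    have h2 : (i : ℝ) / (m + 1) < t := lt_of_le_of_ne hi.1 fun h2 => htB.2 ⟨i, h2⟩
    obtain ⟨v, hv, h1⟩ := (h i).generic t ⟨h2, hi.2⟩ fun h3 => htB.1 (Set.mem_iUnion_of_mem i h3)
    refine ⟨i, ?_, v, Set.mem_iUnion_of_mem i hv, h1⟩
    rw [nhdsWithin_univ]
    exact Icc_mem_nhds h2 hi.2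

end Affine

section Normed

variable {V : Type*} [NormedAddCommGroup V] [NormedSpace ℝ V]

theorem IsAffineAt.continuousWithinAt {c : ℝ → V} {v : V} {A : Set ℝ} {t : ℝ}
    (h : IsAffineAt c v A t) : ContinuousWithinAt c A t := by
  have h1 : ContinuousWithinAt (fun s : ℝ => c t + (s - t) • v) A t := by fun_prop
  exact h1.congr_of_eventuallyEq h (by simp)

theorem IsPolygonOn.continuousOn {c : ℝ → V} {a b : ℝ} (h : IsPolygonOn c a b) :
    ContinuousOn c (Set.Icc a b) := by
  obtain ⟨S, B, -, -, h⟩ := h.isPiecewiseAffineOn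
  intro t ht
  have h1 : ContinuousWithinAt c (Set.Icc t b) t := by
    rcases ht.2.eq_or_lt with h1 | h1
    · rw [← h1, Set.Icc_self]; exact continuousWithinAt_singleton
    · obtain ⟨v, -, hv⟩ := h.right t ⟨ht.1, h1⟩
      exact hv.continuousWithinAt.mono fun s hs => hs.1
  have h2 : ContinuousWithinAt c (Set.Icc a t) t := by
    rcases ht.1.eq_or_lt with h1 | h1
    · rw [h1, Set.Icc_self]; exact continuousWithinAt_singleton
    · obtain ⟨v, -, hv⟩ := h.left t ⟨h1, ht.2⟩
      exact hv.continuousWithinAt.mono fun s hs => hs.2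
  rw [← Set.Icc_union_Icc_eq_Icc ht.1 ht.2]
  exact h2.union h1

end Normed

/-! ### Polygons which avoid a countable set. -/

section Avoiding

variable {V : Type*} [AddCommGroup V] [Module ℝ V]

/-- In dimension at least two, two points can be joined by a polygon which avoids a given countable
set in the interior. -/
theorem exists_polygon_avoiding (hV : 2 ≤ Module.finrank ℝ V) {L : Set V} (hL : L.Countable)
    (x y : V) {a b : ℝ} (hab : a < b) :
    ∃ c : ℝ → V, IsPolygonOn c a b ∧ c a = x ∧ c b = y ∧ ∀ t ∈ Set.Ioo a b, c t ∉ L := by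
  have : FiniteDimensional ℝ V := Module.finite_of_finrank_pos (by omega)
  have : Nontrivial V := Module.nontrivial_of_finrank_pos (R := ℝ) (by omega)
  -- The path will consist of two segments through `z = x + e + s • v`, with `v` independent of `e`.
  -- As `κ ≠ 1`, the `e`-coordinate of `z` differs from those of `x` and of `y`, including the case
  -- `x = y`.
  obtain ⟨e, κ, he, hκ, hxy⟩ : ∃ (e : V) (κ : ℝ), e ≠ 0 ∧ κ ≠ 1 ∧ y = x + κ • e := by
    by_cases h : y = x
    · obtain ⟨e, he⟩ := exists_ne (0 : V)
      exact ⟨e, 0, he, by norm_num, by simp [h]⟩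
    · refine ⟨(2⁻¹ : ℝ) • (y - x), 2, ?_, by norm_num, ?_⟩
      · exact smul_ne_zero (by norm_num) (sub_ne_zero.2 h)
      · module
  obtain ⟨f, hf⟩ : ∃ f : Module.Dual ℝ V, f e = 1 := by
    obtain ⟨f, hf⟩ := Module.exists_dual_forall_apply_ne_zero (K := ℝ) (fun _ : Unit => e)
      fun _ => he
    refine ⟨(f e)⁻¹ • f, ?_⟩
    simp [inv_mul_cancel₀ (hf ())]
  obtain ⟨v, hv0, hfv⟩ : ∃ v : V, v ≠ 0 ∧ f v = 0 := by
    have h1 := f.finrank_range_add_finrank_ker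
    have h2 : Module.finrank ℝ (LinearMap.range f) ≤ 1 := by
      simpa using (LinearMap.range f).finrank_le
    have h3 : LinearMap.ker f ≠ ⊥ := fun h3 => by
      rw [h3, finrank_bot] at h1
      omega
    obtain ⟨v, hv, hv0⟩ := (Submodule.ne_bot_iff _).1 h3
    exact ⟨v, hv0, hv⟩
  obtain ⟨g, hgv, hge⟩ : ∃ g : Module.Dual ℝ V, g v = 1 ∧ g e = 0 := by
    obtain ⟨g, hg⟩ := Module.exists_dual_forall_apply_ne_zero (K := ℝ) (fun _ : Unit => v)
      fun _ => hv0
    refine ⟨(g v)⁻¹ • (g - g e • f), ?_, ?_⟩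
    · simp [hfv, inv_mul_cancel₀ (hg ())]
    · simp [hf]
  -- If `l` lies on the line through `x` and `z`, away from `x`, then the coordinates `f` and `g` of
  -- `l - x` determine `s`; likewise for `y`. So each point of `L` excludes at most two values of
  -- `s`. A zero denominator yields 0, which only excludes a superfluous value.
  have hbad : ((fun l => g (l - x) / f (l - x)) '' L ∪
      (fun l => (1 - κ) * g (l - y) / f (l - y)) '' L).Countable :=
    (hL.image _).union (hL.image _)
  obtain ⟨s, hs⟩ : ∃ s : ℝ, s ∉ ((fun l => g (l - x) / f (l - x)) '' L ∪
      (fun l => (1 - κ) * g (l - y) / f (l - y)) '' L) := by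
    by_contra! hcon
    exact Set.not_countable_univ (hbad.mono fun s _ => hcon s)
  rw [Set.mem_union, not_or] at hs
  set z := x + e + s • v with hz
  have hx (r : ℝ) (hr : r ≠ 0) : x + r • (z - x) ∉ L := fun hl => hs.1 ⟨_, hl, by
    simp [hz, hf, hfv, hgv, hge, hr]⟩
  have hκ' : 1 - κ ≠ 0 := sub_ne_zero.2 hκ.symm
  have hy (r : ℝ) (hr : r ≠ 0) : y + r • (z - y) ∉ L := fun hl => hs.2 ⟨_, hl, by
    have hzy : z - y = (1 - κ) • e + s • v := by rw [hz, hxy]; module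
    simp only [hzy, add_sub_cancel_left, map_smul, map_add, hf, hfv, hgv, hge, smul_eq_mul,
      mul_zero, mul_one, add_zero, zero_add]
    field_simp⟩
  have hba : b - a ≠ 0 := (sub_pos.2 hab).ne'
  have hmid1 : a < (a + b) / 2 := by linarith
  have hmid2 : (a + b) / 2 < b := by linarith
  refine ⟨fun t => if t ≤ (a + b) / 2 then x + (2 * (t - a) / (b - a)) • (z - x)
    else y + (2 * (b - t) / (b - a)) • (z - y), ?_, ?_, ?_, ?_⟩
  · refine ⟨2, fun j => if j = 0 then a else if j = 1 then (a + b) / 2 else b, ?_, by simp,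
      by simp, ?_⟩
    · refine monotone_nat_of_le_succ fun j => ?_
      rcases j with _ | _ | j
      · simpa using hmid1.le
      · simpa using hmid2.le
      · simp
    · intro j hj
      interval_cases j
      · refine ⟨x - (2 * a / (b - a)) • (z - x), (2 / (b - a)) • (z - x), fun t ht => ?_⟩
        simp only [zero_add, one_ne_zero, if_true, if_false] at ht
        dsimp only
        rw [if_pos ht.2]
        module
      · refine ⟨y + (2 * b / (b - a)) • (z - y), (-2 / (b - a)) • (z - y), fun t ht => ?_⟩
        simp only [one_ne_zero, if_true, if_false, Nat.reduceAdd, OfNat.ofNat_ne_zero,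
          OfNat.ofNat_ne_one] at ht
        dsimp only
        split_ifs with h1
        · have h2 : t = (a + b) / 2 := le_antisymm h1 ht.1
          have h3 : 2 * (t - a) / (b - a) = 1 := by rw [h2]; field_simp; ring
          have h4 : 2 * b / (b - a) + t * (-2 / (b - a)) = 1 := by rw [h2]; field_simp; ring
          rw [h3, add_assoc, smul_smul, ← add_smul, h4]
          module
        · module
  · simp [hmid1.le]
  · simp [hmid2.not_ge]
  · intro t ht
    dsimp only
    split_ifs with h
    · exact hx _ (div_ne_zero (mul_ne_zero two_ne_zero (sub_pos.2 ht.1).ne') hba)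
    · exact hy _ (div_ne_zero (mul_ne_zero two_ne_zero (sub_pos.2 ht.2).ne') hba)

/-- The functional has a non-zero kernel vector in dimension at least two, so a non-empty level set
contains a line and is uncountable. -/
theorem exists_mem_plane_notMem (hV : 2 ≤ Module.finrank ℝ V) {L : Set V} (hL : L.Countable)
    (α : Module.Dual ℝ V) (k : ℝ) {x : V} (hx : α x = k) : ∃ y, α y = k ∧ y ∉ L := by
  have : FiniteDimensional ℝ V := Module.finite_of_finrank_pos (by omega)
  obtain ⟨v, hv0, hαv⟩ : ∃ v : V, v ≠ 0 ∧ α v = 0 := by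
    have h1 := α.finrank_range_add_finrank_ker
    have h2 : Module.finrank ℝ (LinearMap.range α) ≤ 1 := by
      simpa using (LinearMap.range α).finrank_le
    have h3 : LinearMap.ker α ≠ ⊥ := fun h3 => by
      rw [h3, finrank_bot] at h1
      omega
    obtain ⟨v, hv, hv0⟩ := (Submodule.ne_bot_iff _).1 h3
    exact ⟨v, hv0, hv⟩
  have hinj : Function.Injective fun s : ℝ => x + s • v := fun s s' h =>
    smul_left_injective ℝ hv0 (add_left_cancel h)
  by_contra! hcon
  refine Set.not_countable_univ ((hL.preimage hinj).mono fun s _ => hcon (x + s • v) ?_)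
  simp [hx, hαv]

/-- Each family of polygons for planes can be replaced by one which avoids a given countable set
outside of its endpoints. -/
theorem IsPolygonFamily.exists_avoiding (hV : 2 ≤ Module.finrank ℝ V) {L : Set V}
    (hL : L.Countable) {m : ℕ} {P : Fin m → Set V} {c : Fin (m + 1) → ℝ → V}
    (hc : IsPolygonFamily P c)
    (hP : ∀ i, ∃ (α : Module.Dual ℝ V) (k : ℝ), P i = {x | α x = k}) :
    ∃ c' : Fin (m + 1) → ℝ → V, IsPolygonFamily P c' ∧
      ∀ i, ∀ t ∈ partInterval i, t ∈ Set.Ioo (0 : ℝ) 1 → c' i t ∉ L := by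
  have hm : (0 : ℝ) < m + 1 := by positivity
  have h1 (i : Fin m) : ∃ y ∈ P i, y ∉ L := by
    obtain ⟨α, k, h⟩ := hP i
    have hx := hc.mem_plane i
    rw [h] at hx ⊢
    exact exists_mem_plane_notMem hV hL α k hx
  choose y hyP hyL using h1
  -- The joints $0,y_1,\dots,y_m,0$ of the new family; the default value 0 supplies both ends.
  let q : ℕ → V := fun j => if h : 0 < j ∧ j ≤ m then y ⟨j - 1, by omega⟩ else 0
  have hq (i : Fin m) : q (i + 1) = y i := by
    simp only [q]
    rw [dif_pos ⟨by omega, i.2⟩]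
    rfl
  have h2 (i : Fin (m + 1)) := exists_polygon_avoiding hV hL (q i) (q (i + 1))
    (a := (i : ℝ) / (m + 1)) (b := (i + 1) / (m + 1)) (by gcongr; linarith)
  choose c' hpol hstart hend havoid using h2
  have hjs (i : Fin m) : c' i.succ ((i + 1) / (m + 1)) = y i := by
    rw [← hq, ← Fin.val_succ, ← hstart i.succ]
    simp
  have hje (i : Fin m) : c' i.castSucc ((i + 1) / (m + 1)) = y i := by
    have := hend i.castSucc
    rw [Fin.val_castSucc] at this
    rw [this, hq]
  refine ⟨c', ⟨hpol, ?_, ?_, fun i => (hje i).trans (hjs i).symm, fun i => ?_⟩, ?_⟩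
  · have := hstart 0
    simpa [q] using this
  · have := hend (Fin.last m)
    simpa [q, div_self hm.ne'] using this
  · rw [hjs]; exact hyP i
  · intro i t ht ht01
    rcases ht.1.eq_or_lt with h | h
    · obtain rfl | ⟨j, rfl⟩ := i.eq_zero_or_eq_succ
      · rw [Fin.val_zero, Nat.cast_zero, zero_div] at h
        exact absurd h ht01.1.ne
      · have : t = (j + 1) / (m + 1) := by rw [← h]; simp
        rw [this, hjs]
        exact hyL j
    rcases ht.2.eq_or_lt with h' | h'
    · induction i using Fin.lastCases with
      | last =>
        rw [Fin.val_last, div_self hm.ne'] at h'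
        exact absurd h' ht01.2.ne
      | cast j =>
        rw [Fin.val_castSucc] at h'
        rw [h', hje]
        exact hyL j
    · exact havoid i t ⟨h, h'⟩

end Avoiding

end Polygons

/-! ## Broken paths of the form `κ i • Exp (C i t)` -/

section BrokenPaths

open Filter Topology

variable {n d m : ℕ} {G M F V : Type*}
  [TopologicalSpace G] [ChartedSpace (EuclideanSpace ℝ (Fin n)) G] [Group G]
  [TopologicalSpace M] [ChartedSpace (EuclideanSpace ℝ (Fin d)) M]
  [NormedAddCommGroup F] [NormedSpace ℝ F] [NormedAddCommGroup V] [NormedSpace ℝ V]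

/-- The derivatives of `ψ` along the left invariant vector fields. -/
def leftDeriv (n : ℕ) {G F : Type*} [TopologicalSpace G]
    [ChartedSpace (EuclideanSpace ℝ (Fin n)) G] [Group G] [NormedAddCommGroup F] [NormedSpace ℝ F]
    (ψ : G → F) (g : G) : EuclideanSpace ℝ (Fin n) →L[ℝ] F :=
  (modelDeriv (𝓡 n) 𝓘(ℝ, F) ψ g).comp (modelDeriv (𝓡 n) (𝓡 n) (fun b : G => g * b) 1)

/-- Applied to a fixed `X`, this is the fibre component of the tangent map of `ψ` along a left
invariant field; in finite dimension, continuity of operators may be tested pointwise. -/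
theorem continuousOn_leftDeriv [LieGroup (𝓡 n) ∞ G] {ψ : G → F} {U : Set G} (hU : IsOpen U)
    (hψ : ContMDiffOn (𝓡 n) 𝓘(ℝ, F) ∞ ψ U) : ContinuousOn (leftDeriv n ψ) U := by
  have : IsManifold (𝓡 n) 1 G := isManifold_one_lieGroup
  rw [continuousOn_clm_apply]
  intro X
  have h1 := hψ.continuousOn_tangentMapWithin (by simp) hU.uniqueMDiffOn
  have h2 := (contMDiff_one_mulInvariantVectorField (n := n) (G := G) X).continuous
  have h3 := (contMDiff_snd_tangentBundle_modelSpace (n := 0) F 𝓘(ℝ, F)).continuous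
  have h4 := h3.comp_continuousOn (h1.comp h2.continuousOn (s := U) fun g hg => hg)
  refine h4.congr fun g hg => ?_
  have h5 : mfderivWithin (𝓡 n) 𝓘(ℝ, F) ψ U g = mfderiv (𝓡 n) 𝓘(ℝ, F) ψ g :=
    mfderivWithin_of_isOpen hU hg
  exact (congrArg (fun L : EuclideanSpace ℝ (Fin n) →L[ℝ] F => L (leftField X g)) h5).symm

/-- The path `γ` is given by `κ i • Exp (C i t)` on the part number `i` of `[0, 1]`. -/
def IsBrokenPath [SMul G M] (ι : V →ₗ[ℝ] EuclideanSpace ℝ (Fin n)) (o : M) (κ : Fin (m + 1) → G)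
    (C : Fin (m + 1) → ℝ → V) (γ : ℝ → M) : Prop :=
  ∀ i, ∀ t ∈ partInterval i, γ t = (κ i * modelExp G (ι (C i t))) • o

theorem partInterval_subset (i : Fin (m + 1)) : partInterval i ⊆ Set.Icc (0 : ℝ) 1 := by
  have hm : (0 : ℝ) < m + 1 := by positivity
  refine Set.Icc_subset_Icc (by positivity) ?_
  rw [div_le_one hm]
  have : (i : ℝ) ≤ m := by exact_mod_cast Nat.lt_succ_iff.1 i.2
  linarith

theorem isClosed_partInterval (i : Fin (m + 1)) : IsClosed (partInterval i) := isClosed_Icc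

/-- Paths on the parts of `[0, 1]` which agree at the joints define a path on `[0, 1]`. -/
theorem exists_glued {X : Type*} {f : Fin (m + 1) → ℝ → X}
    (hf : ∀ i : Fin m, f i.castSucc ((i + 1) / (m + 1)) = f i.succ ((i + 1) / (m + 1))) :
    ∃ γ : ℝ → X, ∀ i, ∀ t ∈ partInterval i, γ t = f i t := by
  have hm : (0 : ℝ) < m + 1 := by positivity
  have key (i j : Fin (m + 1)) (hij : i < j) (t : ℝ) (hi : t ∈ partInterval i)
      (hj : t ∈ partInterval j) : f i t = f j t := by
    have h1 : (j : ℝ) / (m + 1) ≤ (i + 1) / (m + 1) := hj.1.trans hi.2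
    rw [div_le_div_iff_of_pos_right hm] at h1
    -- Distinct parts meet only if they are consecutive, and then only at their joint.
    have h2 : (j : ℕ) = i + 1 := le_antisymm (by exact_mod_cast h1) hij
    have hi' : (i : ℕ) < m := by omega
    obtain ⟨k, rfl⟩ : ∃ k : Fin m, i = k.castSucc := ⟨⟨i, hi'⟩, rfl⟩
    obtain rfl : j = k.succ := Fin.ext (by simpa using h2)
    have h3 : t = (k + 1) / (m + 1) := by
      refine le_antisymm (by simpa using hi.2) ?_
      simpa using hj.1
    rw [h3, hf]
  have key2 (i j : Fin (m + 1)) (t : ℝ) (hi : t ∈ partInterval i) (hj : t ∈ partInterval j) :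
      f i t = f j t := by
    rcases lt_trichotomy i j with h | h | h
    · exact key i j h t hi hj
    · rw [h]
    · exact (key j i h t hj hi).symm
  classical
  refine ⟨fun t => if h : ∃ i : Fin (m + 1), t ∈ partInterval i then f h.choose t else f 0 t,
    fun i t ht => ?_⟩
  have h : ∃ i : Fin (m + 1), t ∈ partInterval i := ⟨i, ht⟩
  simp only [dif_pos h]
  exact key2 _ _ t h.choose_spec ht

variable [LieGroup (𝓡 n) ∞ G] [T2Space G] [IsManifold (𝓡 d) ∞ M] [MulAction G M]
  [ContMDiffSMul (𝓡 n) (𝓡 d) ∞ G M] {ι : V →ₗ[ℝ] EuclideanSpace ℝ (Fin n)}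

theorem contMDiff_smul_basepoint (n d : ℕ) {G M : Type*}
    [TopologicalSpace G] [ChartedSpace (EuclideanSpace ℝ (Fin n)) G] [Group G]
    [TopologicalSpace M] [ChartedSpace (EuclideanSpace ℝ (Fin d)) M] [MulAction G M]
    [ContMDiffSMul (𝓡 n) (𝓡 d) ∞ G M] (o : M) :
    ContMDiff (𝓡 n) (𝓡 d) ∞ fun h : G => h • o :=
  contMDiff_id.smul contMDiff_const

theorem exists_path_of_isBrokenPath [FiniteDimensional ℝ V] [ContinuousSMul G M] (hι : IsFlat G ι) {o : M}
    {κ : Fin (m + 1) → G} {C : Fin (m + 1) → ℝ → V}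
    (hC : ∀ i, ContinuousOn (C i) (partInterval i))
    (hjoint : ∀ i : Fin m, (κ i.castSucc * modelExp G (ι (C i.castSucc ((i + 1) / (m + 1))))) • o =
      (κ i.succ * modelExp G (ι (C i.succ ((i + 1) / (m + 1))))) • o) :
    ∃ γ : C(unitInterval, M), IsBrokenPath ι o κ C (pathExtend γ) := by
  have : ContinuousMul G := continuousMul_of_contMDiffMul (𝓡 n) ∞
  obtain ⟨γ, hγ⟩ := exists_glued
    (f := fun i t => (κ i * modelExp G (ι (C i t))) • o) hjoint
  have hcont : Continuous fun t : unitInterval => γ t := by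
    refine LocallyFinite.continuous
      (f := fun i : Fin (m + 1) => {t : unitInterval | (t : ℝ) ∈ partInterval i})
      (locallyFinite_of_finite _) ?_ (fun i => ?_) (fun i => ?_)
    · refine Set.iUnion_eq_univ_iff.2 fun t => exists_mem_partInterval m t.2
    · exact (isClosed_partInterval i).preimage continuous_subtype_val
    · have h1 : ContinuousOn (fun t => (κ i * modelExp G (ι (C i t))) • o) (partInterval i) :=
        (continuousOn_const.mul (hι.continuous.comp_continuousOn (hC i))).smul continuousOn_const
      have h2 : ContinuousOn γ (partInterval i) := h1.congr (hγ i)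
      exact h2.comp continuous_subtype_val.continuousOn fun t ht => ht
  refine ⟨⟨_, hcont⟩, fun i t ht => ?_⟩
  rw [← hγ i t ht, pathExtend, ContinuousMap.coe_mk,
    Set.projIcc_of_mem zero_le_one (partInterval_subset i ht)]

variable {o : M} {κ : Fin (m + 1) → G} {C : Fin (m + 1) → ℝ → V} {γ : ℝ → M}

theorem IsBrokenPath.eventuallyEq (hγ : IsBrokenPath ι o κ C γ) {A : Set ℝ} {t : ℝ} {v : V}
    {i : Fin (m + 1)} (hi : partInterval i ∈ 𝓝[A] t) (hv : IsAffineAt (C i) v A t) :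
    γ =ᶠ[𝓝[A] t] fun s => (κ i * modelExp G (ι (C i t + (s - t) • v))) • o := by
  filter_upwards [hi, hv] with s hs hs'
  rw [hγ i s hs, hs']

theorem IsBrokenPath.hasVelocityWithinAt (hι : IsFlat G ι) (hγ : IsBrokenPath ι o κ C γ)
    {A : Set ℝ} {t : ℝ} (ht : t ∈ A) {v : V} {i : Fin (m + 1)} (hi : partInterval i ∈ 𝓝[A] t)
    (hv : IsAffineAt (C i) v A t) :
    HasVelocityWithinAt (𝓡 d) γ (modelDeriv (𝓡 n) (𝓡 d) (fun h : G => h • o)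
      (κ i * modelExp G (ι (C i t))) (leftField (ι v) (κ i * modelExp G (ι (C i t))))) A t := by
  have h1 := hι.hasVelocityWithinAt (κ i) (C i t) v t t A
  have h2 := h1.comp_curve (f := fun h : G => h • o) (I' := 𝓡 d)
    ((contMDiff_smul_basepoint n d o).mdifferentiableAt (by simp))
  have h3 := h2.congr (hγ.eventuallyEq hi hv) (by
    rw [hγ i t (mem_of_mem_nhdsWithin ht hi)]
    simp)
  simpa using h3

theorem IsBrokenPath.hasDerivWithinAt (hι : IsFlat G ι) (hγ : IsBrokenPath ι o κ C γ)
    {A : Set ℝ} {t : ℝ} (ht : t ∈ A) {v : V} {i : Fin (m + 1)} (hi : partInterval i ∈ 𝓝[A] t)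
    (hv : IsAffineAt (C i) v A t) {φ : M → F}
    (hφ : MDifferentiableAt (𝓡 d) 𝓘(ℝ, F) φ ((κ i * modelExp G (ι (C i t))) • o)) :
    HasDerivWithinAt (fun s => φ (γ s)) (leftDeriv n (fun h : G => φ (h • o))
      (κ i * modelExp G (ι (C i t))) (ι v)) A t := by
  have h1 := hγ.hasVelocityWithinAt (d := d) hι ht hi hv
  have hγt : γ t = (κ i * modelExp G (ι (C i t))) • o := hγ i t (mem_of_mem_nhdsWithin ht hi)
  have h2 := (h1.comp_curve (f := φ) (I' := 𝓘(ℝ, F)) (by rwa [hγt])).hasDerivWithinAt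
  rw [hγt] at h2
  refine h2.congr_deriv ?_
  exact (modelDeriv_comp (f := fun h : G => h • o) (x := κ i * modelExp G (ι (C i t))) hφ
    ((contMDiff_smul_basepoint n d o).mdifferentiableAt (by simp)) _).symm

/-- In a chart the path is Lipschitz: its right derivatives are values of `leftDeriv` on a compact
subset of `G`, applied to finitely many slopes, and are therefore bounded. -/
theorem IsBrokenPath.isAbsContPath [FiniteDimensional ℝ V] (hι : IsFlat G ι)
    {γ : C(unitInterval, M)} (hγ : IsBrokenPath ι o κ C (pathExtend γ))
    (hC : ∀ i, ContinuousOn (C i) (partInterval i)) {S : Set V} {B : Set ℝ} (hS : S.Finite)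
    (hfam : IsPiecewiseAffineFamily C S B) : IsAbsContPath d γ := by
  have : ContinuousMul G := continuousMul_of_contMDiffMul (𝓡 n) ∞
  have : ContinuousSMul G M := ContMDiffSMul.continuousSMul (I := 𝓡 n) (I' := 𝓡 d) ∞
  intro e he a b ha hab hb hmem
  set U : Set G := {g : G | g • o ∈ e.source} with hU
  have hUo : IsOpen U := e.open_source.preimage (continuous_id.smul continuous_const)
  have hes := contMDiffOn_of_mem_maximalAtlas he
  have hψ : ContMDiffOn (𝓡 n) 𝓘(ℝ, EuclideanSpace ℝ (Fin d)) ∞ (fun g : G => e (g • o)) U :=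
    hes.comp (contMDiff_smul_basepoint n d o).contMDiffOn fun g hg => hg
  set K : Set G := ⋃ i, (fun t => κ i * modelExp G (ι (C i t))) '' (partInterval i ∩ Set.Icc a b)
    with hK
  have hKc : IsCompact K := by
    refine isCompact_iUnion fun i => ?_
    refine IsCompact.image_of_continuousOn (isCompact_Icc.inter isCompact_Icc) ?_
    exact continuousOn_const.mul (hι.continuous.comp_continuousOn
      ((hC i).mono Set.inter_subset_left))
  have hKU : K ⊆ U := by
    refine Set.iUnion_subset fun i => ?_
    rintro _ ⟨t, ht, rfl⟩
    have := hmem t ht.2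
    rwa [hγ i t ht.1] at this
  obtain ⟨D, hD⟩ := hKc.exists_bound_of_continuousOn ((continuousOn_leftDeriv hUo hψ).mono hKU)
  obtain ⟨D', hD'⟩ := hS.isCompact.exists_bound_of_continuousOn
    (f := fun v => ι v) (LinearMap.continuous_of_finiteDimensional ι).continuousOn
  have hcont : ContinuousOn (fun t => e (pathExtend γ t)) (Set.Icc a b) :=
    e.continuousOn.comp (γ.continuous.comp continuous_projIcc).continuousOn hmem
  have hder (t : ℝ) : ∃ w, t ∈ Set.Ico a b →
      HasDerivWithinAt (fun t => e (pathExtend γ t)) w (Set.Ici t) t ∧ ‖w‖ ≤ D * D' := by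
    by_cases ht : t ∈ Set.Ico a b
    · obtain ⟨i, hi, v, hv, hiv⟩ := hfam.right t ⟨ha.trans ht.1, ht.2.trans_le hb⟩
      have hti := mem_of_mem_nhdsWithin (Set.self_mem_Ici (a := t)) hi
      have hg : κ i * modelExp G (ι (C i t)) ∈ K :=
        Set.mem_iUnion_of_mem i ⟨t, ⟨hti, ht.1, ht.2.le⟩, rfl⟩
      refine ⟨_, fun _ => ⟨hγ.hasDerivWithinAt (d := d) hι Set.self_mem_Ici hi hiv (φ := e) ?_, ?_⟩⟩
      · exact (hes.contMDiffAt (e.open_source.mem_nhds (hKU hg))).mdifferentiableAt (by simp)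
      · refine (ContinuousLinearMap.le_opNorm _ _).trans ?_
        exact mul_le_mul (hD _ hg) (hD' v hv) (norm_nonneg _) ((norm_nonneg _).trans (hD _ hg))
    · exact ⟨0, fun h => absurd h ht⟩
  choose f' hf' using hder
  have hlip : LipschitzOnWith (D * D').toNNReal (fun t => e (pathExtend γ t)) (Set.uIcc a b) := by
    rw [Set.uIcc_of_le hab]
    refine LipschitzOnWith.of_dist_le_mul fun x hx y hy => ?_
    have key (x y : ℝ) (hx : x ∈ Set.Icc a b) (hy : y ∈ Set.Icc a b) (hxy : x ≤ y) :
        ‖e (pathExtend γ y) - e (pathExtend γ x)‖ ≤ (D * D').toNNReal * (y - x) := by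
      refine norm_image_sub_le_of_norm_deriv_right_le_segment (f' := f')
        (hcont.mono (Set.Icc_subset_Icc hx.1 hy.2)) (fun t ht => ?_) (fun t ht => ?_) y
        ⟨hxy, le_rfl⟩
      · exact (hf' t ⟨hx.1.trans ht.1, ht.2.trans_le hy.2⟩).1
      · exact (hf' t ⟨hx.1.trans ht.1, ht.2.trans_le hy.2⟩).2.trans (Real.le_coe_toNNReal _)
    rcases le_total x y with h | h
    · rw [dist_comm, dist_eq_norm, dist_comm, Real.dist_eq, abs_of_nonneg (sub_nonneg.2 h)]
      exact key x y hx hy h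
    · rw [dist_eq_norm, Real.dist_eq, abs_of_nonneg (sub_nonneg.2 h)]
      exact key y x hy hx h
  exact hlip.absolutelyContinuousOnInterval

/-- The square of the length of a tangent vector. -/
def metricSq {d : ℕ} {M : Type*} [TopologicalSpace M] [ChartedSpace (EuclideanSpace ℝ (Fin d)) M]
    [IsManifold (𝓡 d) ∞ M] (g : SmoothMetric d M) (x : M) (v : EuclideanSpace ℝ (Fin d)) : ℝ :=
  g.inner x v v

/-- By invariance of the metric, the speed of a broken path depends on the slope of its polygon
only. Hence it takes finitely many values almost everywhere, and the energy is finite. -/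
theorem SymmetricSpace.metricSq_leftField (S : SymmetricSpace n d G M) (g : G)
    (X : EuclideanSpace ℝ (Fin n)) :
    metricSq S.g (g • S.o) (modelDeriv (𝓡 n) (𝓡 d) (fun h : G => h • S.o) g (leftField X g)) =
      metricSq S.g S.o (modelDeriv (𝓡 n) (𝓡 d) (fun h : G => h • S.o) 1 X) := by
  have hd (x : G) : MDifferentiableAt (𝓡 n) (𝓡 d) (fun h : G => h • S.o) x :=
    (contMDiff_smul_basepoint n d S.o).mdifferentiableAt (by simp)
  have h1 := modelDeriv_comp (I := 𝓡 n) (I' := 𝓡 n) (I'' := 𝓡 d) (f := fun h : G => g * h)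
    (g := fun h : G => h • S.o) (x := 1) (hd _) (LieGroup.mdifferentiableAt_mul_left g _) X
  have h2 := modelDeriv_comp (I := 𝓡 n) (I' := 𝓡 d) (I'' := 𝓡 d) (f := fun h : G => h • S.o)
    (g := fun y : M => g • y) (x := (1 : G))
    ((ContMDiffSMul.contMDiff_const_smul (I := 𝓡 n) (n := ∞) g).mdifferentiableAt (by simp)) (hd _) X
  have h3 : (fun h : G => (g * h) • S.o) = fun h => g • h • S.o := funext fun h => mul_smul g h S.o
  rw [h3, h2, mul_one, one_smul] at h1
  rw [leftField, ← h1]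
  exact S.g_invariant g S.o _ _

theorem velocity_eq {γ : C(unitInterval, M)} {t : ℝ} {v : EuclideanSpace ℝ (Fin d)}
    (h : HasVelocityWithinAt (𝓡 d) (pathExtend γ) v Set.univ t) : velocity d γ t = v := by
  have h1 := (hasMFDerivAt_iff_hasVelocityWithinAt.2 h).mfderiv
  have h2 := congrArg (fun L : ℝ →L[ℝ] EuclideanSpace ℝ (Fin d) => L 1) h1
  exact Eq.trans h2 (one_smul ℝ v)

theorem IsBrokenPath.energy_lt_top (S : SymmetricSpace n d G M) (hι : IsFlat G ι)
    {γ : C(unitInterval, M)} (hγ : IsBrokenPath ι S.o κ C (pathExtend γ))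
    {T : Set V} {B : Set ℝ} (hT : T.Finite) (hB : B.Finite)
    (hfam : IsPiecewiseAffineFamily C T B) : energy S.g γ < ⊤ := by
  set Q : V → ℝ := fun v =>
    metricSq S.g S.o (modelDeriv (𝓡 n) (𝓡 d) (fun h : G => h • S.o) 1 (ι v)) with hQ
  obtain ⟨D, hD⟩ := (hT.image Q).bddAbove
  have hae : ∀ᵐ t ∂(MeasureTheory.volume.restrict (Set.Icc (0 : ℝ) 1)),
      ENNReal.ofReal (S.g.inner (pathExtend γ t) (velocity d γ t) (velocity d γ t)) ≤
        ENNReal.ofReal D := by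
    have h0 : ∀ᵐ t : ℝ, t ∉ B ∪ {0, 1} :=
      (hB.union (Set.toFinite {0, 1})).countable.ae_notMem _
    filter_upwards [MeasureTheory.ae_restrict_of_ae h0,
      MeasureTheory.ae_restrict_mem measurableSet_Icc] with t ht ht01
    simp only [Set.mem_union, Set.mem_insert_iff, Set.mem_singleton_iff, not_or] at ht
    obtain ⟨i, hi, v, hv, hiv⟩ := hfam.generic t
      ⟨lt_of_le_of_ne ht01.1 (Ne.symm ht.2.1), lt_of_le_of_ne ht01.2 ht.2.2⟩ ht.1
    have hvel := velocity_eq (hγ.hasVelocityWithinAt (d := d) hι (Set.mem_univ t) hi hiv)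
    have h1 : metricSq S.g (pathExtend γ t) (velocity d γ t) = Q v := by
      have h2 := hγ i t (mem_of_mem_nhdsWithin (Set.mem_univ t) hi)
      exact (congrArg₂ (metricSq S.g) h2 hvel).trans (S.metricSq_leftField _ _)
    exact ENNReal.ofReal_le_ofReal (h1.le.trans (hD ⟨v, hv, rfl⟩))
  refine ENNReal.mul_lt_top (by simp) ((MeasureTheory.lintegral_mono_ae hae).trans_lt ?_)
  rw [MeasureTheory.lintegral_const]
  exact ENNReal.mul_lt_top ENNReal.ofReal_lt_top (by simp)

end BrokenPaths

/-! ## Paths without energy -/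

section ZeroEnergy

open Filter Topology MeasureTheory Bundle

variable {d : ℕ} {M : Type*} [TopologicalSpace M] [ChartedSpace (EuclideanSpace ℝ (Fin d)) M]
  [IsManifold (𝓡 d) ∞ M]

/-- The Euclidean metric of a chart is locally bounded by a Riemannian metric. -/
theorem eventually_norm_modelDeriv_extChartAt_le (g : SmoothMetric d M) (x₀ : M) :
    ∃ c > 0, ∀ᶠ y in 𝓝 x₀, ∀ v : EuclideanSpace ℝ (Fin d),
      c * ‖modelDeriv (𝓡 d) 𝓘(ℝ, EuclideanSpace ℝ (Fin d)) (extChartAt (𝓡 d) x₀) y v‖ ^ 2 ≤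
        metricSq g y v := by
  -- The fibre norms are now those of `g`, and the chart derivative is locally bounded with respect
  -- to them.
  let : RiemannianBundle (fun x : M => TangentSpace (𝓡 d) x) := ⟨g.toRiemannianMetric⟩
  have : IsManifold (𝓡 d) 1 M := .of_le (n := ∞) (by simp)
  have : IsContinuousRiemannianBundle (EuclideanSpace ℝ (Fin d))
      (fun x : M => TangentSpace (𝓡 d) x) :=
    ⟨⟨g.inner, g.contMDiff.continuous, fun b v w => rfl⟩⟩
  obtain ⟨C, hC, h⟩ := eventually_norm_mfderiv_extChartAt_lt (𝓡 d) x₀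
  refine ⟨(C ^ 2)⁻¹, by positivity, h.mono fun y hy v => ?_⟩
  have h1 : ‖modelDeriv (𝓡 d) 𝓘(ℝ, EuclideanSpace ℝ (Fin d)) (extChartAt (𝓡 d) x₀) y v‖ ≤
      C * ‖(show TangentSpace (𝓡 d) y from v)‖ :=
    (ContinuousLinearMap.le_opNorm (show TangentSpace (𝓡 d) y →L[ℝ] EuclideanSpace ℝ (Fin d) from
      mfderiv (𝓡 d) 𝓘(ℝ, EuclideanSpace ℝ (Fin d)) (extChartAt (𝓡 d) x₀) y) _).trans
      (mul_le_mul_of_nonneg_right hy.le (norm_nonneg _))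
  have h2 : ‖(show TangentSpace (𝓡 d) y from v)‖ ^ 2 = metricSq g y v :=
    (real_inner_self_eq_norm_sq _).symm
  rw [inv_mul_le_iff₀ (by positivity), ← h2, ← mul_pow]
  exact pow_le_pow_left₀ (norm_nonneg _) h1 2

/-- Absolute continuity yields derivatives in a chart almost everywhere; this transfers them to `M`,
where the energy is defined. -/
theorem hasVelocityWithinAt_of_hasDerivAt {γ : ℝ → M} (hγ : Continuous γ) {x₀ : M} {t : ℝ}
    {w : EuclideanSpace ℝ (Fin d)} (ht : γ t ∈ (extChartAt (𝓡 d) x₀).source)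
    (h : HasDerivAt (fun s => extChartAt (𝓡 d) x₀ (γ s)) w t) :
    ∃ u, HasVelocityWithinAt (𝓡 d) γ u Set.univ t ∧
      modelDeriv (𝓡 d) 𝓘(ℝ, EuclideanSpace ℝ (Fin d)) (extChartAt (𝓡 d) x₀) (γ t) u = w := by
  have h1 : HasVelocityWithinAt 𝓘(ℝ, EuclideanSpace ℝ (Fin d))
      (fun s => extChartAt (𝓡 d) x₀ (γ s)) w Set.univ t :=
    hasMFDerivAt_iff_hasVelocityWithinAt.1 h.hasFDerivAt.hasMFDerivAt
  have h2 := h1.comp_curve (f := (extChartAt (𝓡 d) x₀).symm) (I' := 𝓡 d)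
    (((contMDiffOn_extChartAt_symm (n := ∞) x₀).contMDiffAt
      ((isOpen_extChartAt_target x₀).mem_nhds
        ((extChartAt (𝓡 d) x₀).map_source ht))).mdifferentiableAt (by simp))
  have h3 := h2.congr (γ' := γ) (by
      rw [nhdsWithin_univ]
      filter_upwards [hγ.continuousAt.eventually ((isOpen_extChartAt_source x₀).mem_nhds ht)]
        with s hs
      exact ((extChartAt (𝓡 d) x₀).left_inv hs).symm)
    ((extChartAt (𝓡 d) x₀).left_inv ht).symm
  refine ⟨_, h3, ?_⟩
  have h4 := h3.comp_curve (f := extChartAt (𝓡 d) x₀) (I' := 𝓘(ℝ, EuclideanSpace ℝ (Fin d)))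
    ((contMDiffAt_extChartAt' (n := ∞) (by simpa using ht)).mdifferentiableAt (by simp))
  have h5 := h4.hasDerivWithinAt
  rw [hasDerivWithinAt_univ] at h5
  exact h5.unique h

theorem continuous_pathExtend (γ : C(unitInterval, M)) : Continuous (pathExtend γ) :=
  γ.continuous.comp continuous_projIcc

/-- In a chart around `pathExtend γ t₀` the energy density dominates a multiple of the squared
Euclidean speed. So the derivative vanishes almost everywhere, and an absolutely continuous function
with this property is constant. -/
theorem eventually_eq_of_energy_eq_zero (g : SmoothMetric d M) {γ : C(unitInterval, M)}
    (hγ : IsAbsContPath d γ) (h0 : energy g γ = 0) {t₀ : ℝ} (ht₀ : t₀ ∈ Set.Icc (0 : ℝ) 1) :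
    ∀ᶠ t in 𝓝[Set.Icc 0 1] t₀, pathExtend γ t = pathExtend γ t₀ := by
  set x₀ := pathExtend γ t₀ with hx₀
  obtain ⟨c, hc, hbound⟩ := eventually_norm_modelDeriv_extChartAt_le g x₀
  have h1 : ∀ᶠ t in 𝓝 t₀, pathExtend γ t ∈ (extChartAt (𝓡 d) x₀).source ∧
      ∀ v : EuclideanSpace ℝ (Fin d),
      c * ‖modelDeriv (𝓡 d) 𝓘(ℝ, EuclideanSpace ℝ (Fin d)) (extChartAt (𝓡 d) x₀)
        (pathExtend γ t) v‖ ^ 2 ≤ metricSq g (pathExtend γ t) v :=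
    (continuous_pathExtend γ).continuousAt.eventually
      ((show ∀ᶠ y in 𝓝 x₀, y ∈ (extChartAt (𝓡 d) x₀).source from
        extChartAt_source_mem_nhds (I := 𝓡 d) x₀).and hbound)
  obtain ⟨δ, hδ, hball⟩ := Metric.eventually_nhds_iff.1 h1
  set a := max 0 (t₀ - δ / 2) with ha
  set b := min 1 (t₀ + δ / 2) with hb
  have ha0 : 0 ≤ a := le_max_left _ _
  have hb1 : b ≤ 1 := min_le_left _ _
  have hat : a ≤ t₀ := max_le ht₀.1 (by linarith)
  have htb : t₀ ≤ b := le_min ht₀.2 (by linarith)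
  have hloc (t : ℝ) (ht : t ∈ Set.Icc a b) := hball (y := t) (by
    have h2 : t₀ - δ / 2 ≤ t := (le_max_right _ _).trans ht.1
    have h3 : t ≤ t₀ + δ / 2 := ht.2.trans (min_le_right _ _)
    rw [Real.dist_eq, abs_lt]
    constructor <;> linarith)
  set f : ℝ → EuclideanSpace ℝ (Fin d) := fun t => extChartAt (𝓡 d) x₀ (pathExtend γ t) with hf
  have hac : AbsolutelyContinuousOnInterval f a b :=
    hγ (chartAt (EuclideanSpace ℝ (Fin d)) x₀) (IsManifold.chart_mem_maximalAtlas x₀) a b ha0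
      (hat.trans htb) hb1 fun t ht => by simpa using (hloc t ht).1
  have hdiff : ∀ᵐ t, t ∈ Set.uIcc a b → DifferentiableAt ℝ f t :=
    hac.boundedVariationOn.ae_differentiableAt_of_mem_uIcc
  rw [Set.uIcc_of_le (hat.trans htb)] at hdiff
  have hle : ∀ᵐ t ∂volume.restrict (Set.Icc a b), ENNReal.ofReal (c * ‖deriv f t‖ ^ 2) ≤
      ENNReal.ofReal (g.inner (pathExtend γ t) (velocity d γ t) (velocity d γ t)) := by
    filter_upwards [ae_restrict_of_ae hdiff, ae_restrict_mem measurableSet_Icc] with t ht htab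
    obtain ⟨u, hu, hw⟩ := hasVelocityWithinAt_of_hasDerivAt (continuous_pathExtend γ)
      (hloc t htab).1 (ht htab).hasDerivAt
    rw [← hw]
    refine ENNReal.ofReal_le_ofReal (((hloc t htab).2 u).trans_eq ?_)
    exact congrArg (metricSq g (pathExtend γ t)) (velocity_eq hu).symm
  have hint : ∫⁻ t in Set.Icc a b, ENNReal.ofReal (c * ‖deriv f t‖ ^ 2) = 0 := by
    have h2 : ∫⁻ t in Set.Icc (0 : ℝ) 1, ENNReal.ofReal
        (g.inner (pathExtend γ t) (velocity d γ t) (velocity d γ t)) = 0 := by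
      simpa [energy] using h0
    refine le_antisymm ((lintegral_mono_ae hle).trans ?_) zero_le
    exact (lintegral_mono_set (Set.Icc_subset_Icc ha0 hb1)).trans h2.le
  rw [lintegral_eq_zero_iff
    (((measurable_deriv f).norm.pow_const 2).const_mul c).ennreal_ofReal] at hint
  have hder : ∀ᵐ t, t ∈ Set.uIcc a b → HasDerivAt f 0 t := by
    rw [Set.uIcc_of_le (hat.trans htb)]
    filter_upwards [hdiff, (ae_restrict_iff' measurableSet_Icc).1 hint] with t ht1 ht2 ht
    have h3 := ht2 ht
    rw [Pi.zero_apply, ENNReal.ofReal_eq_zero] at h3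
    have h4 : ‖deriv f t‖ ^ 2 ≤ 0 := by nlinarith [sq_nonneg ‖deriv f t‖]
    have h5 : deriv f t = 0 := by
      rw [← norm_eq_zero]
      exact pow_eq_zero_iff two_ne_zero |>.1 (le_antisymm h4 (sq_nonneg _))
    rw [← h5]
    exact (ht1 ht).hasDerivAt
  obtain ⟨C, hC⟩ := hac.const_of_ae_hasDerivAt_zero hder
  rw [Set.uIcc_of_le (hat.trans htb)] at hC
  have hnhds : Set.Ioo (t₀ - δ / 2) (t₀ + δ / 2) ∈ 𝓝 t₀ :=
    Ioo_mem_nhds (by linarith) (by linarith)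
  filter_upwards [mem_nhdsWithin_of_mem_nhds hnhds, self_mem_nhdsWithin] with t ht ht01
  have htab : t ∈ Set.Icc a b := ⟨max_le ht01.1 ht.1.le, le_min ht01.2 ht.2.le⟩
  exact (extChartAt (𝓡 d) x₀).injOn (hloc t htab).1 (hloc t₀ ⟨hat, htb⟩).1
    ((hC t htab).trans (hC t₀ ⟨hat, htb⟩).symm)

theorem eq_of_energy_eq_zero (g : SmoothMetric d M) {γ : C(unitInterval, M)}
    (hγ : IsAbsContPath d γ) (h0 : energy g γ = 0) (s t : unitInterval) : γ s = γ t := by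
  have h : IsLocallyConstant γ := by
    rw [IsLocallyConstant.iff_eventually_eq]
    intro t₀
    have h1 := eventually_eq_of_energy_eq_zero g hγ h0 t₀.2
    rw [← map_nhds_subtype_val, eventually_map] at h1
    simpa [pathExtend] using h1
  exact h.apply_eq_of_preconnectedSpace s t

/-- If all loops which occur in a cycle have zero energy, then its relative class vanishes. -/
theorem exists_energy_pos (R : Type*) [CommRing R] {g : SmoothMetric d M} {o : M} {n : ℕ}
    (A : relCycles R (∅ : Set (BasedLoopSpace g o)) n)
    (hA : toRelative R (constantLoop g o) n (homologyClass R ∅ n A) ≠ 0) :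
    ∃ γ ∈ chainImage R A.1, 0 < energy g γ.1 := by
  by_contra! hcon
  refine hA (toRelative_homologyClass_eq_zero R A fun γ hγ t => ?_)
  have h := eq_of_energy_eq_zero g γ.2.1 (le_antisymm (hcon γ hγ) zero_le) t 0
  exact h.trans γ.2.2.2.1

theorem two_le_encard_preimage {g : SmoothMetric d M} {o : M} (γ : BasedLoopSpace g o) :
    2 ≤ (γ.1 ⁻¹' {o}).encard := by
  have h : ({0, 1} : Set unitInterval) ⊆ γ.1 ⁻¹' {o} := by
    rintro t (rfl | rfl)
    · exact γ.2.2.2.1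
    · exact γ.2.2.2.2
  rw [← Set.encard_pair (show (0 : unitInterval) ≠ 1 from zero_ne_one)]
  exact Set.encard_le_encard h

theorem EReal.two_sub_one : (2 : EReal) - 1 = 1 := by
  rw [← one_add_one_eq_two]
  exact EReal.add_sub_cancel_right (b := 1)

/-- The non-zero relative class forces every representing cycle to contain a loop of positive
energy. The supremum is thus over a non-empty set, and the two endpoints make it at least 2. -/
theorem one_le_intersectionMultiplicity (R : Type*) [CommRing R] {g : SmoothMetric d M} {o : M}
    {n : ℕ} (a : SingHomology R (BasedLoopSpace g o) n)
    (ha : toRelative R (constantLoop g o) n a ≠ 0) : 1 ≤ intersectionMultiplicity R a := by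
  have h : (2 : EReal) ≤
      ⨅ (A : relCycles R (∅ : Set (BasedLoopSpace g o)) n) (_ : homologyClass R ∅ n A = a),
        ⨆ (γ : BasedLoopSpace g o) (_ : γ ∈ chainImage R A.1) (_ : 0 < energy g γ.1),
          (((γ.1 ⁻¹' {o}).encard : ENNReal) : EReal) := by
    refine le_iInf₂ fun A hA => ?_
    subst hA
    obtain ⟨γ, hγ, hpos⟩ := exists_energy_pos R A ha
    refine le_iSup_of_le γ (le_iSup₂_of_le hγ hpos ?_)
    exact EReal.coe_ennreal_le_coe_ennreal_iff.2 (ENat.toENNReal_le.2 (two_le_encard_preimage γ))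
  have h2 := EReal.sub_le_sub h (le_refl (1 : EReal))
  rwa [EReal.two_sub_one] at h2

theorem intersectionMultiplicity_le_one (R : Type*) [CommRing R] {g : SmoothMetric d M} {o : M}
    {n : ℕ} (A : relCycles R (∅ : Set (BasedLoopSpace g o)) n)
    (hA : ∀ γ ∈ chainImage R A.1, γ.1 ⁻¹' {o} ⊆ {0, 1}) :
    intersectionMultiplicity R (homologyClass R ∅ n A) ≤ 1 := by
  have h : (⨅ (A' : relCycles R (∅ : Set (BasedLoopSpace g o)) n)
      (_ : homologyClass R ∅ n A' = homologyClass R ∅ n A),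
        ⨆ (γ : BasedLoopSpace g o) (_ : γ ∈ chainImage R A'.1) (_ : 0 < energy g γ.1),
          (((γ.1 ⁻¹' {o}).encard : ENNReal) : EReal)) ≤ 2 := by
    refine iInf₂_le_of_le A rfl (iSup_le fun γ => iSup₂_le fun hγ _ => ?_)
    have : (γ.1 ⁻¹' {o}).encard ≤ 2 :=
      (Set.encard_le_encard (hA γ hγ)).trans (Set.encard_pair zero_ne_one).le
    exact EReal.coe_ennreal_le_coe_ennreal_iff.2 (ENat.toENNReal_le.2 this)
  have h2 := EReal.sub_le_sub h (le_refl (1 : EReal))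
  rwa [EReal.two_sub_one] at h2

end ZeroEnergy

/-! ## Continuous families of loops -/

section LoopFamilies

open Filter Topology MeasureTheory

section Criterion

variable {d : ℕ} {M : Type*} [TopologicalSpace M] [ChartedSpace (EuclideanSpace ℝ (Fin d)) M]
  [IsManifold (𝓡 d) ∞ M] {g : SmoothMetric d M} {o : M}

theorem loopDist_triangle (f : M → ℝ) (γ η θ : BasedLoopSpace g o) :
    loopDist f γ θ ≤ loopDist f γ η + loopDist f η θ := by
  have h1 : (⨆ t : unitInterval, ENNReal.ofReal |f (γ.1 t) - f (θ.1 t)|) ≤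
      (⨆ t : unitInterval, ENNReal.ofReal |f (γ.1 t) - f (η.1 t)|) +
        ⨆ t : unitInterval, ENNReal.ofReal |f (η.1 t) - f (θ.1 t)| := by
    refine iSup_le fun t => ?_
    refine (ENNReal.ofReal_le_ofReal (abs_sub_le _ (f (η.1 t)) _)).trans ?_
    rw [ENNReal.ofReal_add (abs_nonneg _) (abs_nonneg _)]
    exact add_le_add (le_iSup (fun t => ENNReal.ofReal |f (γ.1 t) - f (η.1 t)|) t)
      (le_iSup (fun t => ENNReal.ofReal |f (η.1 t) - f (θ.1 t)|) t)
  have hm (γ : BasedLoopSpace g o) : Measurable (deriv fun s => f (pathExtend γ.1 s)) :=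
    measurable_deriv _
  have h2 := eLpNorm_add_le (μ := volume.restrict (Set.Icc (0 : ℝ) 1)) (p := 2)
    ((hm γ).sub (hm η)).aestronglyMeasurable ((hm η).sub (hm θ)).aestronglyMeasurable (by norm_num)
  rw [sub_add_sub_cancel] at h2
  refine (add_le_add h1 h2).trans_eq ?_
  rw [loopDist, loopDist, add_add_add_comm]
  rfl

/-- A criterion for the continuity of maps to the loop space. -/
theorem continuous_loopSpace_of_eventually {X : Type*} [TopologicalSpace X]
    {Φ : X → BasedLoopSpace g o}
    (h : ∀ f : M → ℝ, ContMDiff (𝓡 d) 𝓘(ℝ, ℝ) ∞ f → ∀ (x₀ : X) (ε : ENNReal), 0 < ε →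
      ∀ᶠ x in 𝓝 x₀, loopDist f (Φ x₀) (Φ x) < ε) : Continuous Φ := by
  refine continuous_generateFrom_iff.2 ?_
  rintro U ⟨f, hf, γ, ε, -, rfl⟩
  refine isOpen_iff_mem_nhds.2 fun x₀ hx₀ => ?_
  have hx₀' : loopDist f γ (Φ x₀) < ε := hx₀
  filter_upwards [h f hf x₀ (ε - loopDist f γ (Φ x₀)) (tsub_pos_of_lt hx₀')] with x hx
  refine (loopDist_triangle f γ (Φ x₀) (Φ x)).trans_lt ?_
  have h1 := ENNReal.add_lt_add_left hx₀'.ne_top hx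
  rwa [add_tsub_cancel_of_le hx₀'.le] at h1

theorem loopDist_le {f : M → ℝ} {γ η : BasedLoopSpace g o} {δ : ℝ}
    (h1 : ∀ t : unitInterval, |f (γ.1 t) - f (η.1 t)| ≤ δ)
    (h2 : ∀ᵐ t ∂volume.restrict (Set.Icc (0 : ℝ) 1),
      |deriv (fun s => f (pathExtend γ.1 s)) t - deriv (fun s => f (pathExtend η.1 s)) t| ≤ δ) :
    loopDist f γ η ≤ ENNReal.ofReal δ + ENNReal.ofReal δ := by
  refine add_le_add (iSup_le fun t => ENNReal.ofReal_le_ofReal (h1 t)) ?_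
  refine (eLpNorm_le_of_ae_bound h2).trans_eq ?_
  simp

/-- The tube lemma in the form needed for uniform estimates along the compact images of polygons. -/
theorem eventually_forall_abs_sub_lt {X Z : Type*} [TopologicalSpace X] [TopologicalSpace Z]
    {K : Set Z} (hK : IsCompact K) {Θ : X → Z → ℝ} (hΘ : Continuous fun p : X × Z => Θ p.1 p.2)
    (x₀ : X) {δ : ℝ} (hδ : 0 < δ) : ∀ᶠ x in 𝓝 x₀, ∀ z ∈ K, |Θ x₀ z - Θ x z| < δ := by
  refine hK.eventually_forall_of_forall_eventually (P := fun x z => |Θ x₀ z - Θ x z| < δ)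
    fun z _ => ?_
  have h1 : Continuous fun p : X × Z => |Θ x₀ p.2 - Θ p.1 p.2| := by
    have : Continuous fun p : X × Z => Θ x₀ p.2 := hΘ.comp (continuous_const.prodMk continuous_snd)
    exact (this.sub hΘ).abs
  refine h1.continuousAt.eventually_lt continuousAt_const ?_
  simpa using hδ

end Criterion

/-- The point which divides a segment in the ratio `s : 1 - s`. -/
def lerp {V : Type*} [AddCommGroup V] [Module ℝ V] (s : ℝ) (z : V × V) : V :=
  (1 - s) • z.1 + s • z.2

theorem IsAffineAt.lerp {V : Type*} [AddCommGroup V] [Module ℝ V] {c : ℝ → V × V} {w : V × V}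
    {A : Set ℝ} {t : ℝ} (h : IsAffineAt c w A t) (s : ℝ) :
    IsAffineAt (fun t => _root_.lerp s (c t)) (_root_.lerp s w) A t := by
  filter_upwards [h] with r hr
  rw [hr, _root_.lerp, _root_.lerp, _root_.lerp, Prod.fst_add, Prod.snd_add, Prod.smul_fst,
    Prod.smul_snd]
  module

theorem IsPiecewiseAffineFamily.lerp {V : Type*} [AddCommGroup V] [Module ℝ V] {m : ℕ}
    {c : Fin (m + 1) → ℝ → V × V} {T : Set (V × V)} {B : Set ℝ}
    (h : IsPiecewiseAffineFamily c T B) (s : ℝ) :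
    IsPiecewiseAffineFamily (fun i t => _root_.lerp s (c i t)) (_root_.lerp s '' T) B where
  right t ht := by
    obtain ⟨i, hi, w, hw, h⟩ := h.right t ht
    exact ⟨i, hi, _, ⟨w, hw, rfl⟩, h.lerp s⟩
  left t ht := by
    obtain ⟨i, hi, w, hw, h⟩ := h.left t ht
    exact ⟨i, hi, _, ⟨w, hw, rfl⟩, h.lerp s⟩
  generic t ht hB := by
    obtain ⟨i, hi, w, hw, h⟩ := h.generic t ht hB
    exact ⟨i, hi, _, ⟨w, hw, rfl⟩, h.lerp s⟩

theorem Continuous.lerp {V X : Type*} [NormedAddCommGroup V] [NormedSpace ℝ V] [TopologicalSpace X]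
    {s : X → ℝ} {z : X → V × V} (hs : Continuous s) (hz : Continuous z) :
    Continuous fun x => _root_.lerp (s x) (z x) := by
  unfold _root_.lerp
  fun_prop

variable {n d m : ℕ} {G M V : Type*}
  [TopologicalSpace G] [ChartedSpace (EuclideanSpace ℝ (Fin n)) G] [Group G]
  [LieGroup (𝓡 n) ∞ G] [T2Space G]
  [TopologicalSpace M] [ChartedSpace (EuclideanSpace ℝ (Fin d)) M] [IsManifold (𝓡 d) ∞ M]
  [MulAction G M] [ContMDiffSMul (𝓡 n) (𝓡 d) ∞ G M]
  [NormedAddCommGroup V] [NormedSpace ℝ V] [FiniteDimensional ℝ V]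
  {ι : V →ₗ[ℝ] EuclideanSpace ℝ (Fin n)}

/-- All loops of the family share the breakpoints of the single pair `c` in `V × V`. Off these, both
`f ∘ γ` and its derivative are continuous functions of `x`, of a point in a compact image and of one
of finitely many slopes. Hence they vary uniformly, which bounds `loopDist`. -/
theorem continuous_of_isBrokenPath (hι : IsFlat G ι) {g : SmoothMetric d M} {o : M}
    {X : Type*} [TopologicalSpace X] {κ : X → Fin (m + 1) → G} (hκ : ∀ i, Continuous fun x => κ x i)
    {s : X → ℝ} (hs : Continuous s) {c : Fin (m + 1) → ℝ → V × V}
    (hc : ∀ i, ContinuousOn (c i) (partInterval i)) {T : Set (V × V)} {B : Set ℝ}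
    (hT : T.Finite) (hB : B.Finite) (hfam : IsPiecewiseAffineFamily c T B)
    {Φ : X → BasedLoopSpace g o}
    (hΦ : ∀ x, IsBrokenPath ι o (κ x) (fun i t => lerp (s x) (c i t)) (pathExtend (Φ x).1)) :
    Continuous Φ := by
  have : ContinuousMul G := continuousMul_of_contMDiffMul (𝓡 n) ∞
  have : ContinuousSMul G M := ContMDiffSMul.continuousSMul (I := 𝓡 n) (I' := 𝓡 d) ∞
  refine continuous_loopSpace_of_eventually fun f hf x₀ ε hε => ?_
  -- A finite radius is needed, as `ε` may be infinite; its halves serve the values and the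
  -- derivatives.
  obtain ⟨r, hr0, hrε⟩ := ENNReal.lt_iff_exists_nnreal_btwn.1 hε
  have hr : (0 : ℝ) < r := by exact_mod_cast hr0
  have hsum : ENNReal.ofReal ((r : ℝ) / 2) + ENNReal.ofReal ((r : ℝ) / 2) < ε := by
    rw [← ENNReal.ofReal_add (by positivity) (by positivity), add_halves, ENNReal.ofReal_coe_nnreal]
    exact hrε
  have hpt (i : Fin (m + 1)) : Continuous fun p : X × (V × V) =>
      κ p.1 i * modelExp G (ι (lerp (s p.1) p.2)) :=
    ((hκ i).comp continuous_fst).mul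
      (hι.continuous.comp ((hs.comp continuous_fst).lerp continuous_snd))
  have hψ : Continuous (leftDeriv n fun h : G => f (h • o)) := by
    rw [← continuousOn_univ]
    exact continuousOn_leftDeriv isOpen_univ
      (hf.comp (contMDiff_smul_basepoint n d o)).contMDiffOn
  have hK (i) : IsCompact (c i '' partInterval i) := isCompact_Icc.image_of_continuousOn (hc i)
  have h1 : ∀ᶠ x in 𝓝 x₀, ∀ i, ∀ z ∈ c i '' partInterval i,
      |f ((κ x₀ i * modelExp G (ι (lerp (s x₀) z))) • o) -
        f ((κ x i * modelExp G (ι (lerp (s x) z))) • o)| < (r : ℝ) / 2 :=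
    eventually_all.2 fun i => eventually_forall_abs_sub_lt
      (Θ := fun x z => f ((κ x i * modelExp G (ι (lerp (s x) z))) • o)) (hK i)
      (hf.continuous.comp ((hpt i).smul continuous_const)) x₀ (by positivity)
  have h2 : ∀ᶠ x in 𝓝 x₀, ∀ i, ∀ w ∈ T, ∀ z ∈ c i '' partInterval i,
      |leftDeriv n (fun h : G => f (h • o)) (κ x₀ i * modelExp G (ι (lerp (s x₀) z)))
          (ι (lerp (s x₀) w)) -
        leftDeriv n (fun h : G => f (h • o)) (κ x i * modelExp G (ι (lerp (s x) z)))
          (ι (lerp (s x) w))| < (r : ℝ) / 2 := by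
    refine eventually_all.2 fun i => (eventually_all_finite hT).2 fun w _ => ?_
    refine eventually_forall_abs_sub_lt (Θ := fun x z => leftDeriv n (fun h : G => f (h • o))
      (κ x i * modelExp G (ι (lerp (s x) z))) (ι (lerp (s x) w))) (hK i) ?_ x₀ (by positivity)
    exact (hψ.comp (hpt i)).clm_apply ((LinearMap.continuous_of_finiteDimensional ι).comp
      ((hs.comp continuous_fst).lerp continuous_const))
  filter_upwards [h1, h2] with x hx1 hx2
  refine (loopDist_le (fun t => ?_) ?_).trans_lt hsum
  · obtain ⟨i, hi⟩ := exists_mem_partInterval m t.2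
    have hval (x) : (Φ x).1 t = (κ x i * modelExp G (ι (lerp (s x) (c i t)))) • o := by
      rw [← hΦ x i t hi, pathExtend, Set.projIcc_val]
    rw [hval, hval]
    exact (hx1 i _ ⟨t, hi, rfl⟩).le
  · have h0 : ∀ᵐ t : ℝ, t ∉ B ∪ {0, 1} :=
      (hB.union (Set.toFinite {0, 1})).countable.ae_notMem _
    filter_upwards [ae_restrict_of_ae h0, ae_restrict_mem measurableSet_Icc] with t ht ht01
    simp only [Set.mem_union, Set.mem_insert_iff, Set.mem_singleton_iff, not_or] at ht
    obtain ⟨i, hi, w, hw, hiw⟩ := hfam.generic t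
      ⟨lt_of_le_of_ne ht01.1 (Ne.symm ht.2.1), lt_of_le_of_ne ht01.2 ht.2.2⟩ ht.1
    have hder (x) := ((hΦ x).hasDerivWithinAt (d := d) hι (Set.mem_univ t) hi (hiw.lerp (s x))
      (φ := f) (hf.mdifferentiableAt (by simp)))
    simp only [hasDerivWithinAt_univ] at hder
    rw [(hder x₀).deriv, (hder x).deriv]
    exact (hx2 i w hw _ ⟨t, mem_of_mem_nhdsWithin (Set.mem_univ t) hi, rfl⟩).le

/-- Two families of polygons define a continuous family of loops. -/
theorem exists_loop_family (S : SymmetricSpace n d G M) (hι : IsFlat G ι) {P : Fin m → Set V}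
    (hP : ∀ i, ∃ (α : Module.Dual ℝ V) (k : ℝ), P i = {x | α x = k})
    {c c' : Fin (m + 1) → ℝ → V} (hc : IsPolygonFamily P c) (hc' : IsPolygonFamily P c')
    {X : Type*} [TopologicalSpace X] {k : X → Fin m → G} (hk : ∀ i, Continuous fun x => k x i)
    (hko : ∀ x i, k x i • S.o = S.o)
    (hkP : ∀ x i, ∀ y ∈ P i, k x i • modelExp G (ι y) • S.o = modelExp G (ι y) • S.o) :
    ∃ Φ : C(X × unitInterval, BasedLoopSpace S.g S.o), ∀ x,
      IsBrokenPath ι S.o (Fin.partialProd (k x.1)) (fun i t => lerp (x.2 : ℝ) (c i t, c' i t))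
        (pathExtend (Φ x).1) := by
  have : ContinuousMul G := continuousMul_of_contMDiffMul (𝓡 n) ∞
  have : ContinuousSMul G M := ContMDiffSMul.continuousSMul (I := 𝓡 n) (I' := 𝓡 d) ∞
  have hm : (m : ℝ) + 1 ≠ 0 := by positivity
  set C : Fin (m + 1) → ℝ → V × V := fun i t => (c i t, c' i t) with hC
  have hCc (i) : ContinuousOn (C i) (partInterval i) :=
    (hc.polygon i).continuousOn.prodMk (hc'.polygon i).continuousOn
  obtain ⟨T, B, hT, hB, hfam⟩ := isPiecewiseAffineFamily (c := C) fun i => by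
    obtain ⟨S₁, B₁, h1, h2, h3⟩ := (hc.polygon i).isPiecewiseAffineOn
    obtain ⟨S₂, B₂, h4, h5, h6⟩ := (hc'.polygon i).isPiecewiseAffineOn
    exact ⟨_, _, h1.prod h4, h2.union h5, h3.prodMk h6⟩
  have hpath (x : X × unitInterval) := exists_path_of_isBrokenPath hι (o := S.o)
    (κ := Fin.partialProd (k x.1)) (C := fun i t => lerp (x.2 : ℝ) (C i t))
    (fun i => by
      have h1 := hCc i
      unfold lerp
      fun_prop)
    (fun i => by
      -- An affine plane contains the segment between the two joints, so `k x.1 i` fixes the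
      -- interpolated joint and the pieces fit together.
      have hy : lerp (x.2 : ℝ) (C i.succ ((i + 1) / (m + 1))) ∈ P i := by
        have h1 := hc.mem_plane i
        have h2 := hc'.mem_plane i
        obtain ⟨α, a, h⟩ := hP i
        rw [h, Set.mem_ofPred_eq] at h1 h2 ⊢
        rw [lerp, map_add, map_smul, map_smul, h1, h2, smul_eq_mul, smul_eq_mul]
        ring
      have hjoint : C i.castSucc ((i + 1) / (m + 1)) = C i.succ ((i + 1) / (m + 1)) :=
        Prod.ext (hc.joint i) (hc'.joint i)
      simp only [hjoint]
      rw [Fin.partialProd_succ, mul_smul, mul_smul, mul_smul, hkP x.1 i _ hy])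
  choose γ hγ using hpath
  have hstart (x) : (γ x) 0 = S.o := by
    have h1 := hγ x 0 0 (by simp [partInterval]; positivity)
    rw [pathExtend, Set.projIcc_of_mem zero_le_one ⟨le_rfl, zero_le_one⟩] at h1
    refine h1.trans ?_
    simp [hC, hc.start, hc'.start, lerp, modelExp_zero]
  have hend (x) : (γ x) 1 = S.o := by
    have h1 := hγ x (Fin.last m) 1 (by
      simp only [partInterval, Fin.val_last, div_self hm, Set.mem_Icc, le_refl, and_true]
      rw [div_le_one (by positivity)]
      linarith)
    rw [pathExtend, Set.projIcc_of_mem zero_le_one ⟨zero_le_one, le_rfl⟩] at h1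
    refine h1.trans ?_
    have h2 (j : Fin (m + 1)) : Fin.partialProd (k x.1) j • S.o = S.o := by
      induction j using Fin.induction with
      | zero => simp
      | succ j ih => rw [Fin.partialProd_succ, mul_smul, hko, ih]
    simp [hC, hc.finish, hc'.finish, lerp, modelExp_zero, h2]
  have hlerp (s : ℝ) := hfam.lerp s
  let Φ : X × unitInterval → BasedLoopSpace S.g S.o := fun x => ⟨γ x,
    (hγ x).isAbsContPath hι (fun i => by
      have h1 := hCc i
      unfold lerp
      fun_prop) (hT.image _) (hlerp x.2),
    (hγ x).energy_lt_top S hι (hT.image _) hB (hlerp x.2), hstart x, hend x⟩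
  have hκ (i : Fin (m + 1)) : Continuous fun x : X × unitInterval => Fin.partialProd (k x.1) i := by
    induction i using Fin.induction with
    | zero => simpa using continuous_const
    | succ j ih =>
      simp only [Fin.partialProd_succ]
      exact ih.mul ((hk j).comp continuous_fst)
  exact ⟨⟨Φ, continuous_of_isBrokenPath hι hκ (continuous_subtype_val.comp continuous_snd) hCc hT hB
    hfam (Φ := Φ) hγ⟩, hγ⟩

end LoopFamilies

/-! ## The classes `P_*` -/

section BottSamelson

open Filter Topology

variable {n d m : ℕ} {G M : Type*}
  [TopologicalSpace G] [ChartedSpace (EuclideanSpace ℝ (Fin n)) G] [Group G]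
  [LieGroup (𝓡 n) ∞ G] [T2Space G]
  [TopologicalSpace M] [ChartedSpace (EuclideanSpace ℝ (Fin d)) M] [IsManifold (𝓡 d) ∞ M]
  [MulAction G M] [ContMDiffSMul (𝓡 n) (𝓡 d) ∞ G M]

/-- The subalgebra `𝔞`, as a subspace of the model space. -/
abbrev modelSubspace (𝔞 : Submodule ℝ (GroupLieAlgebra (𝓡 n) G)) :
    Submodule ℝ (EuclideanSpace ℝ (Fin n)) := 𝔞

theorem SymmetricSpace.IsAbelianIn.isFlat {S : SymmetricSpace n d G M}
    {𝔞 : Submodule ℝ (GroupLieAlgebra (𝓡 n) G)} (h : S.IsAbelianIn 𝔞) :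
    IsFlat G (modelSubspace 𝔞).subtype :=
  fun x y => h.2 x.1 x.2 y.1 y.2

/-- The product telescopes: the action of `h` multiplies the `i`-th partial product by `h i` on the
right. As $K_0$ fixes the torus pointwise, the loops depend on the orbit only. -/
theorem SymmetricSpace.SameOrbit.partialProd_eq {S : SymmetricSpace n d G M}
    {𝔞 : Submodule ℝ (GroupLieAlgebra (𝓡 n) G)} {P : Fin m → Set 𝔞} {k k' : S.W 𝔞 P}
    (h : S.SameOrbit 𝔞 P k k') (i : Fin (m + 1)) :
    ∃ a ∈ S.K₀ 𝔞, Fin.partialProd (fun j => (k' j : G)) i =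
      Fin.partialProd (fun j => (k j : G)) i * a := by
  obtain ⟨h, h0, hk⟩ := h
  refine ⟨h i, (h i).2, ?_⟩
  induction i using Fin.induction with
  | zero => simp [h0]
  | succ j ih =>
    rw [Fin.partialProd_succ, Fin.partialProd_succ, ih, hk]
    group

theorem SymmetricSpace.smul_Exp_of_mem_fixing {S : SymmetricSpace n d G M}
    {𝔞 : Submodule ℝ (GroupLieAlgebra (𝓡 n) G)} {p : Set 𝔞} {a : G} (ha : a ∈ S.fixing 𝔞 p)
    {H : 𝔞} (hH : H ∈ p) : a • S.Exp H = S.Exp H :=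
  (mem_fixingSubgroup_iff G).1 ha.2 _ ⟨H, hH, rfl⟩

/-- Two families of polygons define a homotopy of maps `Γ_P → Ω_o M`. -/
theorem SymmetricSpace.exists_homotopy (S : SymmetricSpace n d G M)
    {𝔞 : Submodule ℝ (GroupLieAlgebra (𝓡 n) G)} (h𝔞 : S.IsAbelianIn 𝔞)
    {P : Fin m → Set 𝔞} (hP : ∀ i, ∃ (α : Module.Dual ℝ 𝔞) (k : ℝ), P i = {x | α x = k})
    {c c' : Fin (m + 1) → ℝ → 𝔞} (hc : IsPolygonFamily P c) (hc' : IsPolygonFamily P c') :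
    ∃ f f' : C(S.Γ 𝔞 P, BasedLoopSpace S.g S.o), f.Homotopic f' ∧
      S.IsBottSamelsonMap 𝔞 P c f ∧ S.IsBottSamelsonMap 𝔞 P c' f' := by
  obtain ⟨Φ, hΦ⟩ := exists_loop_family (V := modelSubspace 𝔞) (P := P) (c := c) (c' := c') S
    h𝔞.isFlat hP hc hc' (X := S.W 𝔞 P) (k := fun k i => (k i : G))
    (fun i => continuous_subtype_val.comp (continuous_apply i)) (fun k i => (k i).2.1)
    (fun k i y hy => S.smul_Exp_of_mem_fixing (k i).2 hy)
  have hval (k : S.W 𝔞 P) (s : unitInterval) (i : Fin (m + 1)) (t : unitInterval)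
      (ht : (t : ℝ) ∈ partInterval i) : (Φ (k, s)).1 t =
        Fin.partialProd (fun j => (k j : G)) i • S.Exp (lerp (s : ℝ) (c i t, c' i t) : 𝔞) := by
    have h1 := hΦ (k, s) i t ht
    rw [pathExtend, Set.projIcc_val] at h1
    exact h1.trans (mul_smul _ _ _)
  have hinv (k k' : S.W 𝔞 P) (h : S.SameOrbit 𝔞 P k k') (s : unitInterval) :
      Φ (k, s) = Φ (k', s) := by
    refine Subtype.ext (ContinuousMap.ext fun t => ?_)
    obtain ⟨i, hi⟩ := exists_mem_partInterval m t.2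
    obtain ⟨a, ha, hka⟩ := h.partialProd_eq i
    rw [hval k s i t hi, hval k' s i t hi, hka, mul_smul,
      S.smul_Exp_of_mem_fixing ha (Set.mem_univ _)]
  let F : S.Γ 𝔞 P × unitInterval → BasedLoopSpace S.g S.o := fun p =>
    Quot.lift (fun k => Φ (k, p.2)) (fun k k' h => hinv k k' h p.2) p.1
  -- The product of a quotient map with the locally compact unit interval is a quotient map, so the
  -- homotopy descends to $\Gamma_P$.
  have hF : Continuous F :=
    isQuotientMap_quot_mk.continuous_lift_prod_left (f := Quot.mk (S.SameOrbit 𝔞 P)) Φ.continuous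
  let H : ContinuousMap.Homotopy
      (⟨fun q => F (q, 0), hF.comp (by fun_prop)⟩ : C(S.Γ 𝔞 P, BasedLoopSpace S.g S.o))
      ⟨fun q => F (q, 1), hF.comp (by fun_prop)⟩ :=
    { toFun := fun p => F (p.2, p.1)
      continuous_toFun := hF.comp (by fun_prop)
      map_zero_left := fun _ => rfl
      map_one_left := fun _ => rfl }
  refine ⟨_, _, ⟨H⟩, fun k i t ht => ?_, fun k i t ht => ?_⟩
  · refine (hval k 0 i t ht).trans ?_
    simp [lerp]
  · refine (hval k 1 i t ht).trans ?_
    simp [lerp]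

/-- A family of polygons which meets the lattice only at its ends defines loops which return to
the basepoint only at the ends. -/
theorem SymmetricSpace.IsBottSamelsonMap.preimage_subset {S : SymmetricSpace n d G M}
    {𝔞 : Submodule ℝ (GroupLieAlgebra (𝓡 n) G)} {P : Fin m → Set 𝔞} {c : Fin (m + 1) → ℝ → 𝔞}
    {f : S.Γ 𝔞 P → BasedLoopSpace S.g S.o} (hf : S.IsBottSamelsonMap 𝔞 P c f)
    (hc : ∀ i, ∀ t ∈ partInterval i, t ∈ Set.Ioo (0 : ℝ) 1 → S.Exp (c i t) ≠ S.o)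
    (q : S.Γ 𝔞 P) : (f q).1 ⁻¹' {S.o} ⊆ {0, 1} := by
  obtain ⟨k, rfl⟩ := Quot.exists_rep q
  intro t ht
  by_contra hcon
  rw [Set.mem_insert_iff, Set.mem_singleton_iff, not_or] at hcon
  have ht01 : (t : ℝ) ∈ Set.Ioo (0 : ℝ) 1 :=
    ⟨lt_of_le_of_ne t.2.1 fun h => hcon.1 (Subtype.ext h.symm),
      lt_of_le_of_ne t.2.2 fun h => hcon.2 (Subtype.ext h)⟩
  obtain ⟨i, hi⟩ := exists_mem_partInterval m t.2
  have hfix (j : Fin (m + 1)) : Fin.partialProd (fun j => (k j : G)) j • S.o = S.o := by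
    induction j using Fin.induction with
    | zero => simp
    | succ j ih => rw [Fin.partialProd_succ, mul_smul, (k j).2.1, ih]
  have h1 : (f (Quot.mk _ k)).1 t = S.o := ht
  rw [hf k i t hi] at h1
  refine hc i t hi ht01 (MulAction.injective (Fin.partialProd (fun j => (k j : G)) i) ?_)
  exact h1.trans (hfix i).symm

/-- The intersection multiplicity of the classes `P_*`. -/
theorem SymmetricSpace.intersectionMultiplicity_pushforward (S : SymmetricSpace n d G M)
    {𝔞 : Submodule ℝ (GroupLieAlgebra (𝓡 n) G)} {P : Fin m → Set 𝔞}
    {f f' : C(S.Γ 𝔞 P, BasedLoopSpace S.g S.o)} (h : f.Homotopic f')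
    (hf' : ∀ q, (f' q).1 ⁻¹' {S.o} ⊆ {0, 1})
    (R : Type*) [CommRing R] (q : ℕ) (μ : SingHomology R (S.Γ 𝔞 P) q) :
    intersectionMultiplicity R (pushforward R f q μ) ≤ 1 ∧
      (toRelative R (constantLoop S.g S.o) q (pushforward R f q μ) ≠ 0 →
        intersectionMultiplicity R (pushforward R f q μ) = 1) := by
  have hle : intersectionMultiplicity R (pushforward R f q μ) ≤ 1 := by
    rw [pushforward_eq_of_homotopic R h]
    obtain ⟨A, hA, hrange⟩ := exists_cycle_pushforward R f' μ
    rw [← hA]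
    refine intersectionMultiplicity_le_one R A fun γ hγ => ?_
    obtain ⟨x, rfl⟩ := hrange hγ
    exact hf' x
  exact ⟨hle, fun h0 => le_antisymm hle (one_le_intersectionMultiplicity R _ h0)⟩

/-- These vectors form the lattice of the flat `𝔞`, a closed subgroup without lines. -/
theorem SymmetricSpace.countable_setOf_Exp_eq [T2Space M] (S : SymmetricSpace n d G M)
    {𝔞 : Submodule ℝ (GroupLieAlgebra (𝓡 n) G)} (h𝔞 : S.IsAbelianIn 𝔞) :
    {H : 𝔞 | S.Exp H = S.o}.Countable := by
  have : ContinuousSMul G M := ContMDiffSMul.continuousSMul (I := 𝓡 n) (I' := 𝓡 d) ∞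
  exact h𝔞.isFlat.countable_lattice S (modelSubspace 𝔞).subtype_injective
    fun x => h𝔞.1 x.1 x.2

end BottSamelson

end

theorem proposition6p2 {n d : ℕ} {G M : Type*}
    [TopologicalSpace G] [ChartedSpace (EuclideanSpace ℝ (Fin n)) G] [Group G]
    [LieGroup (𝓡 n) ∞ G] [T2Space G] [CompactSpace G] [ConnectedSpace G]
    [TopologicalSpace M] [ChartedSpace (EuclideanSpace ℝ (Fin d)) M] [IsManifold (𝓡 d) ∞ M]
    [T2Space M] [CompactSpace M] [SimplyConnectedSpace M]
    [MulAction G M] [ContMDiffSMul (𝓡 n) (𝓡 d) ∞ G M] [MulAction.IsPretransitive G M]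
    (S : SymmetricSpace n d G M)
    (𝔞 : Submodule ℝ (GroupLieAlgebra (𝓡 n) G)) (h𝔞 : S.IsMaximalAbelian 𝔞)
    (hrank : 2 ≤ Module.finrank ℝ 𝔞)
    (𝔥 : LieSubalgebra ℂ (ℂ ⊗[ℝ] GroupLieAlgebra (𝓡 n) G)) (h𝔥 : 𝔥.IsCartanSubalgebra)
    (h𝔞𝔥 : ∀ H ∈ 𝔞, (1 : ℂ) ⊗ₜ[ℝ] H ∈ 𝔥)
    {m : ℕ} (P : Fin m → Set 𝔞) (hP : ∀ i, IsSingularPlane 𝔞 𝔥 (P i))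
    (c : Fin (m + 1) → ℝ → 𝔞) (hc : IsPolygonFamily P c) :
    ∃ f : C(S.Γ 𝔞 P, BasedLoopSpace S.g S.o), S.IsBottSamelsonMap 𝔞 P c f ∧
      (∀ (q : ℕ) (μ : SingHomology (ZMod 2) (S.Γ 𝔞 P) q), IsFundamentalClass (ZMod 2) μ →
        intersectionMultiplicity (ZMod 2) (pushforward (ZMod 2) f q μ) ≤ 1 ∧
        (toRelative (ZMod 2) (constantLoop S.g S.o) q (pushforward (ZMod 2) f q μ) ≠ 0 →
          intersectionMultiplicity (ZMod 2) (pushforward (ZMod 2) f q μ) = 1)) ∧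
      (∀ (R : Type u) [CommRing R] (q : ℕ) (μ : SingHomology R (S.Γ 𝔞 P) q),
        IsFundamentalClass R μ →
        intersectionMultiplicity R (pushforward R f q μ) ≤ 1 ∧
        (toRelative R (constantLoop S.g S.o) q (pushforward R f q μ) ≠ 0 →
          intersectionMultiplicity R (pushforward R f q μ) = 1)) := by
  have hP' (i) : ∃ (α : Module.Dual ℝ 𝔞) (k : ℝ), P i = {x | α x = k} := by
    obtain ⟨α, k, -, h⟩ := hP i
    exact ⟨α, k, h⟩
  -- Here rank at least 2 enters: in rank one a plane is a point, which may lie in the lattice, and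
  -- a segment cannot go around lattice points.
  obtain ⟨c', hc', hav⟩ := hc.exists_avoiding hrank (S.countable_setOf_Exp_eq h𝔞.1) hP'
  obtain ⟨f, f', hff', hf, hf'⟩ := S.exists_homotopy h𝔞.1 hP' hc hc'
  have hpre := hf'.preimage_subset hav
  exact ⟨f, hf, fun q μ _ => S.intersectionMultiplicity_pushforward hff' hpre (ZMod 2) q μ,
    fun R _ q μ _ => S.intersectionMultiplicity_pushforward hff' hpre R q μ⟩
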